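/- Let $a,b,c\in\mathbb R$ with $c\neq0$, $\nu\ge1$, $l\in\mathbb R\setminus\{0\}$, and integers $M,N\ge1$. Consider the vector field on $\mathbb R^4$ $$g(u)=(u_2,\,-au_1+bu_3u_1+cu_1^3,\,u_4,\,-4u_3)$$ and its periodic orbit $\gamma(\theta)=(0,0,\cos2\theta,-2\sin2\theta)$. **Spaces.** Let $S_F$ be the space of $s=(s_m)_{m\in\mathbb Z}\subset\mathbb C$ with $\|s\|_F=\sum_m|s_m|\nu^{|m|}<\infty$, with convolution $*_F$; let $S_{TF}$ be the space of $p=(p_n)_{n\ge0}$, $p_n\in S_F$, with $\|p\|_{TF}=\sum_n\|p_n\|_F<\infty$, with the Cauchy product $(p*q)_n=\sum_{k=0}^n p_k*_Fq_{n-k}$; and $X=S_{TF}^2$ with $\|w\|_X=\max\{\|w^{(1)}\|_{TF},\|w^{(2)}\|_{TF}\}$; $\|\cdot\|_{B(X)}$ is the operator norm. For sets $R,S$ of nonnegative integers let $\Pi_{R,S}$ set to zero all coefficients except those with $n\in R$, $|m|\in S$. Let $\gamma^{(3)},\gamma^{(4)}$ also denote the Fourier coefficient sequences of $\cos2\theta,-2\sin2\theta$,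 regarded as elements of $S_{TF}$ concentrated in $n=0$. **Bundle solution.** Let $\lambda<0$ be real and $v=(v^{(1)},v^{(2)})\in S_F^2$ satisfy, for all $m\in\mathbb Z$, $$(im+\lambda)v^{(1)}_m=v^{(2)}_m,\qquad (im+\lambda)v^{(2)}_m=-av^{(1)}_m+b(\gamma^{(3)}*_Fv^{(1)})_m,$$ and the phase condition $\sum_{|m|\le M}v^{(1)}_m=l$. Suppose $(\bar\lambda,\bar v)$ satisfies $\max\{|\lambda-\bar\lambda|,\|v^{(1)}-\bar v^{(1)}\|_F,\|v^{(2)}-\bar v^{(2)}\|_F\}\le r_F$. **Validation map.** For $w\in X$ put $$f(w)=\bigl(w^{(2)},\,-aw^{(1)}+b\,\gamma^{(3)}*w^{(1)}+c\,w^{(1)}*w^{(1)}*w^{(1)}\bigr),$$ and $F(w)_{0,m}=w_{0,m}$, $F(w)_{1,m}=w_{1,m}-v_m$, $F(w)_{n,m}=(im+n\lambda)w_{n,m}-f(w)_{n,m}$ for $n\ge2$. Write $DF(w)$ for its derivative, and $L_\lambda^{-1}$ for the diagonal operator that is the identity on $n=0,1$ and multiplies by $(im+n\lambda)^{-1}$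 for $n\ge2$. Let $\bar w=\Pi_{[0,N],[0,M]}\bar w$ with $\bar w_0=0$, $\bar w_1=\bar v$, let $\bar A$ be any complex matrix acting on the block $n\le N$, $|m|\le M$ (in practice a numerical inverse of the truncated $DF(\bar w)$), and $A_f=\Pi_{[0,N],[0,M]}\bar A\,\Pi_{[0,N],[0,M]}$. Define $$Y=r_F\|A_f\|_{B(X)}+\|A_f\Pi_{[2,N],[0,M]}F(\bar w)\|_X+r_F+\|\Pi_{(N,3N],[0,3M]}L_\lambda^{-1}F(\bar w)\|_X+\|\Pi_{[2,N],(M,3M]}L_\lambda^{-1}F(\bar w)\|_X,$$ $$\kappa=\frac1{\sqrt{4\lambda^2+(M+1)^2}}+\frac1{|\lambda|(N+1)},$$ $$Z_1=\|\Pi_{[0,N],[0,M]}-A_fDF(\bar w)\Pi_{[0,3N],[0,3M]}\|_{B(X)}+\kappa\,\max\bigl\{1,\ |a|+|b|\nu^2+3|c|\,\|\bar w^{(1)}*\bar w^{(1)}\|_{TF}\bigr\},$$ $$Z_2(r)=3|c|\,\bigl(\|A_f\|_{B(X)}+\kappa\bigr)\bigl(2\|\bar w^{(1)}\|_{TF}+r\bigr).$$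 **Theorem.** Suppose that for some $r^*>0$, with $Z_2=Z_2(r^*)$, $$Z_1<1,\qquad 2YZ_2<(1-Z_1)^2,\qquad r_{TF}:=\frac{1-Z_1-\sqrt{(1-Z_1)^2-2YZ_2}}{Z_2}\le r^*.$$ Then $F$ has exactly one zero $w$ in the closed ball $\{w\in X:\|w-\bar w\|_X\le r_{TF}\}$. If moreover $\bar w^{(i)}_{n,k}=\overline{\bar w^{(i)}_{n,-k}}$ for $i=1,2$ and all $n,k$, then $V(\theta)=\bigl(\sum_mv^{(1)}_me^{im\theta},\sum_mv^{(2)}_me^{im\theta},0,0\bigr)$ is real, and, with $w^{(3)}=\gamma^{(3)}$, $w^{(4)}=\gamma^{(4)}$, the function $$W(\theta,\sigma)=\sum_{n\ge0}\sum_{m\in\mathbb Z}w_{n,m}e^{im\theta}\sigma^n,\qquad \theta\in\mathbb R/2\pi\mathbb Z,\ \sigma\in[-1,1],$$ is real valued and parameterizes a local stable manifold of $\gamma$, in the following sense. It is $C^1$ and injective in $\sigma$ for each $\theta$. It satisfies $\partial_\theta W+\lambda\sigma\,\partial_\sigma W=g(W)$, $W(\theta,0)=\gamma(\theta)$ and $\partial_\sigma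 W(\theta,0)=V(\theta)$. For $t\ge0$, $t\mapsto W(\theta+t,e^{\lambda t}\sigma)$ is the trajectory of $U'=g(U)$ starting at $W(\theta,\sigma)$. Its image is contained in the stable manifold $W^s(\gamma)$ (the set of points whose forward trajectory converges to $\gamma$), and for some neighbourhood $O$ of $\gamma$ it contains every point whose forward trajectory stays in $O$ and converges to $\gamma$. Finally, for $i=1,2$ and all $\theta\in\mathbb R$, $\sigma\in[-1,1]$, $$\Bigl|W^{(i)}(\theta,\sigma)-\sum_{n=0}^N\sum_{m=-M}^M\bar w^{(i)}_{n,m}e^{im\theta}\sigma^n\Bigr|\le r_{TF}.$$ -/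

import Mathlib

open Real Set Filter Topology

namespace GrossPitaevskii

/-! ### The four-dimensional system and its periodic orbit -/

/-- The autonomous polynomial vector field `g` on `ℝ⁴`. Components are numbered from `0`. -/
noncomputable def field (a b c : ℝ) (u : Fin 4 → ℝ) : Fin 4 → ℝ :=
  ![u 1, -a * u 0 + b * u 2 * u 0 + c * u 0 ^ 3, u 3, -4 * u 2]

/-- The periodic solution `γ(θ) = (0, 0, cos 2θ, -2 sin 2θ)`. -/
noncomputable def gammaCurve (θ : ℝ) : Fin 4 → ℝ :=
  ![0, 0, Real.cos (2 * θ), -2 * Real.sin (2 * θ)]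

/-- The periodic orbit `γ` as a set. -/
noncomputable def gammaOrbit : Set (Fin 4 → ℝ) := gammaCurve '' Set.Ico 0 Real.pi

/-- `U` restricted to `[0, ∞)` is the trajectory of `U' = g(U)` that starts at `p`. -/
def IsForwardOrbit (g : (Fin 4 → ℝ) → (Fin 4 → ℝ)) (U : ℝ → Fin 4 → ℝ) (p : Fin 4 → ℝ) : Prop :=
  U 0 = p ∧ ∀ t, 0 ≤ t → HasDerivWithinAt U (g (U t)) (Set.Ici 0) t

/-- The stable manifold `W^s(Γ)`: points whose forward orbit converges to `Γ`. -/
def stableSet (g : (Fin 4 → ℝ) → (Fin 4 → ℝ)) (Γ : Set (Fin 4 → ℝ)) : Set (Fin 4 → ℝ) :=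
  {p | ∃ U : ℝ → Fin 4 → ℝ, IsForwardOrbit g U p ∧
    Tendsto (fun t => Metric.infDist (U t) Γ) atTop (𝓝 0)}

/-- The part of `W^s(Γ)` that is local with respect to `O`: points whose forward orbit stays in
`O` and converges to `Γ`. -/
def localStableSet (g : (Fin 4 → ℝ) → (Fin 4 → ℝ)) (Γ O : Set (Fin 4 → ℝ)) :
    Set (Fin 4 → ℝ) :=
  {p | ∃ U : ℝ → Fin 4 → ℝ, IsForwardOrbit g U p ∧ (∀ t, 0 ≤ t → U t ∈ O) ∧
    Tendsto (fun t => Metric.infDist (U t) Γ) atTop (𝓝 0)}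

/-- `W : S¹ × [-1, 1] → ℝ⁴` (with `S¹ = ℝ/2πℤ`, written as a `2π`-periodic dependence on `θ`)
parameterizes a local stable manifold of the orbit `Γ` of the solution `γ`, with stable exponent
`lam` and stable bundle `V`. At `σ = ±1` the derivative in `σ` is the one-sided one. -/
structure IsLocalStableParam (g : (Fin 4 → ℝ) → (Fin 4 → ℝ)) (γ : ℝ → Fin 4 → ℝ)
    (Γ : Set (Fin 4 → ℝ)) (lam : ℝ) (V : ℝ → Fin 4 → ℝ) (W : ℝ → ℝ → Fin 4 → ℝ) : Prop where
  periodic : ∀ θ : ℝ, ∀ σ ∈ Set.Icc (-1 : ℝ) 1, W (θ + 2 * Real.pi) σ = W θ σ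
  contDiffOn : ContDiffOn ℝ 1 (fun p : ℝ × ℝ => W p.1 p.2) (Set.univ ×ˢ Set.Icc (-1 : ℝ) 1)
  injOn : ∀ θ : ℝ, Set.InjOn (W θ) (Set.Icc (-1 : ℝ) 1)
  /-- The invariance equation `∂_θ W + λ σ ∂_σ W = g(W)`. -/
  invariance : ∀ θ : ℝ, ∀ σ ∈ Set.Icc (-1 : ℝ) 1,
    deriv (fun s => W s σ) θ + (lam * σ) • derivWithin (W θ) (Set.Icc (-1 : ℝ) 1) σ = g (W θ σ)
  /-- The first order constraints `W(θ, 0) = γ(θ)` and `∂_σ W(θ, 0) = V(θ)`. -/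
  zeroth_order : ∀ θ : ℝ, W θ 0 = γ θ
  first_order : ∀ θ : ℝ, deriv (W θ) 0 = V θ
  /-- The conjugacy `φ(W(θ, σ), t) = W(θ + t, e^{λ t} σ)` for `t ≥ 0`. -/
  conjugacy : ∀ θ : ℝ, ∀ σ ∈ Set.Icc (-1 : ℝ) 1,
    IsForwardOrbit g (fun t => W (θ + t) (Real.exp (lam * t) * σ)) (W θ σ)
  /-- The image lies in `W^s(Γ)` and contains everything in `W^s(Γ)` that is local with respect
  to some neighbourhood of `Γ`. -/
  image_subset : {p | ∃ θ : ℝ, ∃ σ ∈ Set.Icc (-1 : ℝ) 1, p = W θ σ} ⊆ stableSet g Γ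
  subset_image : ∃ O : Set (Fin 4 → ℝ), IsOpen O ∧ Γ ⊆ O ∧
    localStableSet g Γ O ⊆ {p | ∃ θ : ℝ, ∃ σ ∈ Set.Icc (-1 : ℝ) 1, p = W θ σ}

/-! ### Fourier and Taylor–Fourier sequence spaces -/

/-- Membership in `S_F` for the weight `ν`. -/
def MemF (ν : ℝ) (s : ℤ → ℂ) : Prop := Summable fun m : ℤ => ‖s m‖ * ν ^ m.natAbs

/-- The norm of `S_F`. -/
noncomputable def normF (ν : ℝ) (s : ℤ → ℂ) : ℝ := ∑' m : ℤ, ‖s m‖ * ν ^ m.natAbs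

/-- Membership in `S_TF`. -/
def MemTF (ν : ℝ) (p : ℕ → ℤ → ℂ) : Prop :=
  (∀ n, MemF ν (p n)) ∧ Summable fun n => normF ν (p n)

/-- The norm of `S_TF`. -/
noncomputable def normTF (ν : ℝ) (p : ℕ → ℤ → ℂ) : ℝ := ∑' n : ℕ, normF ν (p n)

/-- Membership in `X_TF = S_TF²`. -/
def MemX (ν : ℝ) (w : Fin 2 → ℕ → ℤ → ℂ) : Prop := ∀ i, MemTF ν (w i)

/-- The norm of `X_TF`. -/
noncomputable def normX (ν : ℝ) (w : Fin 2 → ℕ → ℤ → ℂ) : ℝ :=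
  max (normTF ν (w 0)) (normTF ν (w 1))

/-- The operator norm of `B(X_TF)`. -/
noncomputable def opNormX (ν : ℝ)
    (T : (Fin 2 → ℕ → ℤ → ℂ) → (Fin 2 → ℕ → ℤ → ℂ)) : ℝ :=
  sInf {C : ℝ | 0 ≤ C ∧ ∀ h, MemX ν h → normX ν (T h) ≤ C * normX ν h}

/-- Discrete convolution. -/
noncomputable def convF (s t : ℤ → ℂ) (m : ℤ) : ℂ := ∑' k : ℤ, s k * t (m - k)

/-- Taylor–Fourier Cauchy product. -/
noncomputable def convTF (p q : ℕ → ℤ → ℂ) (n : ℕ) (m : ℤ) : ℂ :=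
  ∑ l ∈ Finset.range (n + 1), convF (p l) (q (n - l)) m

/-- The function with Fourier coefficients `s`. -/
noncomputable def evalF (s : ℤ → ℂ) (θ : ℝ) : ℂ :=
  ∑' m : ℤ, s m * Complex.exp (Complex.I * m * θ)

/-- The function with Taylor–Fourier coefficients `p`. -/
noncomputable def evalTF (p : ℕ → ℤ → ℂ) (θ σ : ℝ) : ℂ :=
  ∑' n : ℕ, evalF (p n) θ * (σ : ℂ) ^ n

/-- Truncation to Taylor indices `n ∈ R` and Fourier indices `m` with `|m| ∈ S`. -/
def trunc (R S : Finset ℕ) (w : Fin 2 → ℕ → ℤ → ℂ) : Fin 2 → ℕ → ℤ → ℂ :=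
  fun i n m => if n ∈ R ∧ m.natAbs ∈ S then w i n m else 0

/-! ### Fourier coefficients of the periodic orbit -/

/-- Fourier coefficients of `γ⁽³⁾(θ) = cos 2θ`. -/
noncomputable def gamma3 (m : ℤ) : ℂ := if m = 2 ∨ m = -2 then 1 / 2 else 0

/-- Fourier coefficients of `γ⁽⁴⁾(θ) = -2 sin 2θ`. -/
noncomputable def gamma4 (m : ℤ) : ℂ :=
  if m = 2 then Complex.I else if m = -2 then -Complex.I else 0

/-- The Taylor–Fourier sequence whose Taylor coefficient of order `0` is `s` and whose other
Taylor coefficients vanish. -/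
def constTF (s : ℤ → ℂ) (n : ℕ) (m : ℤ) : ℂ := if n = 0 then s m else 0

/-- All four components: `w⁽¹⁾, w⁽²⁾` completed by those of `γ⁽³⁾, γ⁽⁴⁾`. -/
noncomputable def fullCoeff (w : Fin 2 → ℕ → ℤ → ℂ) : Fin 4 → ℕ → ℤ → ℂ :=
  ![w 0, w 1, constTF gamma3, constTF gamma4]

/-! ### The bundle problem -/

/-- The linear right-hand side `f(v)` of the bundle equation. -/
noncomputable def bundleRhs (a b : ℝ) (v : Fin 2 → ℤ → ℂ) : Fin 2 → ℤ → ℂ :=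
  ![v 1, fun m => -(a : ℂ) * v 0 m + (b : ℂ) * convF gamma3 (v 0) m]

/-- The bundle validation map `(λ, v) ↦ (η(v) - l, L_λ v - f(v))`. -/
noncomputable def bundleMap (a b l : ℝ) (M : ℕ) (lam : ℂ) (v : Fin 2 → ℤ → ℂ) :
    ℂ × (Fin 2 → ℤ → ℂ) :=
  ((∑ m ∈ Finset.Icc (-(M : ℤ)) M, v 0 m) - (l : ℂ),
    fun i m => (Complex.I * m + lam) * v i m - bundleRhs a b v i m)

/-! ### The Taylor–Fourier problem -/

/-- The nonlinear right-hand side `f(w)`. -/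
noncomputable def rhs (a b c : ℝ) (w : Fin 2 → ℕ → ℤ → ℂ) : Fin 2 → ℕ → ℤ → ℂ :=
  ![w 1, fun n m => -(a : ℂ) * w 0 n m + (b : ℂ) * convTF (constTF gamma3) (w 0) n m
    + (c : ℂ) * convTF (convTF (w 0) (w 0)) (w 0) n m]

/-- The derivative `Df(w) h`. -/
noncomputable def rhsDeriv (a b c : ℝ) (w h : Fin 2 → ℕ → ℤ → ℂ) : Fin 2 → ℕ → ℤ → ℂ :=
  ![h 1, fun n m => -(a : ℂ) * h 0 n m + (b : ℂ) * convTF (constTF gamma3) (h 0) n m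
    + 3 * (c : ℂ) * convTF (convTF (w 0) (w 0)) (h 0) n m]

/-- The Taylor–Fourier validation map `F`. For `n = 0` the constraint is `w⁽ⁱ⁾₀ = γ⁽ⁱ⁾ = 0`
(`i = 1, 2`), for `n = 1` it is `w⁽ⁱ⁾₁ = v⁽ⁱ⁾`. -/
noncomputable def tfMap (a b c lam : ℝ) (v : Fin 2 → ℤ → ℂ) (w : Fin 2 → ℕ → ℤ → ℂ) :
    Fin 2 → ℕ → ℤ → ℂ :=
  fun i n m =>
    if n = 0 then w i 0 m
    else if n = 1 then w i 1 m - v i m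
    else (Complex.I * m + n * (lam : ℂ)) * w i n m - rhs a b c w i n m

/-- The derivative `DF(w) h`. -/
noncomputable def tfMapDeriv (a b c lam : ℝ) (w h : Fin 2 → ℕ → ℤ → ℂ) : Fin 2 → ℕ → ℤ → ℂ :=
  fun i n m =>
    if n ≤ 1 then h i n m
    else (Complex.I * m + n * (lam : ℂ)) * h i n m - rhsDeriv a b c w h i n m

/-- The diagonal inverse `L_λ⁻¹`. -/
noncomputable def linInv (lam : ℝ) (w : Fin 2 → ℕ → ℤ → ℂ) : Fin 2 → ℕ → ℤ → ℂ :=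
  fun i n m => if n ≤ 1 then w i n m else (Complex.I * m + n * (lam : ℂ))⁻¹ * w i n m

/-- The finite part `A_f = Π Ā Π` of the approximate inverse, with
`Π = Π^T_{[0,N]} Π^F_{[0,M]}`. Only the entries of `Abar` with row and column index in the finite
block `n ≤ N`, `|m| ≤ M` are used. -/
noncomputable def finPart (N M : ℕ) (Abar : Matrix (Fin 2 × ℕ × ℤ) (Fin 2 × ℕ × ℤ) ℂ)
    (h : Fin 2 → ℕ → ℤ → ℂ) : Fin 2 → ℕ → ℤ → ℂ :=
  trunc (Finset.Icc 0 N) (Finset.Icc 0 M) fun i n m =>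
    ∑ j : Fin 2, ∑ n' ∈ Finset.Icc 0 N, ∑ m' ∈ Finset.Icc (-(M : ℤ)) M,
      Abar (i, n, m) (j, n', m') * h j n' m'

/-- The bound `Y`. -/
noncomputable def boundY (a b c ν lam rF : ℝ) (N M : ℕ)
    (Abar : Matrix (Fin 2 × ℕ × ℤ) (Fin 2 × ℕ × ℤ) ℂ) (v : Fin 2 → ℤ → ℂ)
    (wbar : Fin 2 → ℕ → ℤ → ℂ) : ℝ :=
  rF * opNormX ν (finPart N M Abar)
  + normX ν (finPart N M Abar
      (trunc (Finset.Icc 2 N) (Finset.Icc 0 M) (tfMap a b c lam v wbar)))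
  + rF
  + normX ν (trunc (Finset.Ioc N (3 * N)) (Finset.Icc 0 (3 * M))
      (linInv lam (tfMap a b c lam v wbar)))
  + normX ν (trunc (Finset.Icc 2 N) (Finset.Ioc M (3 * M))
      (linInv lam (tfMap a b c lam v wbar)))

/-- The bound `Z₁`. -/
noncomputable def boundZ1 (a b c ν lam : ℝ) (N M : ℕ)
    (Abar : Matrix (Fin 2 × ℕ × ℤ) (Fin 2 × ℕ × ℤ) ℂ) (wbar : Fin 2 → ℕ → ℤ → ℂ) : ℝ :=
  opNormX ν (fun h => trunc (Finset.Icc 0 N) (Finset.Icc 0 M) h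
      - finPart N M Abar (tfMapDeriv a b c lam wbar
          (trunc (Finset.Icc 0 (3 * N)) (Finset.Icc 0 (3 * M)) h)))
  + (1 / √(4 * lam ^ 2 + ((M : ℝ) + 1) ^ 2) + 1 / |lam * ((N : ℝ) + 1)|)
    * max 1 (|a| + |b| * ν ^ 2 + 3 * |c| * normTF ν (convTF (wbar 0) (wbar 0)))

/-- The bound `Z₂(r)`. -/
noncomputable def boundZ2 (c ν lam : ℝ) (N M : ℕ)
    (Abar : Matrix (Fin 2 × ℕ × ℤ) (Fin 2 × ℕ × ℤ) ℂ) (wbar : Fin 2 → ℕ → ℤ → ℂ) (r : ℝ) : ℝ :=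
  3 * |c| * (opNormX ν (finPart N M Abar)
      + 1 / √(4 * lam ^ 2 + ((M : ℝ) + 1) ^ 2) + 1 / |lam * ((N : ℝ) + 1)|)
    * (2 * normTF ν (wbar 0) + r)

/-- The validated radius obtained from `Y`, `Z₁`, `Z₂`. -/
noncomputable def nkRadius (Y Z1 Z2 : ℝ) : ℝ :=
  (1 - Z1 - √((1 - Z1) ^ 2 - 2 * Y * Z2)) / Z2

end GrossPitaevskii

open GrossPitaevskii

/-! The zero of `F` comes from a Newton–Kantorovich argument. The approximate inverse `A` of
`DF(wbar)` is `A_f` on the finite block and the diagonal `L_λ⁻¹` off it, and `newtonOp` is `w ↦ w -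
A F(w)`. Since `f` is cubic, differences of `F` have an exact expansion (`cube_remainder`,
`tfMap_sub`), so `newtonOp` has Lipschitz constant at most `Z1 + Z2 r` on the ball of radius `r`
(`bddX_newtonOp_sub`) and moves `wbar` by at most `Y` (`bddX_newtonOp_residual`). The radius is the
smaller root of `Y + Z1 r + Z2 r²/2 = r`, which makes the ball invariant and the map a contraction.
Fixed points are zeros because `A` is injective: `Z1 < 1` forces `A_f` to be invertible on the block
(`finPart_injective`). Together these give `exists_unique_zero`.

The bundle is real because two periodic solutions of the bundle equation have zero Wronskian
(`BundleODE.wronskian`), so `v` and its conjugate are proportional, and the real nonzero phase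
condition fixes the factor to be one. Then the conjugate of `w` is a zero in the same ball, and
uniqueness makes `w` real. The relation `(im + nλ) w = f(w)`, with `f(w)` in `ℓ¹`, makes the
differentiated series absolutely convergent, so `W` is `C¹` up to `σ = ±1`. The invariance equation
is then the chain rule for the conjugacy. Injectivity in `σ` follows by flowing for many periods
into the region where `∂_σ W(θ, 0) = V(θ) ≠ 0` decides (`injOn_paramW`).

That the image contains the local stable set uses that the last two components form a harmonic
oscillator: convergence to `γ` fixes the phase `θ` exactly (`orbit_phase`). A value `σ` is chosen so
that the orbit differs from `W(θ, σ)` orthogonally to the bundle (`exists_orthogonal`). The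
difference of the two forward orbits tends to zero and solves a perturbed variational equation with
one contracting and one expanding direction; a quadratic form increasing along it forces it to
vanish (`eq_zero_of_orthogonal`). -/

namespace GrossPitaevskii

section

/-! ### Calculus of the weighted `ℓ¹` norms -/

variable {ν : ℝ}

/-- Norm of a Fourier sequence bounded by `C`. -/
def BddF (ν : ℝ) (s : ℤ → ℂ) (C : ℝ) : Prop := MemF ν s ∧ normF ν s ≤ C

/-- Norm of a Taylor–Fourier sequence bounded by `C`. -/
def BddTF (ν : ℝ) (p : ℕ → ℤ → ℂ) (C : ℝ) : Prop := MemTF ν p ∧ normTF ν p ≤ C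

/-- Norm of a pair of Taylor–Fourier sequences bounded by `C`. -/
def BddX (ν : ℝ) (w : Fin 2 → ℕ → ℤ → ℂ) (C : ℝ) : Prop := MemX ν w ∧ normX ν w ≤ C

/-- The summands of the norm of `S_TF`, indexed by pairs. -/
noncomputable def wnorm (ν : ℝ) (p : ℕ → ℤ → ℂ) (x : ℕ × ℤ) : ℝ := ‖p x.1 x.2‖ * ν ^ x.2.natAbs

lemma wnorm_nonneg (hν : 1 ≤ ν) (p : ℕ → ℤ → ℂ) : 0 ≤ wnorm ν p := fun x => by
  unfold wnorm; positivity

lemma memTF_iff (hν : 1 ≤ ν) (p : ℕ → ℤ → ℂ) : MemTF ν p ↔ Summable (wnorm ν p) :=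
  (summable_prod_of_nonneg (wnorm_nonneg hν p)).symm

lemma normTF_eq (hν : 1 ≤ ν) {p : ℕ → ℤ → ℂ} (hp : MemTF ν p) :
    normTF ν p = ∑' x, wnorm ν p x :=
  ((memTF_iff hν p).1 hp).tsum_prod.symm

lemma normF_nonneg (hν : 1 ≤ ν) (s : ℤ → ℂ) : 0 ≤ normF ν s :=
  tsum_nonneg fun m => by positivity

lemma normTF_nonneg (hν : 1 ≤ ν) (p : ℕ → ℤ → ℂ) : 0 ≤ normTF ν p :=
  tsum_nonneg fun _ => normF_nonneg hν _

lemma normX_nonneg (hν : 1 ≤ ν) (w : Fin 2 → ℕ → ℤ → ℂ) : 0 ≤ normX ν w :=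
  le_max_of_le_left (normTF_nonneg hν _)

lemma bddX_iff {w : Fin 2 → ℕ → ℤ → ℂ} {C : ℝ} : BddX ν w C ↔ ∀ i, BddTF ν (w i) C := by
  simp only [BddX, BddTF, MemX, normX, Fin.forall_fin_two, max_le_iff]; tauto

lemma BddTF.nonneg (hν : 1 ≤ ν) {p : ℕ → ℤ → ℂ} {C : ℝ} (h : BddTF ν p C) : 0 ≤ C :=
  (normTF_nonneg hν p).trans h.2

lemma BddX.nonneg (hν : 1 ≤ ν) {w : Fin 2 → ℕ → ℤ → ℂ} {C : ℝ} (h : BddX ν w C) : 0 ≤ C :=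
  (normX_nonneg hν w).trans h.2

/-- A summable majorant gives membership and the norm bound at once; carrying both in `BddTF` is
necessary because `tsum` of a divergent series is `0`, so a bound on `normTF` alone says nothing. -/
lemma bddTF_of_sum_le (hν : 1 ≤ ν) {p : ℕ → ℤ → ℂ} {C : ℝ} {u : ℕ × ℤ → ℝ} (hu : Summable u)
    (hle : ∀ x, wnorm ν p x ≤ u x) (hC : ∑' x, u x ≤ C) : BddTF ν p C := by
  have hs : Summable (wnorm ν p) := Summable.of_nonneg_of_le (wnorm_nonneg hν p) hle hu
  have hm := (memTF_iff hν p).2 hs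
  exact ⟨hm, by rw [normTF_eq hν hm]; exact (hs.tsum_le_tsum hle hu).trans hC⟩

lemma BddTF.summable (hν : 1 ≤ ν) {p : ℕ → ℤ → ℂ} {C : ℝ} (h : BddTF ν p C) :
    Summable (wnorm ν p) := (memTF_iff hν p).1 h.1

lemma BddTF.tsum_le (hν : 1 ≤ ν) {p : ℕ → ℤ → ℂ} {C : ℝ} (h : BddTF ν p C) :
    ∑' x, wnorm ν p x ≤ C := by rw [← normTF_eq hν h.1]; exact h.2

lemma BddTF.mono {p : ℕ → ℤ → ℂ} {C D : ℝ} (h : BddTF ν p C) (hCD : C ≤ D) : BddTF ν p D :=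
  ⟨h.1, h.2.trans hCD⟩

lemma BddX.mono {w : Fin 2 → ℕ → ℤ → ℂ} {C D : ℝ} (h : BddX ν w C) (hCD : C ≤ D) : BddX ν w D :=
  ⟨h.1, h.2.trans hCD⟩

lemma BddTF.of_le (hν : 1 ≤ ν) {p q : ℕ → ℤ → ℂ} {C κ : ℝ} (h : BddTF ν q C) (hκ : 0 ≤ κ)
    (hle : ∀ n m, ‖p n m‖ ≤ κ * ‖q n m‖) : BddTF ν p (κ * C) := by
  refine bddTF_of_sum_le hν ((h.summable hν).mul_left κ) (fun x => ?_) ?_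
  · unfold wnorm
    rw [← mul_assoc]
    gcongr
    exact hle _ _
  · rw [tsum_mul_left]
    exact mul_le_mul_of_nonneg_left (h.tsum_le hν) hκ

lemma BddTF.of_le_one (hν : 1 ≤ ν) {p q : ℕ → ℤ → ℂ} {C : ℝ} (h : BddTF ν q C)
    (hle : ∀ n m, ‖p n m‖ ≤ ‖q n m‖) : BddTF ν p C := by
  simpa using h.of_le hν zero_le_one (p := p) (by simpa using hle)

lemma BddTF.add (hν : 1 ≤ ν) {p q : ℕ → ℤ → ℂ} {C D : ℝ} (hp : BddTF ν p C) (hq : BddTF ν q D) :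
    BddTF ν (p + q) (C + D) := by
  refine bddTF_of_sum_le hν ((hp.summable hν).add (hq.summable hν)) (fun x => ?_) ?_
  · simp only [wnorm, Pi.add_apply, ← add_mul]
    gcongr
    exact norm_add_le _ _
  · rw [(hp.summable hν).tsum_add (hq.summable hν)]
    exact add_le_add (hp.tsum_le hν) (hq.tsum_le hν)

lemma BddTF.smul (hν : 1 ≤ ν) {p : ℕ → ℤ → ℂ} {C : ℝ} (z : ℂ) (hp : BddTF ν p C) :
    BddTF ν (z • p) (‖z‖ * C) :=
  hp.of_le hν (norm_nonneg _) fun n m => by simp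

lemma BddTF.neg (hν : 1 ≤ ν) {p : ℕ → ℤ → ℂ} {C : ℝ} (hp : BddTF ν p C) : BddTF ν (-p) C :=
  hp.of_le_one hν fun n m => by simp

lemma BddTF.sub (hν : 1 ≤ ν) {p q : ℕ → ℤ → ℂ} {C D : ℝ} (hp : BddTF ν p C) (hq : BddTF ν q D) :
    BddTF ν (p - q) (C + D) := by
  rw [sub_eq_add_neg]; exact hp.add hν (hq.neg hν)

lemma BddX.add (hν : 1 ≤ ν) {p q : Fin 2 → ℕ → ℤ → ℂ} {C D : ℝ} (hp : BddX ν p C)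
    (hq : BddX ν q D) : BddX ν (p + q) (C + D) :=
  bddX_iff.2 fun i => (bddX_iff.1 hp i).add hν (bddX_iff.1 hq i)

lemma BddX.sub (hν : 1 ≤ ν) {p q : Fin 2 → ℕ → ℤ → ℂ} {C D : ℝ} (hp : BddX ν p C)
    (hq : BddX ν q D) : BddX ν (p - q) (C + D) :=
  bddX_iff.2 fun i => (bddX_iff.1 hp i).sub hν (bddX_iff.1 hq i)

lemma BddX.of_le (hν : 1 ≤ ν) {p q : Fin 2 → ℕ → ℤ → ℂ} {C κ : ℝ} (h : BddX ν q C) (hκ : 0 ≤ κ)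
    (hle : ∀ i n m, ‖p i n m‖ ≤ κ * ‖q i n m‖) : BddX ν p (κ * C) :=
  bddX_iff.2 fun i => (bddX_iff.1 h i).of_le hν hκ (hle i)

lemma BddX.of_le_one (hν : 1 ≤ ν) {p q : Fin 2 → ℕ → ℤ → ℂ} {C : ℝ} (h : BddX ν q C)
    (hle : ∀ i n m, ‖p i n m‖ ≤ ‖q i n m‖) : BddX ν p C :=
  bddX_iff.2 fun i => (bddX_iff.1 h i).of_le_one hν (hle i)

lemma MemX.bdd {w : Fin 2 → ℕ → ℤ → ℂ} (h : MemX ν w) : BddX ν w (normX ν w) := ⟨h, le_rfl⟩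

lemma MemTF.bdd {p : ℕ → ℤ → ℂ} (h : MemTF ν p) : BddTF ν p (normTF ν p) := ⟨h, le_rfl⟩

lemma BddTF.apply_le (hν : 1 ≤ ν) {p : ℕ → ℤ → ℂ} {C : ℝ} (h : BddTF ν p C) (n : ℕ) (m : ℤ) :
    ‖p n m‖ ≤ C := by
  have h1 : wnorm ν p (n, m) ≤ ∑' x, wnorm ν p x :=
    (h.summable hν).le_tsum (n, m) fun x _ => wnorm_nonneg hν p x
  have h2 : ‖p n m‖ ≤ wnorm ν p (n, m) :=
    le_mul_of_one_le_right (norm_nonneg _) (one_le_pow₀ hν)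
  exact h2.trans (h1.trans (h.tsum_le hν))

/-- A finitely supported sequence lies in `S_TF`. -/
lemma memTF_of_finite (hν : 1 ≤ ν) {p : ℕ → ℤ → ℂ} (s : Finset (ℕ × ℤ))
    (h : ∀ n m, (n, m) ∉ s → p n m = 0) : MemTF ν p :=
  (memTF_iff hν p).2 (summable_of_ne_finset_zero (s := s) fun x hx => by
    simp [wnorm, h x.1 x.2 hx])

lemma memF_of_finite {s : ℤ → ℂ} (t : Finset ℤ) (h : ∀ m ∉ t, s m = 0) : MemF ν s :=
  summable_of_ne_finset_zero (s := t) fun x hx => by simp [h x hx]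

lemma MemF.summable_norm (hν : 1 ≤ ν) {s : ℤ → ℂ} (h : MemF ν s) : Summable fun m => ‖s m‖ :=
  Summable.of_nonneg_of_le (fun _ => norm_nonneg _)
    (fun _ => le_mul_of_one_le_right (norm_nonneg _) (one_le_pow₀ hν)) h

lemma MemF.tsum_norm_le (hν : 1 ≤ ν) {s : ℤ → ℂ} (h : MemF ν s) : ∑' m, ‖s m‖ ≤ normF ν s :=
  (h.summable_norm hν).tsum_le_tsum
    (fun _ => le_mul_of_one_le_right (norm_nonneg _) (one_le_pow₀ hν)) h

/-! ### Convolution -/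

/-- The change of variables `(m, k) ↦ (k, m - k)`. -/
def shearEquiv : ℤ × ℤ ≃ ℤ × ℤ where
  toFun x := (x.2, x.1 - x.2)
  invFun y := (y.1 + y.2, y.1)
  left_inv x := by ext <;> simp
  right_inv y := by ext <;> simp

/-- Submultiplicativity of the weight, the reason why `S_F` is a Banach algebra. -/
lemma pow_natAbs_le (hν : 1 ≤ ν) (m k : ℤ) :
    ν ^ m.natAbs ≤ ν ^ k.natAbs * ν ^ (m - k).natAbs := by
  rw [← pow_add]
  exact pow_le_pow_right₀ hν (by omega)

lemma MemF.conv_summable {s t : ℤ → ℂ} (hs : MemF ν s) (ht : MemF ν t) (hν : 1 ≤ ν) :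
    Summable (fun x : ℤ × ℤ => (‖s x.2‖ * ν ^ x.2.natAbs) *
      (‖t (x.1 - x.2)‖ * ν ^ (x.1 - x.2).natAbs)) := by
  have h := Summable.mul_of_nonneg hs ht (fun _ => by positivity) (fun _ => by positivity)
  exact (shearEquiv.summable_iff.2 h :)

lemma convF_summable {s t : ℤ → ℂ} (hs : MemF ν s) (ht : MemF ν t) (hν : 1 ≤ ν) (m : ℤ) :
    Summable fun k => ‖s k * t (m - k)‖ := by
  refine Summable.of_nonneg_of_le (fun _ => norm_nonneg _) (fun k => ?_)
    ((hs.conv_summable ht hν).prod_factor m)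
  rw [norm_mul]
  gcongr <;> exact le_mul_of_one_le_right (norm_nonneg _) (one_le_pow₀ hν)

/-- Both sides are sums of one absolutely convergent double series, related by the shear `(m, k) ↦
(k, m - k)`. -/
lemma convF_bdd {s t : ℤ → ℂ} (hs : MemF ν s) (ht : MemF ν t) (hν : 1 ≤ ν) :
    BddF ν (convF s t) (normF ν s * normF ν t) := by
  have h := hs.conv_summable ht hν
  have hle : ∀ m, ‖convF s t m‖ * ν ^ m.natAbs ≤ ∑' k, (‖s k‖ * ν ^ k.natAbs) *
      (‖t (m - k)‖ * ν ^ (m - k).natAbs) := fun m => by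
    have hn := convF_summable hs ht hν m
    calc ‖convF s t m‖ * ν ^ m.natAbs ≤ (∑' k, ‖s k * t (m - k)‖) * ν ^ m.natAbs := by
          gcongr; exact norm_tsum_le_tsum_norm hn
      _ = ∑' k, ‖s k * t (m - k)‖ * ν ^ m.natAbs := tsum_mul_right.symm
      _ ≤ _ := by
          refine (hn.mul_right _).tsum_le_tsum (fun k => ?_) (h.prod_factor m)
          rw [norm_mul]
          calc _ ≤ ‖s k‖ * ‖t (m - k)‖ * (ν ^ k.natAbs * ν ^ (m - k).natAbs) := by
                gcongr; exact pow_natAbs_le hν m k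
            _ = _ := by ring
  have hsum : MemF ν (convF s t) :=
    Summable.of_nonneg_of_le (fun _ => by positivity) hle h.prod
  refine ⟨hsum, (hsum.tsum_le_tsum hle h.prod).trans_eq ?_⟩
  rw [← h.tsum_prod]
  have h' := Summable.mul_of_nonneg hs ht (fun _ => by positivity) (fun _ => by positivity)
  calc _ = ∑' y : ℤ × ℤ, (‖s y.1‖ * ν ^ y.1.natAbs) * (‖t y.2‖ * ν ^ y.2.natAbs) :=
        shearEquiv.tsum_eq (fun y : ℤ × ℤ => (‖s y.1‖ * ν ^ y.1.natAbs) * (‖t y.2‖ * ν ^ y.2.natAbs))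
    _ = _ := (Summable.tsum_mul_tsum hs ht h').symm

lemma normF_sum_le (hν : 1 ≤ ν) {ι : Type*} (S : Finset ι) {s : ι → ℤ → ℂ} {C : ι → ℝ}
    (h : ∀ i ∈ S, BddF ν (s i) (C i)) : BddF ν (fun m => ∑ i ∈ S, s i m) (∑ i ∈ S, C i) := by
  have hs : Summable fun m : ℤ => ∑ i ∈ S, ‖s i m‖ * ν ^ m.natAbs :=
    summable_sum fun i hi => (h i hi).1
  have hle : ∀ m : ℤ, ‖∑ i ∈ S, s i m‖ * ν ^ m.natAbs ≤ ∑ i ∈ S, ‖s i m‖ * ν ^ m.natAbs :=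
    fun m => by rw [← Finset.sum_mul]; gcongr; exact norm_sum_le _ _
  have hm : MemF ν (fun m => ∑ i ∈ S, s i m) :=
    Summable.of_nonneg_of_le (fun _ => by positivity) hle hs
  refine ⟨hm, (hm.tsum_le_tsum hle hs).trans ?_⟩
  rw [Summable.tsum_finsetSum fun i hi => (h i hi).1]
  exact Finset.sum_le_sum fun i hi => (h i hi).2

lemma BddTF.conv (hν : 1 ≤ ν) {p q : ℕ → ℤ → ℂ} {C D : ℝ} (hp : BddTF ν p C)
    (hq : BddTF ν q D) : BddTF ν (convTF p q) (C * D) := by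
  have hb : ∀ n, BddF ν (convTF p q n)
      (∑ l ∈ Finset.range (n + 1), normF ν (p l) * normF ν (q (n - l))) := fun n =>
    normF_sum_le hν _ fun l _ => convF_bdd (hp.1.1 l) (hq.1.1 (n - l)) hν
  have hpn : Summable fun n => ‖normF ν (p n)‖ := hp.1.2.norm
  have hqn : Summable fun n => ‖normF ν (q n)‖ := hq.1.2.norm
  have hs : Summable fun n => ∑ l ∈ Finset.range (n + 1), normF ν (p l) * normF ν (q (n - l)) :=
    (summable_norm_sum_mul_range_of_summable_norm hpn hqn).of_norm
  have hS : Summable fun n => normF ν (convTF p q n) :=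
    Summable.of_nonneg_of_le (fun n => normF_nonneg hν _) (fun n => (hb n).2) hs
  refine ⟨⟨fun n => (hb n).1, hS⟩, (hS.tsum_le_tsum (fun n => (hb n).2) hs).trans ?_⟩
  rw [← tsum_mul_tsum_eq_tsum_sum_range_of_summable_norm hpn hqn]
  exact mul_le_mul hp.2 hq.2 (normTF_nonneg hν q) (hp.nonneg hν)

/-! ### Evaluation -/

lemma norm_expI (m : ℤ) (θ : ℝ) : ‖Complex.exp (Complex.I * m * θ)‖ = 1 := by
  rw [show Complex.I * m * θ = ((m * θ : ℝ) : ℂ) * Complex.I by push_cast; ring]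
  exact Complex.norm_exp_ofReal_mul_I _

lemma MemF.eval_summable (hν : 1 ≤ ν) {s : ℤ → ℂ} (h : MemF ν s) (θ : ℝ) :
    Summable fun m : ℤ => ‖s m * Complex.exp (Complex.I * m * θ)‖ := by
  simpa [norm_expI] using h.summable_norm hν

lemma MemF.norm_eval_le (hν : 1 ≤ ν) {s : ℤ → ℂ} (h : MemF ν s) (θ : ℝ) :
    ‖evalF s θ‖ ≤ normF ν s := by
  refine (norm_tsum_le_tsum_norm (h.eval_summable hν θ)).trans ?_
  simpa [norm_expI] using h.tsum_norm_le hν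

lemma evalF_conv (hν : 1 ≤ ν) {s t : ℤ → ℂ} (hs : MemF ν s) (ht : MemF ν t) (θ : ℝ) :
    evalF (convF s t) θ = evalF s θ * evalF t θ := by
  have h1 := hs.eval_summable hν θ
  have h2 := ht.eval_summable hν θ
  have h3 : Summable fun x : ℤ × ℤ => s x.2 * t (x.1 - x.2) * Complex.exp (Complex.I * x.1 * θ) := by
    have := shearEquiv.summable_iff.2 (h1.mul_norm h2).of_norm
    refine this.congr fun x => ?_
    simp only [shearEquiv, Equiv.coe_fn_mk, Function.comp]
    rw [show Complex.I * x.1 * θ = Complex.I * x.2 * θ + Complex.I * ((x.1 - x.2 : ℤ) : ℂ) * θ by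
      push_cast; ring, Complex.exp_add]
    ring
  unfold evalF
  rw [tsum_mul_tsum_of_summable_norm h1 h2, ← shearEquiv.tsum_eq]
  calc _ = ∑' m, ∑' k, s k * t (m - k) * Complex.exp (Complex.I * m * θ) := by
        simp only [convF, tsum_mul_right]
    _ = _ := by
        rw [← h3.tsum_prod]
        refine tsum_congr fun x => ?_
        simp only [shearEquiv, Equiv.coe_fn_mk]
        rw [show Complex.I * x.1 * θ = Complex.I * x.2 * θ + Complex.I * ((x.1 - x.2 : ℤ) : ℂ) * θ by
          push_cast; ring, Complex.exp_add]
        ring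

lemma evalF_add (hν : 1 ≤ ν) {s t : ℤ → ℂ} (hs : MemF ν s) (ht : MemF ν t) (θ : ℝ) :
    evalF (s + t) θ = evalF s θ + evalF t θ := by
  unfold evalF
  rw [← (hs.eval_summable hν θ).of_norm.tsum_add (ht.eval_summable hν θ).of_norm]
  exact tsum_congr fun m => by simp [add_mul]

lemma evalF_smul (z : ℂ) (s : ℤ → ℂ) (θ : ℝ) : evalF (z • s) θ = z * evalF s θ := by
  unfold evalF
  rw [← tsum_mul_left]
  exact tsum_congr fun m => by simp [mul_assoc]

/-- Uniqueness of Fourier coefficients. -/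
lemma coeff_eq_integral (hν : 1 ≤ ν) {s : ℤ → ℂ} (hs : MemF ν s) (k : ℤ) :
    ∫ θ in (0 : ℝ)..(2 * π), evalF s θ * Complex.exp (-(Complex.I * k * θ)) = 2 * π * s k := by
  have hmono : ∀ m : ℤ, ∫ θ in (0 : ℝ)..(2 * π), s m * Complex.exp (Complex.I * m * θ) *
      Complex.exp (-(Complex.I * k * θ)) = if m = k then 2 * π * s k else 0 := fun m => by
    have : ∀ θ : ℝ, s m * Complex.exp (Complex.I * m * θ) * Complex.exp (-(Complex.I * k * θ))
        = s m * Complex.exp (Complex.I * (m - k) * θ) := fun θ => by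
      rw [mul_assoc, ← Complex.exp_add]; ring_nf
    simp only [this]
    rw [intervalIntegral.integral_const_mul]
    split_ifs with h
    · subst h; simp; ring
    · have hc : Complex.I * ((m : ℂ) - k) ≠ 0 := by
        refine mul_ne_zero Complex.I_ne_zero (sub_ne_zero.2 ?_)
        exact_mod_cast h
      rw [integral_exp_mul_complex hc]
      have : Complex.exp (Complex.I * ((m : ℂ) - k) * ((2 * π : ℝ) : ℂ)) = 1 :=
        Complex.exp_eq_one_iff.2 ⟨m - k, by push_cast; ring⟩
      rw [this]; simp
  have hsum := hs.summable_norm hν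
  have := intervalIntegral.hasSum_integral_of_dominated_convergence
    (μ := MeasureTheory.volume) (a := (0 : ℝ)) (b := 2 * π)
    (F := fun (m : ℤ) (θ : ℝ) => s m * Complex.exp (Complex.I * m * θ) *
      Complex.exp (-(Complex.I * k * θ)))
    (f := fun θ => evalF s θ * Complex.exp (-(Complex.I * k * θ)))
    (fun m _ => ‖s m‖) (fun m => (by fun_prop : Continuous _).aestronglyMeasurable)
    (fun m => Filter.Eventually.of_forall fun θ _ => by
      have h2 : ‖Complex.exp (-(Complex.I * k * θ))‖ = 1 := by
        have := norm_expI (-k) θ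
        rwa [show Complex.I * ((-k : ℤ) : ℂ) * θ = -(Complex.I * k * θ) by push_cast; ring] at this
      simp [norm_expI, h2])
    (Filter.Eventually.of_forall fun θ _ => hsum) (by simp)
    (Filter.Eventually.of_forall fun θ _ =>
      (hs.eval_summable hν θ).of_norm.hasSum.mul_right _)
  rw [← this.tsum_eq]
  simp only [hmono]
  exact tsum_ite_eq k _

lemma evalF_injective (hν : 1 ≤ ν) {s t : ℤ → ℂ} (hs : MemF ν s) (ht : MemF ν t)
    (h : ∀ θ, evalF s θ = evalF t θ) : s = t := by
  funext k
  have h1 := coeff_eq_integral hν hs k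
  rw [funext h, coeff_eq_integral hν ht k] at h1
  exact (mul_left_cancel₀ (by simp [pi_ne_zero]) h1).symm

/-! ### Products of sequences as products of power series -/

/-- The power series whose coefficients are the functions `evalF (p n)`. -/
noncomputable def toPS (p : ℕ → ℤ → ℂ) : PowerSeries (ℝ → ℂ) := PowerSeries.mk fun n => evalF (p n)

/-- Fourier coefficients are determined by the function, so polynomial identities between
Taylor–Fourier products can be checked in the commutative ring of power series over functions of
`θ`. There `ring` does the work of associativity, commutativity and distributivity of convolution.
-/
lemma toPS_injective (hν : 1 ≤ ν) {p q : ℕ → ℤ → ℂ} (hp : MemTF ν p) (hq : MemTF ν q)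
    (h : toPS p = toPS q) : p = q := by
  funext n
  refine evalF_injective hν (hp.1 n) (hq.1 n) fun θ => ?_
  have := congrArg (PowerSeries.coeff n) h
  simp only [toPS, PowerSeries.coeff_mk] at this
  exact congrFun this θ

lemma evalF_finsum (hν : 1 ≤ ν) {ι : Type*} (S : Finset ι) {s : ι → ℤ → ℂ}
    (h : ∀ i ∈ S, MemF ν (s i)) (θ : ℝ) :
    evalF (fun m => ∑ i ∈ S, s i m) θ = ∑ i ∈ S, evalF (s i) θ := by
  unfold evalF
  rw [← Summable.tsum_finsetSum fun i hi => ((h i hi).eval_summable hν θ).of_norm]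
  simp [Finset.sum_mul]

lemma evalF_convTF (hν : 1 ≤ ν) {p q : ℕ → ℤ → ℂ} (hp : MemTF ν p) (hq : MemTF ν q) (n : ℕ)
    (θ : ℝ) : evalF (convTF p q n) θ =
      ∑ l ∈ Finset.range (n + 1), evalF (p l) θ * evalF (q (n - l)) θ := by
  have := evalF_finsum hν (Finset.range (n + 1)) (s := fun l => convF (p l) (q (n - l)))
    (fun l _ => (convF_bdd (hp.1 l) (hq.1 _) hν).1) θ
  rw [show convTF p q n = fun m => ∑ l ∈ Finset.range (n + 1), convF (p l) (q (n - l)) m from rfl,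
    this]
  exact Finset.sum_congr rfl fun l _ => evalF_conv hν (hp.1 l) (hq.1 _) θ

lemma toPS_conv (hν : 1 ≤ ν) {p q : ℕ → ℤ → ℂ} (hp : MemTF ν p) (hq : MemTF ν q) :
    toPS (convTF p q) = toPS p * toPS q := by
  ext n θ
  simp only [toPS, PowerSeries.coeff_mk, PowerSeries.coeff_mul]
  rw [evalF_convTF hν hp hq, Finset.Nat.sum_antidiagonal_eq_sum_range_succ_mk]
  simp

lemma toPS_add (hν : 1 ≤ ν) {p q : ℕ → ℤ → ℂ} (hp : MemTF ν p) (hq : MemTF ν q) :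
    toPS (p + q) = toPS p + toPS q := by
  ext n θ
  simp only [toPS, PowerSeries.coeff_mk, map_add, Pi.add_apply]
  exact evalF_add hν (hp.1 n) (hq.1 n) θ

lemma toPS_neg (p : ℕ → ℤ → ℂ) : toPS (-p) = -toPS p := by
  ext n θ
  simp only [toPS, PowerSeries.coeff_mk, map_neg, Pi.neg_apply]
  simpa using evalF_smul (-1) (p n) θ

/-- The third order remainder of the cube. -/
lemma cube_remainder (hν : 1 ≤ ν) {u p q : ℕ → ℤ → ℂ} (hu : MemTF ν u) (hp : MemTF ν p)
    (hq : MemTF ν q) :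
    convTF (convTF (u + p) (u + p)) (u + p) - convTF (convTF (u + q) (u + q)) (u + q)
      - (3 : ℂ) • convTF (convTF u u) (p - q)
    = convTF ((3 : ℂ) • convTF u (p + q) + (convTF p p + convTF p q + convTF q q)) (p - q) := by
  have add : ∀ {x y : ℕ → ℤ → ℂ}, MemTF ν x → MemTF ν y → MemTF ν (x + y) :=
    fun hx hy => (hx.bdd.add hν hy.bdd).1
  have neg : ∀ {x : ℕ → ℤ → ℂ}, MemTF ν x → MemTF ν (-x) := fun hx => (hx.bdd.neg hν).1
  have conv : ∀ {x y : ℕ → ℤ → ℂ}, MemTF ν x → MemTF ν y → MemTF ν (convTF x y) :=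
    fun hx hy => (hx.bdd.conv hν hy.bdd).1
  have three : ∀ x : ℕ → ℤ → ℂ, (3 : ℂ) • x = x + x + x := fun x => by
    ext n m; simp; ring
  simp only [three, sub_eq_add_neg]
  have hup := add hu hp
  have huq := add hu hq
  have hd := add hp (neg hq)
  have hs := add hp hq
  have c1 := conv (conv hup hup) hup
  have c2 := conv (conv huq huq) huq
  have c3 := conv (conv hu hu) hd
  have c4 := conv hu hs
  have c44 := add (add c4 c4) c4
  have cpp := conv hp hp
  have cpq := conv hp hq
  have cqq := conv hq hq
  have c5 := add c44 (add (add cpp cpq) cqq)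
  -- What remains is `(u+p)³ - (u+q)³ - 3u²(p-q) = (3u(p+q) + p² + pq + q²)(p-q)` in a commutative
  -- ring; the memberships collected above allow each product and sum to be pushed through `toPS`.
  refine toPS_injective hν (add (add c1 (neg c2)) (neg (add (add c3 c3) c3))) (conv c5 hd) ?_
  rw [toPS_conv hν c5 hd, toPS_add hν c44 (add (add cpp cpq) cqq),
    toPS_add hν (add c1 (neg c2)) (neg (add (add c3 c3) c3)), toPS_add hν c1 (neg c2), toPS_neg,
    toPS_neg, toPS_add hν (add c3 c3) c3, toPS_add hν c3 c3, toPS_conv hν (conv hup hup) hup,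
    toPS_conv hν (conv huq huq) huq, toPS_conv hν (conv hu hu) hd, toPS_conv hν hup hup,
    toPS_conv hν huq huq, toPS_conv hν hu hu, toPS_add hν (add c4 c4) c4, toPS_add hν c4 c4,
    toPS_conv hν hu hs, toPS_add hν (add cpp cpq) cqq, toPS_add hν cpp cpq, toPS_conv hν hp hp,
    toPS_conv hν hp hq, toPS_conv hν hq hq, toPS_add hν hp (neg hq), toPS_add hν hu hp,
    toPS_add hν hu hq, toPS_add hν hp hq, toPS_neg]
  ring

end

section

variable {ν : ℝ}

/-! ### Completeness: the contraction principle in `X` -/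

/-- The sequence of coefficients encoded by an unweighted summable family. -/
noncomputable def decode (ν : ℝ) (f : lp (fun _ : ℕ × ℤ => ℂ) 1) (n : ℕ) (m : ℤ) : ℂ :=
  f (n, m) / (ν : ℂ) ^ m.natAbs

lemma wnorm_decode (hν : 1 ≤ ν) (f : lp (fun _ : ℕ × ℤ => ℂ) 1) (x : ℕ × ℤ) :
    wnorm ν (decode ν f) x = ‖f x‖ := by
  have h0 : 0 < ν := by linarith
  simp only [wnorm, decode, norm_div, norm_pow, Complex.norm_real, Real.norm_eq_abs, abs_of_pos h0]
  exact div_mul_cancel₀ _ (by positivity)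

lemma memTF_decode (hν : 1 ≤ ν) (f : lp (fun _ : ℕ × ℤ => ℂ) 1) : MemTF ν (decode ν f) := by
  rw [memTF_iff hν, funext (wnorm_decode hν f)]
  simpa using (memℓp_gen_iff (p := 1) (by simp)).1 f.2

lemma norm_eq_normTF (hν : 1 ≤ ν) (f : lp (fun _ : ℕ × ℤ => ℂ) 1) :
    ‖f‖ = normTF ν (decode ν f) := by
  rw [normTF_eq hν (memTF_decode hν f), lp.norm_eq_tsum_rpow (by simp)]
  simp [wnorm_decode hν]

lemma exists_decode (hν : 1 ≤ ν) {p : ℕ → ℤ → ℂ} (hp : MemTF ν p) : ∃ f, decode ν f = p := by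
  have h0 : 0 < ν := by linarith
  have hs := (memTF_iff hν p).1 hp
  refine ⟨⟨fun x => p x.1 x.2 * (ν : ℂ) ^ x.2.natAbs, ?_⟩, ?_⟩
  · refine (memℓp_gen_iff (p := 1) (by simp)).2 ?_
    refine hs.congr fun x => ?_
    simp [wnorm, abs_of_pos h0]
  · ext n m
    simp only [decode]
    exact mul_div_cancel_right₀ _ (pow_ne_zero _ (by exact_mod_cast h0.ne'))

lemma decode_sub (f g : lp (fun _ : ℕ × ℤ => ℂ) 1) :
    decode ν (f - g) = decode ν f - decode ν g := by
  ext n m; simp [decode, sub_div]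

/-- The pair of sequences encoded by an element of `ℓ¹ × ℓ¹`. -/
noncomputable def decodeX (ν : ℝ) (f : lp (fun _ : ℕ × ℤ => ℂ) 1 × lp (fun _ : ℕ × ℤ => ℂ) 1) :
    Fin 2 → ℕ → ℤ → ℂ := ![decode ν f.1, decode ν f.2]

lemma memX_decodeX (hν : 1 ≤ ν) (f) : MemX ν (decodeX ν f) := by
  intro i; fin_cases i <;> exact memTF_decode hν _

lemma norm_eq_normX (hν : 1 ≤ ν) (f) : ‖f‖ = normX ν (decodeX ν f) := by
  rw [Prod.norm_def, norm_eq_normTF hν, norm_eq_normTF hν]; rfl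

lemma decodeX_sub (f g) : decodeX ν (f - g) = decodeX ν f - decodeX ν g := by
  ext i; fin_cases i <;> simp [decodeX, decode_sub]

lemma exists_decodeX (hν : 1 ≤ ν) {w} (hw : MemX ν w) : ∃ f, decodeX ν f = w := by
  obtain ⟨f, hf⟩ := exists_decode hν (hw 0)
  obtain ⟨g, hg⟩ := exists_decode hν (hw 1)
  refine ⟨(f, g), ?_⟩
  ext i; fin_cases i <;> simp [decodeX, hf, hg]

lemma eq_of_normX_le_zero (hν : 1 ≤ ν) {w w' : Fin 2 → ℕ → ℤ → ℂ} (h : BddX ν (w - w') 0) :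
    w = w' := by
  ext i n m
  have := (bddX_iff.1 h i).apply_le hν n m
  simpa [sub_eq_zero] using this

/-- Banach's fixed point theorem. The sequences are bare functions, so completeness is borrowed from
`ℓ¹ × ℓ¹`, which `decodeX` identifies isometrically with `X` by removing the weights. -/
lemma exists_unique_fixed (hν : 1 ≤ ν) {T : (Fin 2 → ℕ → ℤ → ℂ) → (Fin 2 → ℕ → ℤ → ℂ)}
    {u : Fin 2 → ℕ → ℤ → ℂ} (hu : MemX ν u) {r q : ℝ} (hr : 0 ≤ r) (hq : q < 1)
    (hq0 : 0 ≤ q)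
    (hc : ∀ w w', BddX ν (w - u) r → BddX ν (w' - u) r →
      BddX ν (T w - T w') (q * normX ν (w - w')))
    (hm : ∀ w, BddX ν (w - u) r → BddX ν (T w - u) r) :
    ∃ w, BddX ν (w - u) r ∧ T w = w ∧ ∀ w', BddX ν (w' - u) r → T w' = w' → w' = w := by
  obtain ⟨u', hu'⟩ := exists_decodeX hν hu
  have hmem : ∀ w, BddX ν (w - u) r → MemX ν w := fun w hw => by
    simpa using (hw.add hν hu.bdd).1
  have key : ∀ x ∈ Metric.closedBall u' r, BddX ν (decodeX ν x - u) r := fun x hx => by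
    rw [← hu', ← decodeX_sub]
    refine ⟨memX_decodeX hν _, ?_⟩
    rw [← norm_eq_normX hν, ← dist_eq_norm]; exact hx
  -- `enc` is meaningful only on `X`; its arbitrary values elsewhere do no harm, since `T` sends the
  -- ball into `X`.
  choose! enc henc using fun w (hw : MemX ν w) => exists_decodeX hν hw
  let S : _ → _ := fun x => enc (T (decodeX ν x))
  have hS : ∀ x ∈ Metric.closedBall u' r, decodeX ν (S x) = T (decodeX ν x) := fun x hx =>
    henc _ (hmem _ (hm _ (key x hx)))
  have hmaps : MapsTo S (Metric.closedBall u' r) (Metric.closedBall u' r) := fun x hx => by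
    rw [Metric.mem_closedBall, dist_eq_norm, norm_eq_normX hν, decodeX_sub, hS x hx, hu']
    exact (hm _ (key x hx)).2
  have hcontr : ContractingWith ⟨q, hq0⟩ (hmaps.restrict S _ _) := by
    refine ⟨by exact_mod_cast hq, LipschitzWith.of_dist_le_mul fun x y => ?_⟩
    rw [Subtype.dist_eq, Subtype.dist_eq, dist_eq_norm, dist_eq_norm, norm_eq_normX hν,
      norm_eq_normX hν, decodeX_sub, decodeX_sub]
    simp only [MapsTo.val_restrict_apply]
    rw [hS _ x.2, hS _ y.2]
    exact (hc _ _ (key _ x.2) (key _ y.2)).2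
  obtain ⟨y, hy, hfix, -⟩ := ContractingWith.exists_fixedPoint'
    Metric.isClosed_closedBall.isComplete hmaps hcontr (Metric.mem_closedBall_self hr)
    (edist_ne_top _ _)
  have hTy : T (decodeX ν y) = decodeX ν y := by rw [← hS y hy, hfix.eq]
  refine ⟨decodeX ν y, key y hy, hTy, fun w' hw' hT => ?_⟩
  have h := hc _ _ hw' (key y hy)
  rw [hT, hTy] at h
  have h0 := normX_nonneg hν (w' - decodeX ν y)
  have h2 := h.2
  refine eq_of_normX_le_zero hν ⟨h.1, ?_⟩
  nlinarith

/-! ### Operator norms and the finite part -/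

lemma opNormX_nonneg (T) : 0 ≤ opNormX ν T := Real.sInf_nonneg fun _ hC => hC.1

/-- Some finite bound `C` must be known beforehand: the infimum of an empty set of reals is `0`, so
without one `opNormX` would not dominate `T`. -/
lemma le_opNormX (hν : 1 ≤ ν) {T : (Fin 2 → ℕ → ℤ → ℂ) → (Fin 2 → ℕ → ℤ → ℂ)} {C : ℝ}
    (hC : 0 ≤ C) (hT : ∀ h, MemX ν h → normX ν (T h) ≤ C * normX ν h) {h} (hh : MemX ν h) :
    normX ν (T h) ≤ opNormX ν T * normX ν h := by
  rcases (normX_nonneg hν h).eq_or_lt with h0 | h0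
  · simpa [← h0] using hT h hh
  · rw [← div_le_iff₀ h0]
    exact le_csInf ⟨C, hC, hT⟩ fun D hD => (div_le_iff₀ h0).2 (hD.2 h hh)

variable {N M : ℕ} {Abar : Matrix (Fin 2 × ℕ × ℤ) (Fin 2 × ℕ × ℤ) ℂ}

lemma trunc_block_apply (w : Fin 2 → ℕ → ℤ → ℂ) (i n m) :
    trunc (Finset.Icc 0 N) (Finset.Icc 0 M) w i n m =
      if n ≤ N ∧ m.natAbs ≤ M then w i n m else 0 := by
  simp [trunc]

lemma finPart_of_not {h : Fin 2 → ℕ → ℤ → ℂ} {i n m} (hb : ¬(n ≤ N ∧ m.natAbs ≤ M)) :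
    finPart N M Abar h i n m = 0 := by
  rw [finPart, trunc_block_apply, if_neg hb]

lemma finPart_congr {g h : Fin 2 → ℕ → ℤ → ℂ}
    (hgh : ∀ i n m, n ≤ N → m.natAbs ≤ M → g i n m = h i n m) :
    finPart N M Abar g = finPart N M Abar h := by
  unfold finPart
  congr 1
  ext i n m
  refine Finset.sum_congr rfl fun j _ => Finset.sum_congr rfl fun n' hn => Finset.sum_congr rfl
    fun m' hm => ?_
  rw [Finset.mem_Icc] at hn hm
  rw [hgh j n' m' hn.2 (by omega)]

lemma finPart_add (g h : Fin 2 → ℕ → ℤ → ℂ) :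
    finPart N M Abar (g + h) = finPart N M Abar g + finPart N M Abar h := by
  ext i n m
  simp only [finPart, trunc, Pi.add_apply]
  split_ifs
  · simp only [mul_add, Finset.sum_add_distrib]
  · simp

lemma finPart_smul (z : ℂ) (h : Fin 2 → ℕ → ℤ → ℂ) :
    finPart N M Abar (z • h) = z • finPart N M Abar h := by
  ext i n m
  simp only [finPart, trunc, Pi.smul_apply, smul_eq_mul]
  split_ifs
  · simp only [Finset.mul_sum]
    refine Finset.sum_congr rfl fun j _ => Finset.sum_congr rfl fun n' hn => Finset.sum_congr rfl
      fun m' hm => ?_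
    ring
  · simp

lemma finPart_sub (g h : Fin 2 → ℕ → ℤ → ℂ) :
    finPart N M Abar (g - h) = finPart N M Abar g - finPart N M Abar h := by
  have : g - h = g + (-1 : ℂ) • h := by ext; simp; ring
  rw [this, finPart_add, finPart_smul]; ext; simp; ring

/-- The bound uses only the size of the entries of `g` inside the block, not a norm of `g`. This
lets `g` be the image of an unbounded operator such as `DF`. -/
lemma exists_finPart_bound (hν : 1 ≤ ν) (N M : ℕ)
    (Abar : Matrix (Fin 2 × ℕ × ℤ) (Fin 2 × ℕ × ℤ) ℂ) : ∃ C, 0 ≤ C ∧ ∀ g : Fin 2 → ℕ → ℤ → ℂ,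
    ∀ K, 0 ≤ K → (∀ j n m, n ≤ N → m.natAbs ≤ M → ‖g j n m‖ ≤ K) →
      BddX ν (finPart N M Abar g) (C * K) := by
  let B : Fin 2 → ℕ → ℤ → ℂ := fun i n m => if n ≤ N ∧ m.natAbs ≤ M then
    ((∑ j : Fin 2, ∑ n' ∈ Finset.Icc 0 N, ∑ m' ∈ Finset.Icc (-(M : ℤ)) M,
      ‖Abar (i, n, m) (j, n', m')‖ : ℝ) : ℂ) else 0
  have hB : MemX ν B := fun i => memTF_of_finite hν
    (Finset.Icc 0 N ×ˢ Finset.Icc (-(M : ℤ)) M) fun n m hnm => by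
      simp only [Finset.mem_product, Finset.mem_Icc] at hnm
      exact if_neg (by omega)
  refine ⟨normX ν B, normX_nonneg hν B, fun g K hK hg => ?_⟩
  rw [mul_comm]
  refine hB.bdd.of_le hν hK fun i n m => ?_
  by_cases hb : n ≤ N ∧ m.natAbs ≤ M
  · have hs : 0 ≤ ∑ j : Fin 2, ∑ n' ∈ Finset.Icc 0 N, ∑ m' ∈ Finset.Icc (-(M : ℤ)) M,
        ‖Abar (i, n, m) (j, n', m')‖ := by positivity
    simp only [finPart, trunc_block_apply, if_pos hb, B, Complex.norm_real, Real.norm_eq_abs,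
      abs_of_nonneg hs, Finset.mul_sum]
    refine norm_sum_le_of_le _ fun j _ => norm_sum_le_of_le _ fun n' hn =>
      norm_sum_le_of_le _ fun m' hm => ?_
    rw [Finset.mem_Icc] at hn hm
    rw [norm_mul, mul_comm]
    gcongr
    exact hg _ _ _ hn.2 (by omega)
  · rw [finPart_of_not hb, norm_zero]; positivity

lemma BddX.finPart (hν : 1 ≤ ν) {h : Fin 2 → ℕ → ℤ → ℂ} {C : ℝ} (hh : BddX ν h C) :
    BddX ν (finPart N M Abar h) (opNormX ν (finPart N M Abar) * C) := by
  obtain ⟨D, hD, hb⟩ := exists_finPart_bound hν N M Abar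
  have hb' : ∀ h, MemX ν h → BddX ν (GrossPitaevskii.finPart N M Abar h) (D * normX ν h) :=
    fun h hh => hb h _ (normX_nonneg hν h) fun j n m _ _ =>
      (bddX_iff.1 hh.bdd j).apply_le hν n m
  refine ⟨(hb' h hh.1).1, (le_opNormX hν hD (fun h hh => (hb' h hh).2) hh.1).trans ?_⟩
  exact mul_le_mul_of_nonneg_left hh.2 (opNormX_nonneg _)

lemma BddX.trunc (hν : 1 ≤ ν) {h : Fin 2 → ℕ → ℤ → ℂ} {C : ℝ} (R S : Finset ℕ) (hh : BddX ν h C) :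
    BddX ν (trunc R S h) C :=
  hh.of_le_one hν fun i n m => by
    unfold GrossPitaevskii.trunc; split_ifs <;> simp

/-! ### The tail of the approximate inverse -/

/-- The factor bounding `L_λ⁻¹` outside the finite block. -/
noncomputable def tailConst (lam : ℝ) (N M : ℕ) : ℝ :=
  1 / √(4 * lam ^ 2 + ((M : ℝ) + 1) ^ 2) + 1 / |lam * ((N : ℝ) + 1)|

/-- The part of `L_λ⁻¹` outside the finite block. -/
noncomputable def tailInv (lam : ℝ) (N M : ℕ) (g : Fin 2 → ℕ → ℤ → ℂ) : Fin 2 → ℕ → ℤ → ℂ :=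
  fun i n m => if n ≤ N ∧ m.natAbs ≤ M then 0 else linInv lam g i n m

lemma tailInv_sub (lam : ℝ) (g h : Fin 2 → ℕ → ℤ → ℂ) :
    tailInv lam N M (g - h) = tailInv lam N M g - tailInv lam N M h := by
  ext i n m
  simp only [tailInv, linInv, Pi.sub_apply]
  split_ifs <;> ring

lemma sqrt_le_norm {x y u v : ℝ} (h1 : u ≤ |x|) (h2 : v ≤ |y|) (hu : 0 ≤ u) (hv : 0 ≤ v) :
    √(u ^ 2 + v ^ 2) ≤ ‖Complex.I * y + x‖ := by
  rw [show Complex.I * y + x = (x : ℂ) + (y : ℂ) * Complex.I by ring, Complex.norm_add_mul_I,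
    ← sq_abs x, ← sq_abs y]
  gcongr

lemma symbol_eq (lam : ℝ) (n : ℕ) (m : ℤ) : Complex.I * m + n * (lam : ℂ) =
    Complex.I * ((m : ℝ) : ℂ) + ((n * lam : ℝ) : ℂ) := by push_cast; ring

lemma symbol_ne_zero {lam : ℝ} (hlam : lam < 0) {n : ℕ} (hn : n ≠ 0) (m : ℤ) :
    Complex.I * m + n * (lam : ℂ) ≠ 0 := fun h => by
  have := congrArg Complex.re h
  simp at this
  exact this.elim hn hlam.ne

/-- Outside the block either `|m| ≥ M + 1`, and with `n ≥ 2` the modulus is at least `√(4λ² +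
(M+1)²)`, or `n ≥ N + 1`, and the real part alone gives `|λ|(N + 1)`. `tailConst` is the sum of the
two reciprocals and dominates each. -/
lemma inv_symbol_le {lam : ℝ} (hlam : lam < 0) {n : ℕ} (hn : 2 ≤ n) {m : ℤ}
    (hb : ¬(n ≤ N ∧ m.natAbs ≤ M)) :
    ‖(Complex.I * m + n * (lam : ℂ))⁻¹‖ ≤ tailConst lam N M := by
  have habs : |(n : ℝ) * lam| = n * |lam| := by rw [abs_mul, Nat.abs_cast]
  have hl : 0 < |lam| := abs_pos.2 hlam.ne
  have hn' : (2 : ℝ) ≤ n := by exact_mod_cast hn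
  rw [norm_inv, symbol_eq, tailConst]
  by_cases hm : m.natAbs ≤ M
  · have hnN : (N : ℝ) + 1 ≤ n := by exact_mod_cast (show N + 1 ≤ n by omega)
    have h1 := sqrt_le_norm (x := n * lam) (y := m) (u := |lam * (N + 1)|) (v := 0)
      (by rw [habs, abs_mul, mul_comm, abs_of_nonneg (by positivity : (0 : ℝ) ≤ N + 1)]; gcongr)
      (abs_nonneg _) (abs_nonneg _) le_rfl
    rw [zero_pow two_ne_zero, add_zero, Real.sqrt_sq (abs_nonneg _)] at h1
    have hpos : 0 < |lam * ((N : ℝ) + 1)| :=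
      abs_pos.2 (mul_ne_zero hlam.ne (by positivity))
    calc _ ≤ 1 / |lam * ((N : ℝ) + 1)| := by
          rw [one_div]; exact inv_anti₀ hpos h1
      _ ≤ _ := le_add_of_nonneg_left (by positivity)
  · have hmM : (M : ℝ) + 1 ≤ |(m : ℝ)| := by
      have : (M : ℤ) + 1 ≤ |m| := by rw [Int.abs_eq_natAbs]; omega
      exact_mod_cast this
    have h1 := sqrt_le_norm (x := n * lam) (y := m) (u := 2 * |lam|) (v := M + 1)
      (by rw [habs]; gcongr) hmM (by positivity) (by positivity)
    rw [mul_pow, sq_abs] at h1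
    norm_num at h1
    calc _ ≤ 1 / √(4 * lam ^ 2 + ((M : ℝ) + 1) ^ 2) := by
          rw [one_div]; refine inv_anti₀ (by positivity) (by push_cast; exact h1)
      _ ≤ _ := le_add_of_nonneg_right (by positivity)

lemma tailConst_pos {lam : ℝ} : 0 < tailConst lam N M := by
  unfold tailConst; positivity

/-- Orders `n ≤ 1` must be absent: there `L_λ⁻¹` is the identity and gains no factor `tailConst`. -/
lemma BddX.tailInv (hν : 1 ≤ ν) {lam : ℝ} (hlam : lam < 0) {g : Fin 2 → ℕ → ℤ → ℂ} {C : ℝ}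
    (hg : BddX ν g C) (h1 : ∀ i n m, n ≤ 1 → g i n m = 0) :
    BddX ν (tailInv lam N M g) (tailConst lam N M * C) :=
  hg.of_le hν tailConst_pos.le fun i n m => by
    have h0 : 0 ≤ tailConst lam N M := tailConst_pos.le
    simp only [GrossPitaevskii.tailInv, linInv]
    split_ifs with hb hn
    · rw [norm_zero]; positivity
    · rw [h1 i n m hn, norm_zero, mul_zero]
    · rw [norm_mul]
      gcongr
      exact inv_symbol_le hlam (by omega) hb

/-! ### The nonlinearity and its derivative -/

/-- The only nonzero coefficients are `1/2` at `m = ±2`; this is the source of the term `|b| ν²` in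
`Z1`. -/
lemma bddTF_gamma3 (hν : 1 ≤ ν) : BddTF ν (constTF gamma3) (ν ^ 2) := by
  refine ⟨memTF_of_finite hν {(0, 2), (0, -2)} fun n m h => ?_, ?_⟩
  · simp only [Finset.mem_insert, Finset.mem_singleton, Prod.mk.injEq] at h
    simp only [constTF, gamma3]
    split_ifs <;> tauto
  · have h1 : normTF ν (constTF gamma3) = normF ν gamma3 := by
      unfold normTF
      rw [tsum_eq_single 0 fun n hn => by simp [normF, constTF, hn]]
      simp [normF, constTF]
    rw [h1, normF, tsum_eq_sum (s := {2, -2}) fun m hm => by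
      simp only [Finset.mem_insert, Finset.mem_singleton] at hm
      simp [gamma3, hm]]
    rw [Finset.sum_pair (by norm_num)]
    norm_num [gamma3]
    linarith

lemma convTF_add (hν : 1 ≤ ν) {p q h : ℕ → ℤ → ℂ} (hh : MemTF ν h) (hp : MemTF ν p)
    (hq : MemTF ν q) : convTF h (p + q) = convTF h p + convTF h q := by
  have hpq := (hp.bdd.add hν hq.bdd).1
  have c1 := (hh.bdd.conv hν hp.bdd).1
  have c2 := (hh.bdd.conv hν hq.bdd).1
  refine toPS_injective hν (hh.bdd.conv hν hpq.bdd).1 (c1.bdd.add hν c2.bdd).1 ?_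
  rw [toPS_conv hν hh hpq, toPS_add hν hp hq, toPS_add hν c1 c2, toPS_conv hν hh hp,
    toPS_conv hν hh hq, mul_add]

lemma convTF_smul (z : ℂ) (p h : ℕ → ℤ → ℂ) : convTF h (z • p) = z • convTF h p := by
  ext n m
  simp only [convTF, convF, Pi.smul_apply, smul_eq_mul, Finset.mul_sum, ← tsum_mul_left]
  refine Finset.sum_congr rfl fun l _ => tsum_congr fun k => by ring

lemma rhsDeriv_one (a b c : ℝ) (w h : Fin 2 → ℕ → ℤ → ℂ) : rhsDeriv a b c w h 1 =
    -(a : ℂ) • h 0 + (b : ℂ) • convTF (constTF gamma3) (h 0)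
      + (3 * (c : ℂ)) • convTF (convTF (w 0) (w 0)) (h 0) := by
  ext n m; simp [rhsDeriv]

lemma rhs_one (a b c : ℝ) (w : Fin 2 → ℕ → ℤ → ℂ) : rhs a b c w 1 =
    -(a : ℂ) • w 0 + (b : ℂ) • convTF (constTF gamma3) (w 0)
      + (c : ℂ) • convTF (convTF (w 0) (w 0)) (w 0) := by
  ext n m; simp [rhs]

lemma rhsDeriv_zero (a b c : ℝ) (w h : Fin 2 → ℕ → ℤ → ℂ) : rhsDeriv a b c w h 0 = h 1 := rfl

lemma rhs_zero (a b c : ℝ) (w : Fin 2 → ℕ → ℤ → ℂ) : rhs a b c w 0 = w 1 := rfl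

variable {a b c : ℝ}

lemma rhsDeriv_add (hν : 1 ≤ ν) {w g h : Fin 2 → ℕ → ℤ → ℂ} (hw : MemX ν w) (hg : MemX ν g)
    (hh : MemX ν h) : rhsDeriv a b c w (g + h) = rhsDeriv a b c w g + rhsDeriv a b c w h := by
  have hww := ((hw 0).bdd.conv hν (hw 0).bdd).1
  funext i
  rw [Pi.add_apply]
  revert i
  simp only [Fin.forall_fin_two, rhsDeriv_zero, rhsDeriv_one, Pi.add_apply, true_and]
  rw [convTF_add hν (bddTF_gamma3 hν).1 (hg 0) (hh 0), convTF_add hν hww (hg 0) (hh 0)]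
  module

lemma rhsDeriv_smul (z : ℂ) (w h : Fin 2 → ℕ → ℤ → ℂ) :
    rhsDeriv a b c w (z • h) = z • rhsDeriv a b c w h := by
  funext i
  rw [Pi.smul_apply]
  revert i
  simp only [Fin.forall_fin_two, rhsDeriv_zero, rhsDeriv_one, Pi.smul_apply, true_and, convTF_smul]
  module

lemma tfMapDeriv_add {lam : ℝ} (hν : 1 ≤ ν) {w g h : Fin 2 → ℕ → ℤ → ℂ} (hw : MemX ν w)
    (hg : MemX ν g) (hh : MemX ν h) : tfMapDeriv a b c lam w (g + h) =
      tfMapDeriv a b c lam w g + tfMapDeriv a b c lam w h := by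
  ext i n m
  simp only [tfMapDeriv, rhsDeriv_add hν hw hg hh, Pi.add_apply]
  split_ifs <;> ring

lemma tfMapDeriv_smul {lam : ℝ} (z : ℂ) (w h : Fin 2 → ℕ → ℤ → ℂ) :
    tfMapDeriv a b c lam w (z • h) = z • tfMapDeriv a b c lam w h := by
  ext i n m
  simp only [tfMapDeriv, rhsDeriv_smul, Pi.smul_apply, smul_eq_mul]
  split_ifs <;> ring

/-- The bound of the operator norm of `Df(w)`. -/
noncomputable def rhsConst (a b c ν : ℝ) (w : Fin 2 → ℕ → ℤ → ℂ) : ℝ :=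
  max 1 (|a| + |b| * ν ^ 2 + 3 * |c| * normTF ν (convTF (w 0) (w 0)))

lemma BddX.rhsDeriv (hν : 1 ≤ ν) {w h : Fin 2 → ℕ → ℤ → ℂ} {C : ℝ} (hw : MemX ν w)
    (hh : BddX ν h C) : BddX ν (rhsDeriv a b c w h) (rhsConst a b c ν w * C) := by
  have hC := hh.nonneg hν
  have hww := ((hw 0).bdd.conv hν (hw 0).bdd).1
  rw [bddX_iff, Fin.forall_fin_two, rhsDeriv_zero, rhsDeriv_one]
  have h0 := bddX_iff.1 hh 0
  constructor
  · refine (bddX_iff.1 hh 1).mono ?_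
    exact le_mul_of_one_le_left hC (le_max_left _ _)
  · refine (((h0.smul hν _).add hν (((bddTF_gamma3 hν).conv hν h0).smul hν _)).add hν
      ((hww.bdd.conv hν h0).smul hν _)).mono ?_
    simp only [norm_neg, norm_mul, Complex.norm_real, Real.norm_eq_abs, Complex.norm_ofNat]
    refine le_trans (le_of_eq ?_) (mul_le_mul_of_nonneg_right (le_max_right _ _) hC)
    ring

/-- The remainder of `F` beyond first order. -/
noncomputable def remTF (c : ℝ) (h K : ℕ → ℤ → ℂ) : Fin 2 → ℕ → ℤ → ℂ :=
  fun i n m => if n ≤ 1 then 0 else if i = 0 then 0 else (c : ℂ) * convTF K h n m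

/-- The quadratic factor of the third order remainder. -/
noncomputable def cubeFactor (u p q : ℕ → ℤ → ℂ) : ℕ → ℤ → ℂ :=
  (3 : ℂ) • convTF u (p + q) + (convTF p p + convTF p q + convTF q q)

/-- Exact expansion of `F` around `u`. Constant and linear parts leave no remainder, so only the
cubic term of the second component contributes, at orders `n ≥ 2`; the minus sign comes from `-f` in
`F`. -/
lemma tfMap_sub (hν : 1 ≤ ν) {lam : ℝ} {v : Fin 2 → ℤ → ℂ} {u p q : Fin 2 → ℕ → ℤ → ℂ}
    (hu : MemX ν u) (hp : MemX ν p) (hq : MemX ν q) :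
    tfMap a b c lam v (u + p) - tfMap a b c lam v (u + q) =
      tfMapDeriv a b c lam u (p - q) - remTF c (p 0 - q 0) (cubeFactor (u 0) (p 0) (q 0)) := by
  have hneg : ∀ {x : ℕ → ℤ → ℂ}, MemTF ν x → MemTF ν ((-1 : ℂ) • x) :=
    fun hx => (hx.bdd.smul hν _).1
  have key := cube_remainder hν (hu 0) (hp 0) (hq 0)
  have hrhs : ∀ i, rhs a b c (u + p) i - rhs a b c (u + q) i = rhsDeriv a b c u (p - q) i +
      if i = 0 then 0 else (c : ℂ) • convTF (cubeFactor (u 0) (p 0) (q 0)) (p 0 - q 0) := by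
    rw [Fin.forall_fin_two]
    constructor
    · simp [rhs_zero, rhsDeriv_zero]
    · have e1 : p 0 - q 0 = p 0 + (-1 : ℂ) • q 0 := by module
      have e2 : convTF (constTF gamma3) (p 0 - q 0) =
          convTF (constTF gamma3) (p 0) - convTF (constTF gamma3) (q 0) := by
        rw [e1, convTF_add hν (bddTF_gamma3 hν).1 (hp 0) (hneg (hq 0)), convTF_smul]; module
      rw [rhs_one, rhs_one, rhsDeriv_one, if_neg one_ne_zero, cubeFactor, Pi.sub_apply, ← key, e2]
      simp only [Pi.add_apply]
      rw [convTF_add hν (bddTF_gamma3 hν).1 (hu 0) (hp 0),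
        convTF_add hν (bddTF_gamma3 hν).1 (hu 0) (hq 0)]
      module
  ext i n m
  have := congrFun (congrFun (hrhs i) n) m
  simp only [Pi.sub_apply, Pi.add_apply] at this
  simp only [tfMap, tfMapDeriv, remTF, Pi.sub_apply, Pi.add_apply]
  by_cases h0 : n = 0
  · subst h0; simp
  by_cases h1 : n = 1
  · subst h1; simp
  have h2 : ¬ n ≤ 1 := by omega
  simp only [h0, h1, h2, if_false]
  split_ifs at this ⊢ with hi
  · simp only [Pi.zero_apply] at this; linear_combination -this
  · simp only [Pi.smul_apply, smul_eq_mul] at this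
    linear_combination -this

lemma bddX_remTF (hν : 1 ≤ ν) {h K : ℕ → ℤ → ℂ} {C H : ℝ} (hK : BddTF ν K C)
    (hh : BddTF ν h H) : BddX ν (remTF c h K) (|c| * (C * H)) := by
  have hb := (hK.conv hν hh).smul hν (c : ℂ)
  rw [Complex.norm_real, Real.norm_eq_abs] at hb
  refine bddX_iff.2 fun i => hb.of_le_one hν fun n m => ?_
  unfold remTF
  split_ifs <;> simp <;> positivity

lemma bddTF_cubeFactor (hν : 1 ≤ ν) {u p q : ℕ → ℤ → ℂ} {P Q : ℝ} (hu : MemTF ν u)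
    (hp : BddTF ν p P) (hq : BddTF ν q Q) :
    BddTF ν (cubeFactor u p q) (3 * normTF ν u * (P + Q) + (P * P + P * Q + Q * Q)) := by
  refine (((hu.bdd.conv hν (hp.add hν hq)).smul hν 3).add hν
    (((hp.conv hν hp).add hν (hp.conv hν hq)).add hν (hq.conv hν hq))).mono (le_of_eq ?_)
  simp only [Complex.norm_ofNat]; ring

end

section

variable {ν : ℝ} {N M : ℕ} {Abar : Matrix (Fin 2 × ℕ × ℤ) (Fin 2 × ℕ × ℤ) ℂ} {a b c lam : ℝ}

/-! ### Supports -/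

lemma convF_congr {s t t' : ℤ → ℂ} {m : ℤ} (h : ∀ k, s k = 0 ∨ t (m - k) = t' (m - k)) :
    convF s t m = convF s t' m :=
  tsum_congr fun k => by rcases h k with h | h <;> simp [h]

lemma convTF_congr {P h h' : ℕ → ℤ → ℂ} {n : ℕ} {m : ℤ}
    (H : ∀ l ≤ n, ∀ k, P l k = 0 ∨ h (n - l) (m - k) = h' (n - l) (m - k)) :
    convTF P h n m = convTF P h' n m :=
  Finset.sum_congr rfl fun l hl => convF_congr (H l (by simpa [Nat.lt_succ_iff] using hl))

/-- Support in `n ≤ A`, `|m| ≤ B`. -/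
def SuppIn (A B : ℕ) (p : ℕ → ℤ → ℂ) : Prop := ∀ n m, ¬(n ≤ A ∧ m.natAbs ≤ B) → p n m = 0

lemma SuppIn.conv {A B A' B' : ℕ} {p q : ℕ → ℤ → ℂ} (hp : SuppIn A B p) (hq : SuppIn A' B' q) :
    SuppIn (A + A') (B + B') (convTF p q) := fun n m h => by
  refine Finset.sum_eq_zero fun l hl => ?_
  rw [Finset.mem_range] at hl
  refine (tsum_congr fun k => ?_).trans tsum_zero
  by_cases h1 : l ≤ A ∧ k.natAbs ≤ B
  · rw [hq (n - l) (m - k) (by omega), mul_zero]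
  · rw [hp l k h1, zero_mul]

lemma suppIn_gamma3 : SuppIn 0 2 (constTF gamma3) := fun n m h => by
  unfold constTF gamma3
  split_ifs with h1 h2
  · omega
  · rfl
  · rfl

/-- On the block, convolution with `w * w` shifts Fourier indices by at most `2M`, and convolution
with `γ⁽³⁾` by `2 ≤ 2M`; the Cauchy product never raises the Taylor index it reads. Hence the
truncation to `3N`, `3M` inside `Z1` loses nothing. -/
lemma tfMapDeriv_congr (hN : 1 ≤ N) (hM : 1 ≤ M) {w : Fin 2 → ℕ → ℤ → ℂ} (hw : SuppIn N M (w 0))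
    (h : Fin 2 → ℕ → ℤ → ℂ) {i n m} (hn : n ≤ N) (hm : m.natAbs ≤ M) :
    tfMapDeriv a b c lam w h i n m = tfMapDeriv a b c lam w
      (trunc (Finset.Icc 0 (3 * N)) (Finset.Icc 0 (3 * M)) h) i n m := by
  set h' := trunc (Finset.Icc 0 (3 * N)) (Finset.Icc 0 (3 * M)) h
  have e : ∀ j n m, n ≤ 3 * N → m.natAbs ≤ 3 * M → h j n m = h' j n m := fun j n m hn hm => by
    simp [h', trunc_block_apply, hn, hm]
  have key : rhsDeriv a b c w h i n m = rhsDeriv a b c w h' i n m := by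
    revert i
    simp only [Fin.forall_fin_two, rhsDeriv_zero, rhsDeriv_one]
    refine ⟨e _ _ _ (by omega) (by omega), ?_⟩
    simp only [Pi.add_apply, Pi.smul_apply]
    rw [e 0 n m (by omega) (by omega), convTF_congr (h := h 0) (h' := h' 0) (fun l hl k => ?_),
      convTF_congr (h := h 0) (h' := h' 0) (fun l hl k => ?_)]
    · by_cases hk : k.natAbs ≤ M + M
      · exact Or.inr (e _ _ _ (by omega) (by omega))
      · exact Or.inl (hw.conv hw l k (by omega))
    · by_cases hk : k.natAbs ≤ 2
      · exact Or.inr (e _ _ _ (by omega) (by omega))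
      · exact Or.inl (suppIn_gamma3 l k (by omega))
  simp only [tfMapDeriv, key, e i n m (by omega) (by omega)]

/-! ### The finite part of the operator in `Z₁` -/

/-- The operator whose norm enters `Z₁`. -/
noncomputable def defectOp (a b c lam : ℝ) (N M : ℕ)
    (Abar : Matrix (Fin 2 × ℕ × ℤ) (Fin 2 × ℕ × ℤ) ℂ) (w h : Fin 2 → ℕ → ℤ → ℂ) :
    Fin 2 → ℕ → ℤ → ℂ :=
  trunc (Finset.Icc 0 N) (Finset.Icc 0 M) h - finPart N M Abar (tfMapDeriv a b c lam w
    (trunc (Finset.Icc 0 (3 * N)) (Finset.Icc 0 (3 * M)) h))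

lemma rhsConst_nonneg (w : Fin 2 → ℕ → ℤ → ℂ) : 0 ≤ rhsConst a b c ν w :=
  zero_le_one.trans (le_max_left _ _)

/-- `DF` is unbounded on `X`, but `A_f` reads only entries of the block, where the symbol is at most
`M + N|λ|`. This provides the finite bound which makes the infimum in `opNormX` meaningful. -/
lemma bddX_defectOp (hν : 1 ≤ ν) {w h : Fin 2 → ℕ → ℤ → ℂ} {C : ℝ}
    (hw : MemX ν w) (hh : BddX ν h C) :
    BddX ν (defectOp a b c lam N M Abar w h)
      (opNormX ν (defectOp a b c lam N M Abar w) * C) := by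
  obtain ⟨D, hD, hb⟩ := exists_finPart_bound hν N M Abar
  set L := (M + N * |lam|) + rhsConst a b c ν w + 1 with hL
  have hR := rhsConst_nonneg (a := a) (b := b) (c := c) (ν := ν) w
  have hL0 : 0 ≤ L := by positivity
  have hb' : ∀ h, MemX ν h → BddX ν (defectOp a b c lam N M Abar w h)
      ((1 + D * L) * normX ν h) := fun h hh => by
    have h0 := normX_nonneg hν h
    refine ((hh.bdd.trunc hν _ _).sub hν (hb _ (L * normX ν h) (by positivity) ?_)).mono
      (by linarith)
    intro j n m hn hm
    have ht := hh.bdd.trunc hν (Finset.Icc 0 (3 * N)) (Finset.Icc 0 (3 * M))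
    have h1 := (bddX_iff.1 ht j).apply_le hν n m
    have h2 := (bddX_iff.1 (ht.rhsDeriv (a := a) (b := b) (c := c) hν hw) j).apply_le hν n m
    have hs : ‖Complex.I * m + n * (lam : ℂ)‖ ≤ M + N * |lam| := by
      refine (norm_add_le _ _).trans ?_
      simp only [norm_mul, Complex.norm_I, one_mul, Complex.norm_natCast, Complex.norm_real,
        Real.norm_eq_abs, Complex.norm_intCast]
      have : |m| ≤ (M : ℤ) := by rw [Int.abs_eq_natAbs]; exact_mod_cast hm
      gcongr
      exact_mod_cast this
    simp only [tfMapDeriv]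
    split_ifs
    · refine h1.trans (le_mul_of_one_le_left h0 ?_)
      rw [hL]
      have : 0 ≤ M + N * |lam| := by positivity
      linarith
    · refine (norm_sub_le _ _).trans ?_
      rw [norm_mul]
      have : ‖Complex.I * m + n * (lam : ℂ)‖ *
        ‖trunc (Finset.Icc 0 (3 * N)) (Finset.Icc 0 (3 * M)) h j n m‖ ≤
          (M + N * |lam|) * normX ν h := by gcongr
      rw [hL]
      linarith
  refine ⟨(hb' h hh.1).1, (le_opNormX hν (by positivity : 0 ≤ 1 + D * L)
    (fun h hh => (hb' h hh).2) hh.1).trans ?_⟩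
  exact mul_le_mul_of_nonneg_left hh.2 (opNormX_nonneg _)

/-- Sequences supported in the finite block. -/
def blockSub (N M : ℕ) : Submodule ℂ (Fin 2 → ℕ → ℤ → ℂ) where
  carrier := {w | ∀ i, SuppIn N M (w i)}
  add_mem' {u w} hu hw i n m h := by simp [hu i n m h, hw i n m h]
  zero_mem' := fun _ _ _ _ => rfl
  smul_mem' z w hw i n m h := by simp [hw i n m h]

lemma finPart_mem_blockSub (h : Fin 2 → ℕ → ℤ → ℂ) : finPart N M Abar h ∈ blockSub N M :=
  fun _ _ _ hb => finPart_of_not hb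

lemma memX_of_mem_blockSub (hν : 1 ≤ ν) {w} (hw : w ∈ blockSub N M) : MemX ν w := fun i =>
  memTF_of_finite hν (Finset.Icc 0 N ×ˢ Finset.Icc (-(M : ℤ)) M) fun n m hnm => by
    simp only [Finset.mem_product, Finset.mem_Icc] at hnm
    exact hw i n m (by omega)

instance finiteDimensional_blockSub (N M : ℕ) : FiniteDimensional ℂ (blockSub N M) := by
  let f : blockSub N M →ₗ[ℂ]
      (Fin 2 × Finset.Icc 0 N × Finset.Icc (-(M : ℤ)) M → ℂ) :=
    { toFun := fun w k => w.1 k.1 k.2.1 k.2.2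
      map_add' := fun _ _ => rfl
      map_smul' := fun _ _ => rfl }
  refine FiniteDimensional.of_injective f fun u w h => ?_
  ext i n m
  by_cases hb : n ≤ N ∧ m.natAbs ≤ M
  · exact congrFun h (i, ⟨n, by simp [hb.1]⟩, ⟨m, by rw [Finset.mem_Icc]; omega⟩)
  · rw [u.2 i n m hb, w.2 i n m hb]

/-- If the finite defect is a contraction then `A_f` is injective on the finite block. -/
lemma finPart_injective (hν : 1 ≤ ν) (hN : 1 ≤ N) (hM : 1 ≤ M)
    {w : Fin 2 → ℕ → ℤ → ℂ} (hw : MemX ν w) (hsupp : SuppIn N M (w 0))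
    (hlt : opNormX ν (defectOp a b c lam N M Abar w) < 1) {g : Fin 2 → ℕ → ℤ → ℂ}
    (hg : finPart N M Abar g = 0) (i : Fin 2) {n : ℕ} {m : ℤ} (hn : n ≤ N) (hm : m.natAbs ≤ M) :
    g i n m = 0 := by
  let tr : (Fin 2 → ℕ → ℤ → ℂ) → blockSub N M := fun h =>
    ⟨trunc (Finset.Icc 0 N) (Finset.Icc 0 M) h, fun i n m hb => by
      rw [trunc_block_apply, if_neg hb]⟩
  have tr_eq : ∀ h : blockSub N M, trunc (Finset.Icc 0 N) (Finset.Icc 0 M) h.1 = h.1 := fun h => by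
    ext i n m
    rw [trunc_block_apply]
    split_ifs with hb
    · rfl
    · exact (h.2 i n m hb).symm
  let A : blockSub N M →ₗ[ℂ] blockSub N M :=
    { toFun := fun h => ⟨finPart N M Abar h.1, finPart_mem_blockSub _⟩
      map_add' := fun h k => Subtype.ext (finPart_add h.1 k.1)
      map_smul' := fun z h => Subtype.ext (finPart_smul z h.1) }
  let D : blockSub N M →ₗ[ℂ] blockSub N M :=
    { toFun := fun h => tr (tfMapDeriv a b c lam w h.1)
      map_add' := fun h k => by
        ext i n m
        simp only [tr, trunc_block_apply, Submodule.coe_add, tfMapDeriv_add hν hw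
          (memX_of_mem_blockSub hν h.2) (memX_of_mem_blockSub hν k.2), Pi.add_apply]
        split_ifs <;> simp
      map_smul' := fun z h => by
        ext i n m
        simp only [tr, trunc_block_apply, Submodule.coe_smul, tfMapDeriv_smul, Pi.smul_apply,
          RingHom.id_apply]
        split_ifs <;> simp }
  -- On the block the defect is `1 - A ∘ D`, so it fixes every vector in the kernel of `A ∘ D`; its
  -- norm being less than one, such a vector is zero.
  have hAD : Function.Injective (A ∘ₗ D) := by
    rw [← LinearMap.ker_eq_bot, LinearMap.ker_eq_bot']
    intro h hh
    have h0 : finPart N M Abar (tfMapDeriv a b c lam w h.1) = 0 := by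
      have : finPart N M Abar (trunc (Finset.Icc 0 N) (Finset.Icc 0 M)
          (tfMapDeriv a b c lam w h.1)) = 0 := congrArg Subtype.val hh
      rw [← this]
      exact finPart_congr fun i n m hn hm => by simp [trunc_block_apply, hn, hm]
    have h1 : defectOp a b c lam N M Abar w h.1 = h.1 := by
      rw [defectOp, ← finPart_congr fun i n m hn hm => tfMapDeriv_congr hN hM hsupp h.1 hn hm, h0,
        tr_eq, sub_zero]
    have hm := memX_of_mem_blockSub hν h.2
    have h2 := bddX_defectOp (a := a) (b := b) (c := c) (N := N) (M := M) (Abar := Abar) (lam := lam) hν hw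
      hm.bdd
    rw [h1] at h2
    have h3 := normX_nonneg hν h.1
    have h4 : normX ν h.1 ≤ 0 := by nlinarith [h2.2]
    exact Subtype.ext (eq_of_normX_le_zero hν (w' := 0) (by simpa using ⟨hm, h4⟩))
  -- In finite dimension `A ∘ D` is then surjective, so `A` is surjective and therefore injective.
  have hA : Function.Injective A := by
    refine LinearMap.injective_iff_surjective.2 ?_
    have := LinearMap.injective_iff_surjective.1 hAD
    rw [LinearMap.coe_comp] at this
    exact this.of_comp
  have hz : tr g = 0 := hA (by
    rw [map_zero]
    refine Subtype.ext ?_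
    rw [Submodule.coe_zero, ← hg]
    exact finPart_congr fun i n m hn hm => by simp [tr, trunc_block_apply, hn, hm])
  have := congrFun (congrFun (congrFun (congrArg Subtype.val hz) i) n) m
  simpa [tr, trunc_block_apply, hn, hm] using this

/-! ### The Newton–Kantorovich argument -/

/-- The Newton-like operator. -/
noncomputable def newtonOp (a b c lam : ℝ) (N M : ℕ)
    (Abar : Matrix (Fin 2 × ℕ × ℤ) (Fin 2 × ℕ × ℤ) ℂ) (v : Fin 2 → ℤ → ℂ)
    (w : Fin 2 → ℕ → ℤ → ℂ) : Fin 2 → ℕ → ℤ → ℂ :=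
  w - finPart N M Abar (tfMap a b c lam v w) - tailInv lam N M (tfMap a b c lam v w)

/-- The two parts of the approximate inverse have disjoint index sets, so each annihilates `F(w)`
separately. The finite part is injective on the block, and the tail is diagonal with nonzero
entries, since `im + nλ` has real part `nλ ≠ 0`. -/
lemma tfMap_eq_zero_of_fixed (hν : 1 ≤ ν) (hN : 1 ≤ N) (hM : 1 ≤ M) (hlam : lam < 0)
    {v : Fin 2 → ℤ → ℂ} {u w : Fin 2 → ℕ → ℤ → ℂ} (hu : MemX ν u) (hsupp : SuppIn N M (u 0))
    (hlt : opNormX ν (defectOp a b c lam N M Abar u) < 1)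
    (hw : newtonOp a b c lam N M Abar v w = w) : tfMap a b c lam v w = 0 := by
  set g := tfMap a b c lam v w
  have h0 : ∀ i n m, finPart N M Abar g i n m + tailInv lam N M g i n m = 0 := fun i n m => by
    have := congrFun (congrFun (congrFun hw i) n) m
    simp only [newtonOp, Pi.sub_apply] at this
    linear_combination -this
  have hfin : finPart N M Abar g = 0 := by
    ext i n m
    by_cases hb : n ≤ N ∧ m.natAbs ≤ M
    · simpa [tailInv, hb] using h0 i n m
    · exact finPart_of_not hb
  ext i n m
  by_cases hb : n ≤ N ∧ m.natAbs ≤ M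
  · exact finPart_injective hν hN hM hu hsupp hlt hfin i hb.1 hb.2
  · have := h0 i n m
    rw [finPart_of_not hb, zero_add, tailInv, if_neg hb, linInv] at this
    split_ifs at this with hn
    · exact this
    · exact (mul_eq_zero.1 this).resolve_left (inv_ne_zero (symbol_ne_zero hlam (by omega) m))

/-- The Lipschitz estimate of the Newton-like operator. -/
lemma bddX_newtonOp_sub (hν : 1 ≤ ν) (hN : 1 ≤ N) (hM : 1 ≤ M) (hlam : lam < 0)
    {v : Fin 2 → ℤ → ℂ} {u p q : Fin 2 → ℕ → ℤ → ℂ} (hu : MemX ν u) (hsupp : SuppIn N M (u 0))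
    {P Q : ℝ} (hp : BddX ν p P) (hq : BddX ν q Q) :
    BddX ν (newtonOp a b c lam N M Abar v (u + p) - newtonOp a b c lam N M Abar v (u + q))
      ((opNormX ν (defectOp a b c lam N M Abar u) + tailConst lam N M * rhsConst a b c ν u
        + (opNormX ν (finPart N M Abar) + tailConst lam N M) *
          (|c| * (3 * normTF ν (u 0) * (P + Q) + (P * P + P * Q + Q * Q))))
        * normX ν (p - q)) := by
  set h := p - q with hh_def
  have hh : MemX ν h := (hp.sub hν hq).1
  have hpi := bddX_iff.1 hp 0
  have hqi := bddX_iff.1 hq 0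
  have hK := bddTF_cubeFactor hν (hu 0) hpi hqi
  have hr := bddX_remTF (c := c) hν hK (bddX_iff.1 hh.bdd 0)
  set K := cubeFactor (u 0) (p 0) (q 0)
  set R := remTF c (h 0) K
  set D := tfMapDeriv a b c lam u h
  -- `G` is `Df(u) h` without orders `n ≤ 1`, where `F` involves no `f`; this is what makes
  -- `BddX.tailInv` applicable.
  let G : Fin 2 → ℕ → ℤ → ℂ := fun i n m => if n ≤ 1 then 0 else rhsDeriv a b c u h i n m
  have hG : BddX ν G (rhsConst a b c ν u * normX ν h) :=
    (hh.bdd.rhsDeriv hν hu).of_le_one hν fun i n m => by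
      simp only [G]; split_ifs <;> simp
  have hF := tfMap_sub (a := a) (b := b) (c := c) (lam := lam) (v := v) hν hu hp.1 hq.1
  have hdef : defectOp a b c lam N M Abar u h =
      trunc (Finset.Icc 0 N) (Finset.Icc 0 M) h - finPart N M Abar D := by
    rw [defectOp, ← finPart_congr fun i n m hn hm => tfMapDeriv_congr hN hM hsupp h hn hm]
  -- Off the block `L_λ⁻¹ DF(u) h = h - L_λ⁻¹ G`, so the tail of `h` cancels in the Newton step and
  -- only the part with gain `tailConst` survives.
  have htail : h = trunc (Finset.Icc 0 N) (Finset.Icc 0 M) h + tailInv lam N M D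
      + tailInv lam N M G := by
    ext i n m
    simp only [Pi.add_apply, trunc_block_apply, tailInv, linInv, D, G, tfMapDeriv]
    split_ifs with h1 h2
    · simp
    · simp
    · rw [mul_sub, inv_mul_cancel_left₀ (symbol_ne_zero hlam (by omega) m)]; ring
  have hsplit : newtonOp a b c lam N M Abar v (u + p) - newtonOp a b c lam N M Abar v (u + q) =
      (defectOp a b c lam N M Abar u h + tailInv lam N M G)
        + (finPart N M Abar R + tailInv lam N M R) := by
    have e1 : finPart N M Abar (tfMap a b c lam v (u + p)) -
        finPart N M Abar (tfMap a b c lam v (u + q)) =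
        finPart N M Abar D - finPart N M Abar R := by
      rw [← finPart_sub, hF, finPart_sub]; rfl
    have e2 : tailInv lam N M (tfMap a b c lam v (u + p)) -
        tailInv lam N M (tfMap a b c lam v (u + q)) =
        tailInv lam N M D - tailInv lam N M R := by
      rw [← tailInv_sub, hF, tailInv_sub]; rfl
    calc _ = h - (finPart N M Abar (tfMap a b c lam v (u + p)) -
          finPart N M Abar (tfMap a b c lam v (u + q))) -
          (tailInv lam N M (tfMap a b c lam v (u + p)) -
            tailInv lam N M (tfMap a b c lam v (u + q))) := by
            simp only [newtonOp, hh_def]; abel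
      _ = _ := by rw [e1, e2, hdef]; nth_rewrite 1 [htail]; abel
  rw [hsplit]
  refine (((bddX_defectOp hν hu hh.bdd).add hν (hG.tailInv hν hlam
    fun i n m hn => if_pos hn)).add hν ((hr.finPart hν).add hν (hr.tailInv hν hlam
    fun i n m hn => if_pos hn))).mono (le_of_eq ?_)
  ring

end

/-! ### The residual estimate, the radius, and the zero of `F` -/

section

variable {ν : ℝ} {N M : ℕ} {Abar : Matrix (Fin 2 × ℕ × ℤ) (Fin 2 × ℕ × ℤ) ℂ} {a b c lam : ℝ}

lemma SuppIn.mono {A B A' B' : ℕ} {p : ℕ → ℤ → ℂ} (hp : SuppIn A B p) (hA : A ≤ A') (hB : B ≤ B') :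
    SuppIn A' B' p := fun n m h => hp n m (by omega)

/-- The cubic term triples the support, and the shift by `2` from `γ⁽³⁾` fits in `3M` because `M ≥
1`. Thus the truncations in `Y` exhaust the tail of `L_λ⁻¹ F(wbar)` at orders `n ≥ 2`. -/
lemma suppIn_rhs (hN : 1 ≤ N) (hM : 1 ≤ M) {w : Fin 2 → ℕ → ℤ → ℂ} (hw : ∀ i, SuppIn N M (w i))
    (i : Fin 2) : SuppIn (3 * N) (3 * M) (rhs a b c w i) := by
  have h0 := (hw 0).mono (A' := 3 * N) (B' := 3 * M) (by omega) (by omega)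
  have h1 := (suppIn_gamma3.conv (hw 0)).mono (A' := 3 * N) (B' := 3 * M) (by omega) (by omega)
  have h2 := (((hw 0).conv (hw 0)).conv (hw 0)).mono (A' := 3 * N) (B' := 3 * M) (by omega)
    (by omega)
  revert i
  rw [Fin.forall_fin_two, rhs_zero, rhs_one]
  refine ⟨(hw 1).mono (by omega) (by omega), fun n m h => ?_⟩
  simp [h0 n m h, h1 n m h, h2 n m h]

/-- A Fourier sequence placed at Taylor order one. -/
def orderOne (s : Fin 2 → ℤ → ℂ) : Fin 2 → ℕ → ℤ → ℂ := fun i n m => if n = 1 then s i m else 0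

lemma bddX_orderOne {s : Fin 2 → ℤ → ℂ} {C : ℝ} (hs : ∀ i, BddF ν (s i) C) :
    BddX ν (orderOne s) C := by
  refine bddX_iff.2 fun i => ?_
  have h1 : ∀ n, n ≠ 1 → normF ν (orderOne s i n) = 0 := fun n hn => by
    simp [normF, orderOne, hn]
  have h2 : orderOne s i 1 = s i := by ext; simp [orderOne]
  refine ⟨⟨fun n => ?_, summable_of_ne_finset_zero (s := {1}) fun n hn =>
    h1 n (by simpa using hn)⟩, ?_⟩
  · by_cases hn : n = 1
    · rw [hn, h2]; exact (hs i).1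
    · simp [MemF, orderOne, hn, summable_zero]
  · rw [normTF, tsum_eq_single 1 h1, h2]; exact (hs i).2

lemma memX_trunc_Icc (hν : 1 ≤ ν) (R S : Finset ℕ) (w : Fin 2 → ℕ → ℤ → ℂ) :
    MemX ν (trunc R S w) := fun i =>
  memTF_of_finite hν (R ×ˢ (S.image (fun k : ℕ => (k : ℤ)) ∪ S.image (fun k : ℕ => -(k : ℤ))))
    fun n m h => by
      refine if_neg fun hb => h ?_
      simp only [Finset.mem_product, Finset.mem_union, Finset.mem_image]
      refine ⟨hb.1, ?_⟩
      rcases Int.natAbs_eq m with h | h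
      · exact Or.inl ⟨_, hb.2, h.symm⟩
      · exact Or.inr ⟨_, hb.2, h.symm⟩

/-- The residual estimate. -/
lemma bddX_newtonOp_residual (hν : 1 ≤ ν) (hN : 1 ≤ N) (hM : 1 ≤ M)
    {v vbar : Fin 2 → ℤ → ℂ} {u : Fin 2 → ℕ → ℤ → ℂ} (hsupp : ∀ i, SuppIn N M (u i))
    (h0 : ∀ i m, u i 0 m = 0) (h1 : ∀ i m, u i 1 m = vbar i m) {rF : ℝ}
    (hr : ∀ i, BddF ν (vbar i - v i) rF) :
    BddX ν (newtonOp a b c lam N M Abar v u - u) (boundY a b c ν lam rF N M Abar v u) := by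
  set F := tfMap a b c lam v u with hF
  have hF0 : ∀ i m, F i 0 m = 0 := fun i m => by simp [hF, tfMap, h0]
  have hF1 : ∀ i m, F i 1 m = vbar i m - v i m := fun i m => by simp [hF, tfMap, h1]
  have hFs : ∀ i n m, 2 ≤ n → ¬(n ≤ 3 * N ∧ m.natAbs ≤ 3 * M) → F i n m = 0 :=
    fun i n m hn hb => by
      simp only [hF, tfMap, if_neg (show n ≠ 0 by omega), if_neg (show n ≠ 1 by omega)]
      rw [suppIn_rhs hN hM hsupp i n m hb, hsupp i n m (by omega)]
      simp
  have hO := bddX_orderOne hr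
  set O := orderOne fun i => vbar i - v i with hOdef
  have hO1 : ∀ i m, O i 1 m = vbar i m - v i m := fun i m => by simp [hOdef, orderOne]
  have hO2 : ∀ i n m, n ≠ 1 → O i n m = 0 := fun i n m hn => by simp [hOdef, orderOne, hn]
  set B := trunc (Finset.Icc 2 N) (Finset.Icc 0 M) F with hB
  -- At order one the residual is `vbar - v`, whose values are known only through `rF`; splitting it
  -- off as `O` gives the term `rF ‖A_f‖` of `Y`.
  have efin : finPart N M Abar F = finPart N M Abar O + finPart N M Abar B := by
    rw [← finPart_add]
    refine finPart_congr fun i n m hn hm => ?_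
    simp only [Pi.add_apply, hB, trunc, Finset.mem_Icc]
    rcases Nat.lt_or_ge n 2 with h | h
    · rw [if_neg (by omega)]
      interval_cases n
      · rw [hF0, hO2 _ _ _ zero_ne_one, zero_add]
      · rw [hF1, hO1, add_zero]
    · rw [if_pos (by omega), hO2 _ _ _ (by omega), zero_add]
  set T1 := trunc (Finset.Ioc N (3 * N)) (Finset.Icc 0 (3 * M)) (linInv lam F) with hT1
  set T2 := trunc (Finset.Icc 2 N) (Finset.Ioc M (3 * M)) (linInv lam F) with hT2
  let O' : Fin 2 → ℕ → ℤ → ℂ := fun i n m => if m.natAbs ≤ M then 0 else O i n m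
  -- `O'` holds the Fourier modes `|m| > M` of `vbar - v`. At order one `L_λ⁻¹` is the identity, so
  -- it contributes the bare `rF` of `Y`.
  have etail : tailInv lam N M F = O' + T1 + T2 := by
    ext i n m
    simp only [tailInv, Pi.add_apply, O', hT1, hT2, trunc, Finset.mem_Icc, Finset.mem_Ioc]
    rcases Nat.lt_or_ge n 2 with h | h
    · rw [if_neg (show ¬((N < n ∧ n ≤ 3 * N) ∧ _) by omega),
        if_neg (show ¬((2 ≤ n ∧ n ≤ N) ∧ _) by omega)]
      interval_cases n
      · simp [linInv, hF0, hO2]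
      · simp [linInv, hF1, hO1, hN]
    · rw [hO2 _ _ _ (by omega), ite_self, zero_add]
      by_cases hb : n ≤ 3 * N ∧ m.natAbs ≤ 3 * M
      · by_cases h2 : n ≤ N
        · by_cases h3 : m.natAbs ≤ M
          · rw [if_pos ⟨h2, h3⟩, if_neg (by omega), if_neg (by omega), add_zero]
          · rw [if_neg (by omega), if_neg (by omega), if_pos (by omega), zero_add]
        · rw [if_neg (by omega), if_pos (by omega), if_neg (by omega), add_zero]
      · have hz : linInv lam F i n m = 0 := by simp [linInv, hFs i n m h hb]
        simp [hz]
  have hO' : BddX ν O' rF := hO.of_le_one hν fun i n m => by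
    simp only [O']; split_ifs <;> simp
  have hB' : MemX ν (finPart N M Abar B) := memX_of_mem_blockSub hν (finPart_mem_blockSub _)
  have hsplit : newtonOp a b c lam N M Abar v u - u =
      0 - ((finPart N M Abar O + finPart N M Abar B) + O' + T1 + T2) := by
    rw [newtonOp, ← hF, efin, etail]; abel
  have hzero : BddX ν (0 : Fin 2 → ℕ → ℤ → ℂ) 0 := by
    have := hO.of_le hν (p := 0) le_rfl fun i n m => by simp
    simpa using this
  rw [hsplit]
  refine (hzero.sub hν (((((hO.finPart hν).add hν hB'.bdd).add hν hO').add hν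
    (memX_trunc_Icc hν _ _ _).bdd).add hν (memX_trunc_Icc hν _ _ _).bdd)).mono (le_of_eq ?_)
  rw [boundY]; ring

lemma boundZ1_eq (w : Fin 2 → ℕ → ℤ → ℂ) : boundZ1 a b c ν lam N M Abar w =
    opNormX ν (defectOp a b c lam N M Abar w) + tailConst lam N M * rhsConst a b c ν w := rfl

lemma boundZ2_eq (w : Fin 2 → ℕ → ℤ → ℂ) (r : ℝ) : boundZ2 c ν lam N M Abar w r =
    3 * |c| * (opNormX ν (finPart N M Abar) + tailConst lam N M) * (2 * normTF ν (w 0) + r) := by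
  unfold boundZ2 tailConst; ring

/-- `r` is the smaller root of `Z2 r²/2 - (1 - Z1) r + Y`, and `Z1 + Z2 r = 1 - s` with `s` the root
of the discriminant. Strictness of the discriminant condition makes `s > 0`, which is the
contraction. -/
lemma nkRadius_spec {Y Z1 Z2 : ℝ} (hY : 0 ≤ Y) (hZ2 : 0 < Z2) (h1 : Z1 < 1)
    (h : 2 * Y * Z2 < (1 - Z1) ^ 2) :
    0 ≤ nkRadius Y Z1 Z2 ∧ Z1 + Z2 * nkRadius Y Z1 Z2 < 1 ∧
      Y + Z1 * nkRadius Y Z1 Z2 + Z2 / 2 * nkRadius Y Z1 Z2 ^ 2 = nkRadius Y Z1 Z2 := by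
  set s := √((1 - Z1) ^ 2 - 2 * Y * Z2) with hs
  have hs2 : s ^ 2 = (1 - Z1) ^ 2 - 2 * Y * Z2 := Real.sq_sqrt (by linarith)
  have hs0 : 0 < s := Real.sqrt_pos.2 (by linarith)
  have hle : s ≤ 1 - Z1 := by
    refine Real.sqrt_le_iff.2 ⟨by linarith, ?_⟩
    have : 0 ≤ 2 * Y * Z2 := by positivity
    linarith
  have hr : Z2 * nkRadius Y Z1 Z2 = 1 - Z1 - s := by
    rw [nkRadius]; field_simp
    rw [hs]; ring_nf
  set r := nkRadius Y Z1 Z2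
  refine ⟨?_, by linarith, ?_⟩
  · by_contra hneg
    have : Z2 * r < 0 := mul_neg_of_pos_of_neg hZ2 (by linarith)
    linarith
  · have : Z2 * (Y + Z1 * r + Z2 / 2 * r ^ 2) = Z2 * r := by
      have e : Z2 * (Y + Z1 * r + Z2 / 2 * r ^ 2) = Y * Z2 + Z1 * (Z2 * r) + (Z2 * r) ^ 2 / 2 := by
        ring
      rw [e, hr]; nlinarith
    exact mul_left_cancel₀ hZ2.ne' this

/-- Existence and local uniqueness of the zero of the Taylor–Fourier map. -/
theorem exists_unique_zero (hc : c ≠ 0) (hν : 1 ≤ ν) (hN : 1 ≤ N) (hM : 1 ≤ M) (hlam : lam < 0)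
    {v vbar : Fin 2 → ℤ → ℂ} {u : Fin 2 → ℕ → ℤ → ℂ} (hsupp : ∀ i, SuppIn N M (u i))
    (h0 : ∀ i m, u i 0 m = 0) (h1 : ∀ i m, u i 1 m = vbar i m) {rF : ℝ}
    (hr : ∀ i, BddF ν (vbar i - v i) rF) {rStar Y Z1 Z2 r : ℝ} (hrStar : 0 < rStar)
    (hY : Y = boundY a b c ν lam rF N M Abar v u)
    (hZ1 : Z1 = boundZ1 a b c ν lam N M Abar u)
    (hZ2 : Z2 = boundZ2 c ν lam N M Abar u rStar) (hrdef : r = nkRadius Y Z1 Z2)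
    (hZ1_lt : Z1 < 1) (hZ2_lt : 2 * Y * Z2 < (1 - Z1) ^ 2) (hr_le : r ≤ rStar) :
    ∃ w, BddX ν (w - u) r ∧ tfMap a b c lam v w = 0 ∧
      ∀ w', BddX ν (w' - u) r → tfMap a b c lam v w' = 0 → w' = w := by
  have hres := bddX_newtonOp_residual (a := a) (b := b) (c := c) (lam := lam) (Abar := Abar)
    hν hN hM hsupp h0 h1 hr
  rw [← hY] at hres
  have hu : MemX ν u := memX_of_mem_blockSub hν (show u ∈ blockSub N M from hsupp)
  have hY0 := hres.nonneg hν
  have hA := opNormX_nonneg (ν := ν) (finPart N M Abar)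
  have hκ := tailConst_pos (lam := lam) (N := N) (M := M)
  have hR := rhsConst_nonneg (a := a) (b := b) (c := c) (ν := ν) u
  have hE := opNormX_nonneg (ν := ν) (defectOp a b c lam N M Abar u)
  have hu0 := normTF_nonneg hν (u 0)
  have hc' := abs_pos.2 hc
  rw [boundZ1_eq] at hZ1
  rw [boundZ2_eq] at hZ2
  have hZ2pos : 0 < Z2 := by rw [hZ2]; positivity
  obtain ⟨hr0, hq, hfix⟩ := nkRadius_spec hY0 hZ2pos hZ1_lt hZ2_lt
  rw [← hrdef] at hr0 hq hfix
  set α := opNormX ν (finPart N M Abar) + tailConst lam N M with hα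
  have hα0 : 0 < α := by positivity
  have hZ1' : 0 ≤ Z1 := by rw [hZ1]; positivity
  have hlt : opNormX ν (defectOp a b c lam N M Abar u) < 1 :=
    lt_of_le_of_lt (by rw [hZ1]; exact le_add_of_nonneg_right (by positivity)) hZ1_lt
  have hcr : |c| * (3 * (2 * normTF ν (u 0) + r)) * α ≤ Z2 := by
    rw [hZ2]
    calc _ = 3 * |c| * α * (2 * normTF ν (u 0) + r) := by ring
      _ ≤ _ := by gcongr
  -- Two separate radii are kept: `P = Q = r` yields the contraction constant `Z1 + Z2 r`, while `Q
  -- = 0`, comparing with the centre, yields the smaller `Z1 + Z2 r / 2` needed for invariance of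
  -- the ball.
  have est : ∀ w w' P Q, BddX ν (w - u) P → BddX ν (w' - u) Q →
      BddX ν (newtonOp a b c lam N M Abar v w - newtonOp a b c lam N M Abar v w')
        ((Z1 + α * (|c| * (3 * normTF ν (u 0) * (P + Q) + (P * P + P * Q + Q * Q))))
        * normX ν (w - w')) := fun w w' P Q hw hw' => by
    have := bddX_newtonOp_sub (a := a) (b := b) (c := c) (lam := lam) (v := v) (Abar := Abar)
      hν hN hM hlam hu (hsupp 0) hw hw'
    rwa [add_sub_cancel, add_sub_cancel, sub_sub_sub_cancel_right, ← hZ1, ← hα] at this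
  obtain ⟨w, hw, hTw, huniq⟩ := exists_unique_fixed (T := newtonOp a b c lam N M Abar v)
    (u := u) hν hu hr0 hq (by positivity) (fun w w' hw hw' => by
      refine (est w w' r r hw hw').mono ?_
      refine mul_le_mul_of_nonneg_right ?_ (normX_nonneg hν _)
      have : α * (|c| * (3 * normTF ν (u 0) * (r + r) + (r * r + r * r + r * r))) =
          |c| * (3 * (2 * normTF ν (u 0) + r)) * α * r := by ring
      rw [this]
      gcongr) (fun w hw => by
      have hzero : BddX ν (u - u) 0 := by
        rw [sub_self]
        have := hw.of_le hν (p := 0) le_rfl fun i n m => by simp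
        simpa using this
      have h := (est w u r 0 hw hzero).add hν hres
      rw [sub_add_sub_cancel] at h
      refine h.mono ?_
      have hh := hw.2
      -- Against the centre the remainder is `3‖u‖r + r²`, at most half of `3(2‖u‖ + r) r`.
      have hq' : Z1 + α * (|c| * (3 * normTF ν (u 0) * (r + 0) + (r * r + r * 0 + 0 * 0))) ≤
          Z1 + Z2 / 2 * r := by
        have : α * (|c| * (3 * normTF ν (u 0) * (r + 0) + (r * r + r * 0 + 0 * 0))) ≤
          |c| * (3 * (2 * normTF ν (u 0) + r)) * α / 2 * r := by
          have : 0 ≤ |c| * α * (r * r) := by positivity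
          nlinarith
        have h2 : |c| * (3 * (2 * normTF ν (u 0) + r)) * α / 2 * r ≤ Z2 / 2 * r := by gcongr
        linarith
      calc _ ≤ (Z1 + Z2 / 2 * r) * r + Y :=
            add_le_add (mul_le_mul hq' hh (normX_nonneg hν _) (by positivity)) le_rfl
        _ = r := by linear_combination hfix)
  refine ⟨w, hw, tfMap_eq_zero_of_fixed hν hN hM hlam hu (hsupp 0) hlt hTw, fun w' hw' hz =>
    huniq w' hw' ?_⟩
  have e1 : finPart N M Abar (0 : Fin 2 → ℕ → ℤ → ℂ) = 0 := by
    have := finPart_smul (N := N) (M := M) (Abar := Abar) 0 0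
    simpa using this
  have e2 : tailInv lam N M (0 : Fin 2 → ℕ → ℤ → ℂ) = 0 := by
    ext i n m; simp [tailInv, linInv]
  rw [newtonOp, hz, e1, e2, sub_zero, sub_zero]

end

section

variable {ν : ℝ} {M : ℕ} {a b lam : ℝ}

/-! ### The stable bundle as a solution of a linear differential equation -/

lemma hasDerivAt_evalF {s : ℤ → ℂ} (hs : Summable fun m => ‖s m‖)
    (hs' : Summable fun m : ℤ => ‖Complex.I * m * s m‖) (θ : ℝ) :
    HasDerivAt (evalF s) (evalF (fun m => Complex.I * m * s m) θ) θ := by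
  refine hasDerivAt_tsum (u := fun m : ℤ => ‖Complex.I * m * s m‖) hs'
    (g := fun (m : ℤ) (θ : ℝ) => s m * Complex.exp (Complex.I * m * θ))
    (g' := fun (m : ℤ) (θ : ℝ) => Complex.I * m * s m * Complex.exp (Complex.I * m * θ))
    (fun m y => ?_) (fun m y => by rw [norm_mul, norm_expI, mul_one]) (y₀ := 0) ?_ θ
  · have h1 : HasDerivAt (fun y : ℝ => Complex.I * m * (y : ℂ)) (Complex.I * m) y := by
      simpa using (Complex.ofRealCLM.hasDerivAt (x := y)).const_mul (Complex.I * m)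
    exact (h1.cexp.const_mul (s m)).congr_deriv (by ring)
  · simpa [norm_expI] using hs.of_norm

lemma memF_gamma3 : MemF ν gamma3 := memF_of_finite {2, -2} fun m hm => by
  simp only [Finset.mem_insert, Finset.mem_singleton] at hm
  simp [gamma3, hm]

lemma evalF_gamma3 (θ : ℝ) : evalF gamma3 θ = Real.cos (2 * θ) := by
  rw [evalF, tsum_eq_sum (s := {2, -2}) fun m hm => by
    simp only [Finset.mem_insert, Finset.mem_singleton] at hm
    simp [gamma3, hm], Finset.sum_pair (by norm_num), Complex.ofReal_cos, Complex.cos]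
  simp only [gamma3]
  push_cast
  norm_num
  ring_nf

lemma evalF_gamma4 (θ : ℝ) : evalF gamma4 θ = (-2 * Real.sin (2 * θ) : ℝ) := by
  rw [evalF, tsum_eq_sum (s := {2, -2}) fun m hm => by
    simp only [Finset.mem_insert, Finset.mem_singleton, not_or] at hm
    simp [gamma4, hm], Finset.sum_pair (by norm_num)]
  push_cast
  rw [Complex.sin]
  simp only [gamma4]
  norm_num
  ring_nf

/-- The linear differential equation of the stable bundle. -/
def BundleODE (a b lam : ℝ) (φ : ℝ → ℂ × ℂ) : Prop := ∀ θ, HasDerivAt φ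
  ((φ θ).2 - lam * (φ θ).1, (-a + b * Real.cos (2 * θ) : ℝ) * (φ θ).1 - lam * (φ θ).2) θ

lemma BundleODE.eq_zero {φ : ℝ → ℂ × ℂ} (h : BundleODE a b lam φ) {θ₀ : ℝ} (h0 : φ θ₀ = 0) :
    φ = 0 := by
  -- As `|cos| ≤ 1`, the Lipschitz constant does not depend on `θ`, so uniqueness holds on the whole
  -- line and the solution is compared with zero.
  have hL : ∀ θ : ℝ, LipschitzOnWith (Real.toNNReal (1 + |a| + |b| + |lam|))
      (fun x : ℂ × ℂ => ((x.2 - lam * x.1,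
        (-a + b * Real.cos (2 * θ) : ℝ) * x.1 - lam * x.2) : ℂ × ℂ)) univ := fun θ => by
    refine LipschitzOnWith.of_dist_le_mul fun x _ y _ => ?_
    rw [Real.coe_toNNReal _ (by positivity), dist_eq_norm, dist_eq_norm]
    set d := x - y with hd
    have e : ((x.2 - lam * x.1, (-a + b * Real.cos (2 * θ) : ℝ) * x.1 - lam * x.2) : ℂ × ℂ) -
        (y.2 - lam * y.1, (-a + b * Real.cos (2 * θ) : ℝ) * y.1 - lam * y.2) =
        (d.2 - lam * d.1, (-a + b * Real.cos (2 * θ) : ℝ) * d.1 - lam * d.2) := by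
      ext <;> simp [hd] <;> ring
    rw [e]
    have h1 : ‖d.1‖ ≤ ‖d‖ := norm_fst_le d
    have h2 : ‖d.2‖ ≤ ‖d‖ := norm_snd_le d
    have h3 : 0 ≤ ‖d‖ := norm_nonneg d
    have hcos : |-a + b * Real.cos (2 * θ)| ≤ |a| + |b| := by
      refine (abs_add_le _ _).trans ?_
      rw [abs_neg, abs_mul]
      have := Real.abs_cos_le_one (2 * θ)
      gcongr
      exact mul_le_of_le_one_right (abs_nonneg _) this
    refine norm_prod_le_iff.2 ⟨?_, ?_⟩
    · calc _ ≤ ‖d.2‖ + |lam| * ‖d.1‖ := by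
            refine (norm_sub_le _ _).trans_eq ?_
            rw [norm_mul, Complex.norm_real, Real.norm_eq_abs]
        _ ≤ ‖d‖ + |lam| * ‖d‖ := by gcongr
        _ ≤ _ := by
            have : 0 ≤ (|a| + |b|) * ‖d‖ := by positivity
            linarith
    · calc _ ≤ |-a + b * Real.cos (2 * θ)| * ‖d.1‖ + |lam| * ‖d.2‖ := by
            refine (norm_sub_le _ _).trans_eq ?_
            rw [norm_mul, norm_mul, Complex.norm_real, Complex.norm_real, Real.norm_eq_abs,
              Real.norm_eq_abs]
        _ ≤ (|a| + |b|) * ‖d‖ + |lam| * ‖d‖ := by gcongr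
        _ ≤ _ := by linarith
  refine ODE_solution_unique_univ (t₀ := θ₀) hL (fun t => ⟨h t, mem_univ _⟩)
    (fun t => ⟨?_, mem_univ _⟩) (by simpa using h0)
  exact (hasDerivAt_const t (0 : ℂ × ℂ)).congr_deriv (by simp; rfl)

lemma BundleODE.linear {φ ψ : ℝ → ℂ × ℂ} (h : BundleODE a b lam φ) (h' : BundleODE a b lam ψ)
    (α β : ℂ) : BundleODE a b lam (α • φ + β • ψ) := fun θ => by
  refine (((h θ).const_smul α).add ((h' θ).const_smul β)).congr_deriv (Prod.ext ?_ ?_)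
  · simp; ring
  · simp; ring

lemma BundleODE.fst {φ : ℝ → ℂ × ℂ} (h : BundleODE a b lam φ) (θ : ℝ) :
    HasDerivAt (fun θ => (φ θ).1) ((φ θ).2 - lam * (φ θ).1) θ := (h θ).fst

lemma BundleODE.snd {φ : ℝ → ℂ × ℂ} (h : BundleODE a b lam φ) (θ : ℝ) :
    HasDerivAt (fun θ => (φ θ).2)
      ((-a + b * Real.cos (2 * θ) : ℝ) * (φ θ).1 - lam * (φ θ).2) θ := (h θ).snd

lemma BundleODE.conj {φ : ℝ → ℂ × ℂ} (h : BundleODE a b lam φ) :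
    BundleODE a b lam (fun θ => star (φ θ)) := fun θ => by
  exact (h θ).star.congr_deriv (Prod.ext (by simp) (by simp [-Complex.ofReal_cos]))

/-- The system has trace `-2λ`, so `e^{2λθ}` times the Wronskian is constant. Periodicity then gives
`(e^{4πλ} - 1)` times the Wronskian at `0` equal to zero, and `λ ≠ 0`. -/
lemma BundleODE.wronskian {φ ψ : ℝ → ℂ × ℂ} (hlam : lam < 0) (h : BundleODE a b lam φ)
    (h' : BundleODE a b lam ψ) (hp : φ (2 * π) = φ 0) (hp' : ψ (2 * π) = ψ 0) :
    (φ 0).1 * (ψ 0).2 = (φ 0).2 * (ψ 0).1 := by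
  let E : ℝ → ℂ := fun θ => ((Real.exp (2 * lam * θ) : ℝ) : ℂ) *
    ((φ θ).1 * (ψ θ).2 - (φ θ).2 * (ψ θ).1)
  have hE : ∀ θ, HasDerivAt E 0 θ := fun θ => by
    have he : HasDerivAt (fun θ : ℝ => ((Real.exp (2 * lam * θ) : ℝ) : ℂ))
        ((Real.exp (2 * lam * θ) * (2 * lam) : ℝ) : ℂ) θ := by
      have : HasDerivAt (fun θ : ℝ => 2 * lam * θ) (2 * lam) θ := by
        simpa using (hasDerivAt_id θ).const_mul (2 * lam)
      exact this.exp.ofReal_comp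
    refine (he.mul (((h.fst θ).mul (h'.snd θ)).sub ((h.snd θ).mul (h'.fst θ)))).congr_deriv ?_
    simp only [Pi.mul_apply, Pi.sub_apply]
    push_cast
    ring
  have hconst : E (2 * π) = E 0 :=
    is_const_of_deriv_eq_zero (fun θ => (hE θ).differentiableAt) (fun θ => (hE θ).deriv) _ _
  simp only [E, hp, hp', mul_zero, Real.exp_zero] at hconst
  have hne : ((Real.exp (2 * lam * (2 * π)) : ℝ) : ℂ) ≠ ((1 : ℝ) : ℂ) := by
    rw [Ne, Complex.ofReal_inj]
    refine (Real.exp_lt_one_iff.2 ?_).ne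
    nlinarith [Real.pi_pos]
  have h3 := sub_eq_zero.2 hconst
  rw [← sub_mul] at h3
  exact sub_eq_zero.1 ((mul_eq_zero.1 h3).resolve_left (sub_ne_zero.2 hne))

/-- The pair of functions with Fourier coefficients `v`. -/
noncomputable def bundleFun (v : Fin 2 → ℤ → ℂ) (θ : ℝ) : ℂ × ℂ := (evalF (v 0) θ, evalF (v 1) θ)

lemma bundle_eqs {l : ℝ} {v : Fin 2 → ℤ → ℂ} (hb : bundleMap a b l M (lam : ℂ) v = 0) :
    (∑ m ∈ Finset.Icc (-(M : ℤ)) M, v 0 m = l) ∧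
    ∀ i m, (Complex.I * m + lam) * v i m = bundleRhs a b v i m := by
  rw [bundleMap, Prod.mk_eq_zero] at hb
  refine ⟨sub_eq_zero.1 hb.1, fun i m => sub_eq_zero.1 ?_⟩
  exact congrFun (congrFun hb.2 i) m

lemma MemF.smul (z : ℂ) {s : ℤ → ℂ} (hs : MemF ν s) : MemF ν (z • s) := by
  refine (Summable.mul_left ‖z‖ hs).congr fun m => ?_
  simp [mul_assoc]

lemma MemF.add (hν : 1 ≤ ν) {s t : ℤ → ℂ} (hs : MemF ν s) (ht : MemF ν t) : MemF ν (s + t) := by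
  refine Summable.of_nonneg_of_le (fun m => by positivity) (fun m => ?_) (Summable.add hs ht)
  rw [← add_mul]
  gcongr
  exact norm_add_le _ _

/-- The bundle equations express `im v_m` through sequences of `S_F`, so termwise differentiation
needs no decay beyond `v ∈ S_F`. -/
lemma bundleODE_bundleFun (hν : 1 ≤ ν) {l : ℝ} {v : Fin 2 → ℤ → ℂ} (hv : ∀ i, MemF ν (v i))
    (hb : bundleMap a b l M (lam : ℂ) v = 0) : BundleODE a b lam (bundleFun v) := by
  obtain ⟨-, hb⟩ := bundle_eqs hb
  have hconv := (convF_bdd memF_gamma3 (hv 0) hν).1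
  have e0 : (fun m : ℤ => Complex.I * m * v 0 m) = v 1 + (-lam : ℂ) • v 0 := by
    ext m
    have : (Complex.I * m + lam) * v 0 m = v 1 m := hb 0 m
    simp only [Pi.add_apply, Pi.smul_apply, smul_eq_mul]
    linear_combination this
  have e1 : (fun m : ℤ => Complex.I * m * v 1 m) =
      ((-a : ℂ) • v 0 + (b : ℂ) • convF gamma3 (v 0)) + (-lam : ℂ) • v 1 := by
    ext m
    have : (Complex.I * m + lam) * v 1 m = -(a : ℂ) * v 0 m + (b : ℂ) * convF gamma3 (v 0) m :=
      hb 1 m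
    simp only [Pi.add_apply, Pi.smul_apply, smul_eq_mul]
    linear_combination this
  have m0 := (hv 1).add hν ((hv 0).smul (-lam : ℂ))
  have m1' := ((hv 0).smul (-a : ℂ)).add hν (hconv.smul (b : ℂ))
  have m1 := m1'.add hν ((hv 1).smul (-lam : ℂ))
  intro θ
  have d0 := hasDerivAt_evalF ((hv 0).summable_norm hν)
    (by simpa only [← e0] using m0.summable_norm hν) θ
  have d1 := hasDerivAt_evalF ((hv 1).summable_norm hν)
    (by simpa only [← e1] using m1.summable_norm hν) θ
  rw [e0, evalF_add hν (hv 1) ((hv 0).smul _), evalF_smul] at d0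
  rw [e1, evalF_add hν m1' ((hv 1).smul _), evalF_smul, evalF_add hν ((hv 0).smul _)
    (hconv.smul _), evalF_smul, evalF_smul, evalF_conv hν memF_gamma3 (hv 0),
    evalF_gamma3] at d1
  refine (d0.prodMk d1).congr_deriv (Prod.ext ?_ ?_)
  · simp only [bundleFun]; ring
  · simp only [bundleFun]; push_cast; ring

/-! ### Conjugation, and reality of the bundle -/

lemma evalF_periodic (s : ℤ → ℂ) (θ : ℝ) : evalF s (θ + 2 * π) = evalF s θ := by
  refine tsum_congr fun m => ?_
  congr 1
  rw [Complex.exp_eq_exp_iff_exists_int]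
  exact ⟨m, by push_cast; ring⟩

/-- The coefficients of the complex conjugate function. -/
noncomputable def reflect (s : ℤ → ℂ) (m : ℤ) : ℂ := (starRingEnd ℂ) (s (-m))

lemma MemF.reflect {s : ℤ → ℂ} (hs : MemF ν s) : MemF ν (reflect s) := by
  have := (Equiv.neg ℤ).summable_iff.2 hs
  refine this.congr fun m => ?_
  simp [GrossPitaevskii.reflect]

lemma evalF_reflect (s : ℤ → ℂ) (θ : ℝ) :
    evalF (reflect s) θ = (starRingEnd ℂ) (evalF s θ) := by
  unfold evalF
  rw [Complex.conj_tsum, ← (Equiv.neg ℤ).tsum_eq]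
  refine tsum_congr fun m => ?_
  simp only [reflect, Equiv.neg_apply, neg_neg, map_mul, ← Complex.exp_conj, Complex.conj_I,
    Complex.conj_ofReal, map_intCast]
  push_cast
  ring_nf

/-- The stable bundle does not vanish. -/
lemma bundleFun_ne_zero (hν : 1 ≤ ν) {l : ℝ} (hl : l ≠ 0) {v : Fin 2 → ℤ → ℂ}
    (hv : ∀ i, MemF ν (v i)) (hb : bundleMap a b l M (lam : ℂ) v = 0) (θ : ℝ) :
    bundleFun v θ ≠ 0 := fun h => by
  -- One zero makes the whole solution vanish, hence all coefficients, against the phase condition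
  -- with `l ≠ 0`.
  have hz := (bundleODE_bundleFun hν hv hb).eq_zero h
  have h0 : v 0 = 0 := evalF_injective hν (hv 0) (t := 0) (memF_of_finite ∅ fun _ _ => rfl) fun θ => by
    have := congrArg Prod.fst (congrFun hz θ)
    simpa [bundleFun, evalF] using this
  have := (bundle_eqs hb).1
  simp only [h0, Pi.zero_apply, Finset.sum_const_zero] at this
  exact hl (by exact_mod_cast this.symm)

/-- The stable bundle is real. -/
lemma reflect_bundle (hν : 1 ≤ ν) {l : ℝ} (hl : l ≠ 0) (hlam : lam < 0) {v : Fin 2 → ℤ → ℂ}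
    (hv : ∀ i, MemF ν (v i)) (hb : bundleMap a b l M (lam : ℂ) v = 0) (i : Fin 2) :
    reflect (v i) = v i := by
  have hφ := bundleODE_bundleFun hν hv hb
  have hper : bundleFun v (2 * π) = bundleFun v 0 := by
    have h0 := evalF_periodic (v 0) 0
    have h1 := evalF_periodic (v 1) 0
    rw [zero_add] at h0 h1
    simp [bundleFun, h0, h1]
  have hW := BundleODE.wronskian hlam hφ hφ.conj hper (by rw [hper])
  -- The vanishing Wronskian says that the value at `0` and its conjugate are dependent; a nonzero
  -- coordinate of that value supplies the coefficients.
  obtain ⟨α, β, hα, hαβ⟩ : ∃ α β : ℂ, α ≠ 0 ∧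
      α • bundleFun v 0 + β • star (bundleFun v 0) = 0 := by
    set x := bundleFun v 0
    simp only [Prod.fst_star, Prod.snd_star] at hW
    by_cases h0 : x.1 = 0
    · have h1 : x.2 ≠ 0 := fun h1 => bundleFun_ne_zero hν hl hv hb 0 (Prod.ext h0 h1)
      refine ⟨star x.2, -x.2, star_ne_zero.2 h1, Prod.ext ?_ ?_⟩
      · simp [h0]
      · simp; ring
    · refine ⟨star x.1, -x.1, star_ne_zero.2 h0, Prod.ext ?_ ?_⟩
      · simp; ring
      · simp at hW ⊢; linear_combination -hW
  have hz := (hφ.linear hφ.conj α β).eq_zero (θ₀ := 0) (by simpa using hαβ)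
  have hev : ∀ i θ, α * evalF (v i) θ + β * (starRingEnd ℂ) (evalF (v i) θ) = 0 := fun i θ => by
    have := congrFun hz θ
    have h0 := congrArg Prod.fst this
    have h1 := congrArg Prod.snd this
    fin_cases i
    · simpa [bundleFun] using h0
    · simpa [bundleFun] using h1
  have hco : ∀ i, α • v i + β • reflect (v i) = 0 := fun i => by
    refine evalF_injective hν (((hv i).smul α).add hν ((hv i).reflect.smul β))
      (memF_of_finite ∅ fun _ _ => rfl) fun θ => ?_
    rw [evalF_add hν ((hv i).smul α) ((hv i).reflect.smul β), evalF_smul, evalF_smul,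
      evalF_reflect, hev]
    simp [evalF]
  have hsum := (bundle_eqs hb).1
  have hsum' : ∑ m ∈ Finset.Icc (-(M : ℤ)) M, reflect (v 0) m = l := by
    have : ∑ m ∈ Finset.Icc (-(M : ℤ)) M, reflect (v 0) m =
        ∑ m ∈ Finset.Icc (-(M : ℤ)) M, (starRingEnd ℂ) (v 0 m) :=
      Finset.sum_equiv (Equiv.neg ℤ) (fun m => by simp only [Finset.mem_Icc, Equiv.neg_apply]; omega)
        fun m _ => rfl
    rw [this, ← map_sum, hsum, Complex.conj_ofReal]
  have hl' : (l : ℂ) ≠ 0 := by exact_mod_cast hl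
  -- Summing the relation over `|m| ≤ M` gives `(α + β) l = 0`, because the phase sum is the real
  -- number `l` for both sequences.
  have hβ : β = -α := by
    have : ∑ m ∈ Finset.Icc (-(M : ℤ)) M, (α * v 0 m + β * reflect (v 0) m) = 0 :=
      Finset.sum_eq_zero fun m _ => by simpa using congrFun (hco 0) m
    rw [Finset.sum_add_distrib, ← Finset.mul_sum, ← Finset.mul_sum, hsum, hsum', ← add_mul] at this
    linear_combination (mul_eq_zero.1 this).resolve_right hl'
  ext m
  have := congrFun (hco i) m
  simp only [Pi.add_apply, Pi.smul_apply, smul_eq_mul, Pi.zero_apply, hβ] at this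
  have h2 : α * (v i m - reflect (v i) m) = 0 := by linear_combination this
  exact (sub_eq_zero.1 ((mul_eq_zero.1 h2).resolve_left hα)).symm

end

section

variable {ν : ℝ} {M : ℕ} {a b c lam : ℝ}

/-! ### Taylor–Fourier series as functions -/

lemma abs_le_one_of_mem {σ : ℝ} (hσ : σ ∈ Icc (-1 : ℝ) 1) : |σ| ≤ 1 := abs_le.2 hσ

lemma MemTF.eval_bound (hν : 1 ≤ ν) {p : ℕ → ℤ → ℂ} (hp : MemTF ν p) (θ : ℝ) {σ : ℝ}
    (hσ : σ ∈ Icc (-1 : ℝ) 1) (n : ℕ) : ‖evalF (p n) θ * (σ : ℂ) ^ n‖ ≤ normF ν (p n) := by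
  rw [norm_mul, norm_pow, Complex.norm_real, Real.norm_eq_abs]
  calc _ ≤ normF ν (p n) * 1 :=
        mul_le_mul ((hp.1 n).norm_eval_le hν θ) (pow_le_one₀ (abs_nonneg _) (abs_le_one_of_mem hσ))
          (by positivity) (normF_nonneg hν _)
    _ = _ := mul_one _

lemma MemTF.eval_summable (hν : 1 ≤ ν) {p : ℕ → ℤ → ℂ} (hp : MemTF ν p) (θ : ℝ) {σ : ℝ}
    (hσ : σ ∈ Icc (-1 : ℝ) 1) : Summable fun n => ‖evalF (p n) θ * (σ : ℂ) ^ n‖ :=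
  Summable.of_nonneg_of_le (fun _ => norm_nonneg _) (hp.eval_bound hν θ hσ) hp.2

lemma MemTF.norm_eval_le (hν : 1 ≤ ν) {p : ℕ → ℤ → ℂ} (hp : MemTF ν p) (θ : ℝ) {σ : ℝ}
    (hσ : σ ∈ Icc (-1 : ℝ) 1) : ‖evalTF p θ σ‖ ≤ normTF ν p :=
  (norm_tsum_le_tsum_norm (hp.eval_summable hν θ hσ)).trans
    ((hp.eval_summable hν θ hσ).tsum_le_tsum (hp.eval_bound hν θ hσ) hp.2)

lemma evalTF_add (hν : 1 ≤ ν) {p q : ℕ → ℤ → ℂ} (hp : MemTF ν p) (hq : MemTF ν q) (θ : ℝ) {σ : ℝ}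
    (hσ : σ ∈ Icc (-1 : ℝ) 1) : evalTF (p + q) θ σ = evalTF p θ σ + evalTF q θ σ := by
  unfold evalTF
  rw [← (hp.eval_summable hν θ hσ).of_norm.tsum_add (hq.eval_summable hν θ hσ).of_norm]
  refine tsum_congr fun n => ?_
  rw [Pi.add_apply, evalF_add hν (hp.1 n) (hq.1 n), add_mul]

lemma evalTF_smul (z : ℂ) (p : ℕ → ℤ → ℂ) (θ σ : ℝ) : evalTF (z • p) θ σ = z * evalTF p θ σ := by
  unfold evalTF
  rw [← tsum_mul_left]
  refine tsum_congr fun n => ?_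
  rw [Pi.smul_apply, evalF_smul, mul_assoc]

lemma evalTF_conv (hν : 1 ≤ ν) {p q : ℕ → ℤ → ℂ} (hp : MemTF ν p) (hq : MemTF ν q) (θ : ℝ) {σ : ℝ}
    (hσ : σ ∈ Icc (-1 : ℝ) 1) : evalTF (convTF p q) θ σ = evalTF p θ σ * evalTF q θ σ := by
  unfold evalTF
  rw [tsum_mul_tsum_eq_tsum_sum_range_of_summable_norm (hp.eval_summable hν θ hσ)
    (hq.eval_summable hν θ hσ)]
  refine tsum_congr fun n => ?_
  rw [evalF_convTF hν hp hq, Finset.sum_mul]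
  refine Finset.sum_congr rfl fun l hl => ?_
  have : n = l + (n - l) := by rw [Finset.mem_range] at hl; omega
  calc _ = evalF (p l) θ * evalF (q (n - l)) θ * (σ : ℂ) ^ (l + (n - l)) := by rw [← this]
    _ = _ := by rw [pow_add]; ring

lemma evalTF_constTF (s : ℤ → ℂ) (θ σ : ℝ) : evalTF (constTF s) θ σ = evalF s θ := by
  unfold evalTF
  rw [tsum_eq_single 0 fun n hn => by simp [constTF, evalF, hn]]
  simp [constTF, evalF]

lemma evalTF_reflect (p : ℕ → ℤ → ℂ) (θ σ : ℝ) :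
    evalTF (fun n => reflect (p n)) θ σ = (starRingEnd ℂ) (evalTF p θ σ) := by
  unfold evalTF
  rw [Complex.conj_tsum]
  exact tsum_congr fun n => by rw [evalF_reflect]; simp

/-! ### Differentiability of the double series up to `σ = ±1` -/

/-- The summand of the double series. -/
noncomputable def termTF (p : ℕ → ℤ → ℂ) (x : ℕ × ℤ) (q : ℝ × ℝ) : ℂ :=
  p x.1 x.2 * Complex.exp (Complex.I * x.2 * q.1) * (q.2 : ℂ) ^ x.1

lemma norm_termTF_le (p : ℕ → ℤ → ℂ) (x : ℕ × ℤ) {q : ℝ × ℝ} (hq : q.2 ∈ Icc (-1 : ℝ) 1) :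
    ‖termTF p x q‖ ≤ ‖p x.1 x.2‖ := by
  rw [termTF, norm_mul, norm_mul, norm_expI, mul_one, norm_pow, Complex.norm_real,
    Real.norm_eq_abs]
  exact mul_le_of_le_one_right (norm_nonneg _)
    (pow_le_one₀ (abs_nonneg _) (abs_le_one_of_mem hq))

lemma evalTF_eq_tsum {p : ℕ → ℤ → ℂ} (hp : Summable fun x : ℕ × ℤ => ‖p x.1 x.2‖) {q : ℝ × ℝ}
    (hq : q.2 ∈ Icc (-1 : ℝ) 1) : evalTF p q.1 q.2 = ∑' x, termTF p x q := by
  have : Summable fun x => termTF p x q :=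
    (Summable.of_nonneg_of_le (fun _ => norm_nonneg _) (fun x => norm_termTF_le p x hq) hp).of_norm
  rw [this.tsum_prod]
  simp only [evalTF, evalF, termTF, tsum_mul_right]

/-- The `σ`-derivative of the double series. -/
noncomputable def derivTF (p : ℕ → ℤ → ℂ) (n : ℕ) (m : ℤ) : ℂ := (n + 1 : ℕ) * p (n + 1) m

/-- The `θ`-derivative of the double series. -/
noncomputable def angTF (p : ℕ → ℤ → ℂ) (n : ℕ) (m : ℤ) : ℂ := Complex.I * m * p n m

/-- The total derivative with partial derivatives `x` and `y`. -/
noncomputable def partials {E : Type*} [NormedAddCommGroup E] [NormedSpace ℝ E] (x y : E) :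
    ℝ × ℝ →L[ℝ] E :=
  (ContinuousLinearMap.fst ℝ ℝ ℝ).smulRight x + (ContinuousLinearMap.snd ℝ ℝ ℝ).smulRight y

lemma norm_partials_le {E : Type*} [NormedAddCommGroup E] [NormedSpace ℝ E] (x y : E) :
    ‖partials x y‖ ≤ ‖x‖ + ‖y‖ := by
  refine (norm_add_le _ _).trans ?_
  rw [ContinuousLinearMap.norm_smulRight_apply, ContinuousLinearMap.norm_smulRight_apply]
  gcongr
  · exact mul_le_of_le_one_left (norm_nonneg _) (ContinuousLinearMap.norm_fst_le ..)
  · exact mul_le_of_le_one_left (norm_nonneg _) (ContinuousLinearMap.norm_snd_le ..)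

lemma continuous_partials {X E : Type*} [TopologicalSpace X] [NormedAddCommGroup E]
    [NormedSpace ℝ E] {s : Set X} {f g : X → E} (hf : ContinuousOn f s) (hg : ContinuousOn g s) :
    ContinuousOn (fun x => partials (f x) (g x)) s := by
  unfold partials
  have h1 : Continuous fun x : E => (ContinuousLinearMap.fst ℝ ℝ ℝ).smulRight x :=
    (ContinuousLinearMap.smulRightL ℝ (ℝ × ℝ) E (ContinuousLinearMap.fst ℝ ℝ ℝ)).continuous
  have h2 : Continuous fun x : E => (ContinuousLinearMap.snd ℝ ℝ ℝ).smulRight x :=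
    (ContinuousLinearMap.smulRightL ℝ (ℝ × ℝ) E (ContinuousLinearMap.snd ℝ ℝ ℝ)).continuous
  exact (h1.comp_continuousOn hf).add (h2.comp_continuousOn hg)

lemma hasFDerivAt_termTF (p : ℕ → ℤ → ℂ) (x : ℕ × ℤ) (q : ℝ × ℝ) :
    HasFDerivAt (termTF p x) (partials
      (Complex.I * x.2 * p x.1 x.2 * Complex.exp (Complex.I * x.2 * q.1) * (q.2 : ℂ) ^ x.1)
      (p x.1 x.2 * Complex.exp (Complex.I * x.2 * q.1) * (x.1 * (q.2 : ℂ) ^ (x.1 - 1)))) q := by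
  have h1 : HasDerivAt (fun y : ℝ => p x.1 x.2 * Complex.exp (Complex.I * x.2 * (y : ℂ)))
      (p x.1 x.2 * (Complex.exp (Complex.I * x.2 * q.1) * (Complex.I * x.2))) q.1 := by
    have : HasDerivAt (fun y : ℝ => Complex.I * x.2 * (y : ℂ)) (Complex.I * x.2) q.1 := by
      simpa using (Complex.ofRealCLM.hasDerivAt (x := q.1)).const_mul (Complex.I * x.2)
    exact this.cexp.const_mul _
  have h2 : HasDerivAt (fun y : ℝ => (y : ℂ) ^ x.1) (x.1 * (q.2 : ℂ) ^ (x.1 - 1)) q.2 := by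
    exact ((Complex.ofRealCLM.hasDerivAt (x := q.2)).pow x.1).congr_deriv (by simp)
  have h3 := (h1.hasFDerivAt.comp q (hasFDerivAt_fst (𝕜 := ℝ) (p := q))).mul
    (h2.hasFDerivAt.comp q (hasFDerivAt_snd (𝕜 := ℝ) (p := q)))
  refine h3.congr_fderiv ?_
  ext <;> (simp [partials]; try ring)

/-- The strip on which the parameterization is defined. -/
def strip : Set (ℝ × ℝ) := univ ×ˢ Icc (-1 : ℝ) 1

lemma strip_eq_closure : strip = closure ((univ : Set ℝ) ×ˢ Ioo (-1 : ℝ) 1) := by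
  rw [closure_prod_eq, closure_univ, closure_Ioo (by norm_num), strip]

lemma uniqueDiffOn_strip : UniqueDiffOn ℝ strip :=
  uniqueDiffOn_univ.prod (uniqueDiffOn_Icc (by norm_num))

/-- Summability of the series together with its first derivatives. -/
structure SmoothTF (p : ℕ → ℤ → ℂ) : Prop where
  base : Summable fun x : ℕ × ℤ => ‖p x.1 x.2‖
  ang : Summable fun x : ℕ × ℤ => ‖angTF p x.1 x.2‖
  tay : Summable fun x : ℕ × ℤ => (x.1 : ℝ) * ‖p x.1 x.2‖

lemma SmoothTF.deriv {p : ℕ → ℤ → ℂ} (hp : SmoothTF p) :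
    Summable fun x : ℕ × ℤ => ‖derivTF p x.1 x.2‖ := by
  have hinj : Function.Injective fun x : ℕ × ℤ => (x.1 + 1, x.2) := fun x y h => by
    simp only [Prod.mk.injEq, add_left_inj] at h; exact Prod.ext h.1 h.2
  refine (hp.tay.comp_injective hinj).congr fun x => ?_
  simp only [derivTF, Function.comp, norm_mul, Complex.norm_natCast]

lemma continuousOn_evalTF {p : ℕ → ℤ → ℂ} (hp : Summable fun x : ℕ × ℤ => ‖p x.1 x.2‖) :
    ContinuousOn (fun q : ℝ × ℝ => evalTF p q.1 q.2) strip := by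
  have : ContinuousOn (fun q : ℝ × ℝ => ∑' x, termTF p x q) strip :=
    continuousOn_tsum (fun x => by unfold termTF; fun_prop) hp
      fun x q hq => norm_termTF_le p x hq.2
  exact this.congr fun q hq => evalTF_eq_tsum hp hq.2

/-- The shift `n ↦ n + 1` misses only `n = 0`, where the factor `n` vanishes and the truncated
exponent `n - 1` is irrelevant. -/
lemma tsum_shift {p : ℕ → ℤ → ℂ} (hp : SmoothTF p) {q : ℝ × ℝ} (hq : q.2 ∈ Icc (-1 : ℝ) 1) :
    HasSum (fun x : ℕ × ℤ =>
      p x.1 x.2 * Complex.exp (Complex.I * x.2 * q.1) * (x.1 * (q.2 : ℂ) ^ (x.1 - 1)))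
      (evalTF (derivTF p) q.1 q.2) := by
  have hinj : Function.Injective fun x : ℕ × ℤ => (x.1 + 1, x.2) := fun x y h => by
    simp only [Prod.mk.injEq, add_left_inj] at h; exact Prod.ext h.1 h.2
  rw [evalTF_eq_tsum hp.deriv hq]
  rw [← hinj.hasSum_iff]
  · have : Summable fun x => termTF (derivTF p) x q :=
      (Summable.of_nonneg_of_le (fun _ => norm_nonneg _)
        (fun x => norm_termTF_le _ x hq) hp.deriv).of_norm
    convert this.hasSum using 1
    ext x
    simp [termTF, derivTF]; ring
  · rintro ⟨n, m⟩ h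
    rcases n with _ | n
    · simp
    · exact absurd ⟨(n, m), rfl⟩ h

lemma SmoothTF.hasFDerivWithinAt {p : ℕ → ℤ → ℂ} (hp : SmoothTF p) {q : ℝ × ℝ} (hq : q ∈ strip) :
    HasFDerivWithinAt (fun q : ℝ × ℝ => evalTF p q.1 q.2)
      (partials (evalTF (angTF p) q.1 q.2) (evalTF (derivTF p) q.1 q.2)) strip q := by
  set U : Set (ℝ × ℝ) := univ ×ˢ Ioo (-1 : ℝ) 1 with hU
  have hUopen : IsOpen U := isOpen_univ.prod isOpen_Ioo
  have hUconv : Convex ℝ U := convex_univ.prod (convex_Ioo _ _)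
  have hsub : U ⊆ strip := prod_mono le_rfl Ioo_subset_Icc_self
  -- In the open strip the terms are differentiated one by one, with the summable majorant provided
  -- by `SmoothTF`.
  have hin : ∀ q ∈ U, HasFDerivAt (fun q : ℝ × ℝ => evalTF p q.1 q.2)
      (partials (evalTF (angTF p) q.1 q.2) (evalTF (derivTF p) q.1 q.2)) q := fun q hq => by
    have hbound : ∀ (x : ℕ × ℤ), ∀ y ∈ U, ‖partials
      (Complex.I * x.2 * p x.1 x.2 * Complex.exp (Complex.I * x.2 * y.1) * (y.2 : ℂ) ^ x.1)
      (p x.1 x.2 * Complex.exp (Complex.I * x.2 * y.1) * (x.1 * (y.2 : ℂ) ^ (x.1 - 1)))‖ ≤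
        ‖angTF p x.1 x.2‖ + x.1 * ‖p x.1 x.2‖ := fun x y hy => by
      have hy1 := abs_le_one_of_mem (hsub hy).2
      refine (norm_partials_le _ _).trans (add_le_add ?_ ?_)
      · exact norm_termTF_le (angTF p) x (hsub hy).2
      · rw [norm_mul, norm_mul, norm_expI, mul_one, norm_mul, norm_pow, Complex.norm_real,
          Real.norm_eq_abs, Complex.norm_natCast, mul_comm]
        refine mul_le_mul_of_nonneg_right ?_ (norm_nonneg _)
        exact mul_le_of_le_one_right (by positivity) (pow_le_one₀ (abs_nonneg _) hy1)
    have hsum := hp.ang.add hp.tay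
    have h0 : Summable fun x => termTF p x q :=
      (Summable.of_nonneg_of_le (fun _ => norm_nonneg _)
        (fun x => norm_termTF_le p x (hsub hq).2) hp.base).of_norm
    have := hasFDerivAt_tsum_of_isPreconnected hsum hUopen hUconv.isPreconnected
      (fun x y _ => hasFDerivAt_termTF p x y) hbound hq h0 hq
    have hs1 : HasSum (fun x : ℕ × ℤ =>
        Complex.I * x.2 * p x.1 x.2 * Complex.exp (Complex.I * x.2 * q.1) * (q.2 : ℂ) ^ x.1)
        (evalTF (angTF p) q.1 q.2) := by
      rw [evalTF_eq_tsum hp.ang (hsub hq).2]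
      exact ((Summable.of_nonneg_of_le (fun _ => norm_nonneg _)
        (fun x => norm_termTF_le (angTF p) x (hsub hq).2) hp.ang).of_norm).hasSum
    have hs2 := tsum_shift hp (hsub hq).2
    have hs : HasSum _ (partials (evalTF (angTF p) q.1 q.2) (evalTF (derivTF p) q.1 q.2)) :=
      (hs1.mapL (ContinuousLinearMap.smulRightL ℝ (ℝ × ℝ) ℂ (ContinuousLinearMap.fst ℝ ℝ ℝ))).add
      (hs2.mapL (ContinuousLinearMap.smulRightL ℝ (ℝ × ℝ) ℂ (ContinuousLinearMap.snd ℝ ℝ ℝ)))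
    have heq : (∑' x : ℕ × ℤ, partials
      (Complex.I * x.2 * p x.1 x.2 * Complex.exp (Complex.I * x.2 * q.1) * (q.2 : ℂ) ^ x.1)
      (p x.1 x.2 * Complex.exp (Complex.I * x.2 * q.1) * (x.1 * (q.2 : ℂ) ^ (x.1 - 1)))) =
      partials (evalTF (angTF p) q.1 q.2) (evalTF (derivTF p) q.1 q.2) := hs.tsum_eq
    rw [heq] at this
    refine this.congr_of_eventuallyEq ?_
    filter_upwards [hUopen.mem_nhds hq] with y hy
    exact evalTF_eq_tsum hp.base (hsub hy).2
  have hcont := continuous_partials (continuousOn_evalTF hp.ang) (continuousOn_evalTF hp.deriv)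
  rw [strip_eq_closure]
  -- The boundary is reached because the derivative series converges uniformly on the closed strip,
  -- so the interior derivative has a continuous extension there.
  refine hasFDerivWithinAt_closure_of_tendsto_fderiv
    (fun y hy => (hin y hy).differentiableAt.differentiableWithinAt) hUconv hUopen
    (fun y hy => (continuousOn_evalTF hp.base y (by rwa [strip_eq_closure])).mono hsub) ?_
  refine ((hcont q hq).mono_left (nhdsWithin_mono _ hsub)).congr' ?_
  filter_upwards [self_mem_nhdsWithin] with y hy
  exact (hin y hy).fderiv.symm

lemma SmoothTF.contDiffOn {p : ℕ → ℤ → ℂ} (hp : SmoothTF p) :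
    ContDiffOn ℝ 1 (fun q : ℝ × ℝ => evalTF p q.1 q.2) strip := by
  rw [show (1 : WithTop ℕ∞) = 0 + 1 from (zero_add 1).symm,
    contDiffOn_succ_iff_fderivWithin uniqueDiffOn_strip, contDiffOn_zero]
  refine ⟨fun q hq => (hp.hasFDerivWithinAt hq).differentiableWithinAt, by simp, ?_⟩
  refine (continuous_partials (continuousOn_evalTF hp.ang) (continuousOn_evalTF hp.deriv)).congr
    fun q hq => ?_
  exact (hp.hasFDerivWithinAt hq).fderivWithin (uniqueDiffOn_strip q hq)

end

section

variable {ν : ℝ} {M : ℕ} {a b c lam l : ℝ} {v : Fin 2 → ℤ → ℂ} {w : Fin 2 → ℕ → ℤ → ℂ}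

/-! ### Regularity and invariance -/

lemma convF_zero_left (t : ℤ → ℂ) : convF 0 t = 0 := by ext m; simp [convF]

lemma convF_zero_right (s : ℤ → ℂ) : convF s 0 = 0 := by ext m; simp [convF]

lemma tfMap_zero_spec (hz : tfMap a b c lam v w = 0) :
    (∀ i, w i 0 = 0) ∧ (∀ i, w i 1 = v i) := by
  have h : ∀ i n m, tfMap a b c lam v w i n m = 0 := fun i n m => by rw [hz]; rfl
  refine ⟨fun i => funext fun m => ?_, fun i => funext fun m => ?_⟩
  · simpa [tfMap] using h i 0 m
  · simpa [tfMap, sub_eq_zero] using h i 1 m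

/-- The invariance equation in coefficients, at all Taylor orders. -/
lemma symbol_mul_eq_rhs (hb : bundleMap a b l M (lam : ℂ) v = 0) (hz : tfMap a b c lam v w = 0)
    (i : Fin 2) (n : ℕ) (m : ℤ) :
    (Complex.I * m + n * (lam : ℂ)) * w i n m = rhs a b c w i n m := by
  obtain ⟨h0, h1⟩ := tfMap_zero_spec hz
  have hconst : constTF gamma3 0 = gamma3 ∧ constTF gamma3 1 = 0 :=
    ⟨by ext; simp [constTF], by ext; simp [constTF]⟩
  rcases Nat.lt_or_ge n 2 with hn | hn
  · have hww : convTF (w 0) (w 0) 0 = 0 := by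
      ext m; simp [convTF, h0, convF_zero_left]
    interval_cases n
    · have hR : rhs a b c w i 0 m = 0 := by
        revert i
        rw [Fin.forall_fin_two, rhs_zero, rhs_one]
        refine ⟨by simp [h0], ?_⟩
        simp [convTF, h0, convF_zero_right]
      rw [hR, h0]; simp
    · have hR : rhs a b c w i 1 m = bundleRhs a b v i m := by
        revert i
        rw [Fin.forall_fin_two, rhs_zero, rhs_one]
        refine ⟨by simp [h1, bundleRhs], ?_⟩
        -- Since `w` starts at order one, the cubic term starts at order three; at order one only
        -- the bundle equation is left.
        have hc : convTF (convTF (w 0) (w 0)) (w 0) 1 m = 0 := by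
          rw [convTF]
          simp [Finset.sum_range_succ, hww, h0, convF_zero_left, convF_zero_right]
        have hg : convTF (constTF gamma3) (w 0) 1 m = convF gamma3 (v 0) m := by
          rw [convTF]
          simp [Finset.sum_range_succ, hconst.1, hconst.2, h0, h1, convF_zero_left]
        simp [hc, hg, h1, bundleRhs]
      rw [hR, h1, ← (bundle_eqs hb).2 i m]; simp
  · have := congrFun (congrFun (congrFun hz i) n) m
    simp only [tfMap, if_neg (show n ≠ 0 by omega), if_neg (show n ≠ 1 by omega)] at this
    exact sub_eq_zero.1 this

lemma memX_rhs (hν : 1 ≤ ν) (hw : MemX ν w) : MemX ν (rhs a b c w) := by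
  intro i
  revert i
  rw [Fin.forall_fin_two, rhs_zero, rhs_one]
  have h0 := (hw 0).bdd
  exact ⟨hw 1, (((h0.smul hν _).add hν (((bddTF_gamma3 hν).conv hν h0).smul hν _)).add hν
    (((h0.conv hν h0).conv hν h0).smul hν _)).1⟩

lemma MemTF.summable_norm (hν : 1 ≤ ν) {p : ℕ → ℤ → ℂ} (hp : MemTF ν p) :
    Summable fun x : ℕ × ℤ => ‖p x.1 x.2‖ :=
  Summable.of_nonneg_of_le (fun _ => norm_nonneg _)
    (fun _ => le_mul_of_one_le_right (norm_nonneg _) (one_le_pow₀ hν)) ((memTF_iff hν p).1 hp)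

/-- One derivative is gained from the equation: the imaginary part of `im + nλ` is `m` and the real
part is `nλ`, so `|m| ‖w‖` and `n|λ| ‖w‖` are both bounded by `‖f(w)‖`, which is summable. This
works even for `ν = 1` and at `|σ| = 1`. -/
lemma smoothTF_of_zero (hν : 1 ≤ ν) (hlam : lam < 0) (hb : bundleMap a b l M (lam : ℂ) v = 0)
    (hw : MemX ν w) (hz : tfMap a b c lam v w = 0) (i : Fin 2) : SmoothTF (w i) := by
  have hr := (memX_rhs (a := a) (b := b) (c := c) hν hw i).summable_norm hν
  have heq := fun n m => (congrArg norm (symbol_mul_eq_rhs hb hz i n m)).symm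
  refine ⟨(hw i).summable_norm hν, ?_, ?_⟩
  · refine Summable.of_nonneg_of_le (fun _ => norm_nonneg _) (fun x => ?_) hr
    rw [heq, norm_mul, angTF, norm_mul]
    gcongr
    have h1 := Complex.abs_im_le_norm (Complex.I * x.2 + x.1 * (lam : ℂ))
    simpa using h1
  · refine Summable.of_nonneg_of_le (fun _ => by positivity) (fun x => ?_) (hr.mul_left |lam|⁻¹)
    have hl : 0 < |lam| := abs_pos.2 hlam.ne
    rw [heq, norm_mul, ← mul_assoc]
    gcongr
    have h1 := Complex.abs_re_le_norm (Complex.I * x.2 + x.1 * (lam : ℂ))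
    rw [le_inv_mul_iff₀ hl, mul_comm]
    simpa [abs_mul] using h1

lemma evalTF_rhs_one (hν : 1 ≤ ν) (hw : MemX ν w) (θ : ℝ) {σ : ℝ} (hσ : σ ∈ Icc (-1 : ℝ) 1) :
    evalTF (rhs a b c w 1) θ σ = -a * evalTF (w 0) θ σ + b * Real.cos (2 * θ) * evalTF (w 0) θ σ
      + c * evalTF (w 0) θ σ ^ 3 := by
  have h0 := (hw 0).bdd
  have h1 := h0.smul hν (-a : ℂ)
  have h2 := (bddTF_gamma3 hν).conv hν h0
  have h2' := h2.smul hν (b : ℂ)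
  have h3 := h0.conv hν h0
  have h4 := h3.conv hν h0
  rw [rhs_one, evalTF_add hν (h1.add hν h2').1 (h4.smul hν (c : ℂ)).1 θ hσ,
    evalTF_add hν h1.1 h2'.1 θ hσ, evalTF_smul, evalTF_smul, evalTF_smul,
    evalTF_conv hν (bddTF_gamma3 hν).1 (hw 0) θ hσ, evalTF_conv hν h3.1 (hw 0) θ hσ,
    evalTF_conv hν (hw 0) (hw 0) θ hσ, evalTF_constTF, evalF_gamma3]
  ring

lemma SmoothTF.euler {p : ℕ → ℤ → ℂ} (hp : SmoothTF p) (θ : ℝ) {σ : ℝ} (hσ : σ ∈ Icc (-1 : ℝ) 1) :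
    evalTF (angTF p) θ σ + lam * σ * evalTF (derivTF p) θ σ =
      ∑' x : ℕ × ℤ, termTF (fun n m => (Complex.I * m + n * lam) * p n m) x (θ, σ) := by
  have h1 : HasSum (fun x => termTF (angTF p) x (θ, σ)) (evalTF (angTF p) θ σ) := by
    rw [evalTF_eq_tsum hp.ang (q := (θ, σ)) hσ]
    exact ((Summable.of_nonneg_of_le (fun _ => norm_nonneg _)
      (fun x => norm_termTF_le (angTF p) x (q := (θ, σ)) hσ) hp.ang).of_norm).hasSum
  have h2 := (tsum_shift hp (q := (θ, σ)) hσ).mul_left ((lam : ℂ) * σ)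
  rw [← (h1.add h2).tsum_eq]
  refine tsum_congr fun x => ?_
  rcases x with ⟨_ | n, m⟩
  · simp [termTF, angTF]
  · simp only [termTF, angTF, Nat.add_sub_cancel]
    ring

lemma evalTF_invariance (hν : 1 ≤ ν) (hlam : lam < 0) (hb : bundleMap a b l M (lam : ℂ) v = 0)
    (hw : MemX ν w) (hz : tfMap a b c lam v w = 0) (i : Fin 2) (θ : ℝ) {σ : ℝ}
    (hσ : σ ∈ Icc (-1 : ℝ) 1) :
    evalTF (angTF (w i)) θ σ + lam * σ * evalTF (derivTF (w i)) θ σ =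
      evalTF (rhs a b c w i) θ σ := by
  rw [(smoothTF_of_zero hν hlam hb hw hz i).euler θ hσ,
    evalTF_eq_tsum ((memX_rhs hν hw i).summable_norm hν) (q := (θ, σ)) hσ]
  simp only [symbol_mul_eq_rhs hb hz]

/-! ### Reality -/

/-- The coefficients of the conjugate pair of functions. -/
noncomputable def reflectX (w : Fin 2 → ℕ → ℤ → ℂ) : Fin 2 → ℕ → ℤ → ℂ :=
  fun i n => reflect (w i n)

lemma normF_reflect (s : ℤ → ℂ) : normF ν (reflect s) = normF ν s := by
  unfold normF
  rw [← (Equiv.neg ℤ).tsum_eq]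
  exact tsum_congr fun m => by simp [reflect]

lemma BddX.reflectX {C : ℝ} (h : BddX ν w C) : BddX ν (reflectX w) C := by
  refine bddX_iff.2 fun i => ⟨⟨fun n => ((bddX_iff.1 h i).1.1 n).reflect, ?_⟩, ?_⟩
  · refine (bddX_iff.1 h i).1.2.congr fun n => ?_
    exact (normF_reflect _).symm
  · refine le_trans (le_of_eq (tsum_congr fun n => ?_)) (bddX_iff.1 h i).2
    exact normF_reflect _

lemma convF_reflect (s t : ℤ → ℂ) : convF (reflect s) (reflect t) = reflect (convF s t) := by
  ext m
  rw [reflect, convF, convF, Complex.conj_tsum, ← (Equiv.neg ℤ).tsum_eq]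
  refine tsum_congr fun k => ?_
  simp only [reflect, Equiv.neg_apply, neg_neg, map_mul]
  congr 3
  ring

lemma convTF_reflect (p q : ℕ → ℤ → ℂ) :
    convTF (fun n => reflect (p n)) (fun n => reflect (q n)) = fun n => reflect (convTF p q n) := by
  ext n m
  simp only [convTF, reflect, map_sum]
  refine Finset.sum_congr rfl fun l _ => ?_
  exact congrFun (convF_reflect _ _) m

lemma reflect_constTF_gamma3 : (fun n => reflect (constTF gamma3 n)) = constTF gamma3 := by
  ext n m
  simp only [reflect, constTF, gamma3]
  split_ifs <;> first | omega | simp [Complex.conj_ofNat]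

lemma rhs_reflectX : rhs a b c (reflectX w) = reflectX (rhs a b c w) := by
  have h1 : convTF (constTF gamma3) (reflectX w 0) =
      fun n => reflect (convTF (constTF gamma3) (w 0) n) := by
    rw [← convTF_reflect, reflect_constTF_gamma3]; rfl
  have h2 : convTF (convTF (reflectX w 0) (reflectX w 0)) (reflectX w 0) =
      fun n => reflect (convTF (convTF (w 0) (w 0)) (w 0) n) := by
    rw [← convTF_reflect, ← convTF_reflect]; rfl
  funext i
  revert i
  rw [Fin.forall_fin_two, rhs_zero, rhs_one, h1, h2]
  refine ⟨rfl, ?_⟩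
  ext n m
  simp [reflectX, reflect, rhs_one]

/-- `f` has real coefficients, `γ⁽³⁾` and `v` are real functions, and conjugation turns the symbol
at `-m` into the symbol at `m`. -/
lemma tfMap_reflectX (hv : ∀ i, reflect (v i) = v i) :
    tfMap a b c lam v (reflectX w) = reflectX (tfMap a b c lam v w) := by
  ext i n m
  have hvm : (starRingEnd ℂ) (v i (-m)) = v i m := congrFun (hv i) m
  simp only [tfMap, rhs_reflectX]
  simp only [reflectX, reflect, tfMap]
  split_ifs
  · rfl
  · rw [map_sub, hvm]
  · simp

lemma evalTF_im_eq_zero (h : reflectX w = w) (i : Fin 2) (θ σ : ℝ) :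
    ((evalTF (w i) θ σ).re : ℂ) = evalTF (w i) θ σ := by
  have h1 := evalTF_reflect (w i) θ σ
  rw [show (fun n => reflect (w i n)) = w i from congrFun h i] at h1
  exact Complex.conj_eq_iff_re.1 h1.symm

/-! ### The parameterization -/

/-- The real function with Taylor–Fourier coefficients `w`. -/
noncomputable def paramW (w : Fin 2 → ℕ → ℤ → ℂ) (θ σ : ℝ) : Fin 4 → ℝ :=
  ![(evalTF (w 0) θ σ).re, (evalTF (w 1) θ σ).re, Real.cos (2 * θ), -2 * Real.sin (2 * θ)]

/-- The angular derivative of `paramW`. -/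
noncomputable def paramWang (w : Fin 2 → ℕ → ℤ → ℂ) (θ σ : ℝ) : Fin 4 → ℝ :=
  ![(evalTF (angTF (w 0)) θ σ).re, (evalTF (angTF (w 1)) θ σ).re, -2 * Real.sin (2 * θ),
    -4 * Real.cos (2 * θ)]

/-- The derivative of `paramW` in `σ`. -/
noncomputable def paramWder (w : Fin 2 → ℕ → ℤ → ℂ) (θ σ : ℝ) : Fin 4 → ℝ :=
  ![(evalTF (derivTF (w 0)) θ σ).re, (evalTF (derivTF (w 1)) θ σ).re, 0, 0]

/-- The real stable bundle. -/
noncomputable def bundleV (v : Fin 2 → ℤ → ℂ) (θ : ℝ) : Fin 4 → ℝ :=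
  ![(evalF (v 0) θ).re, (evalF (v 1) θ).re, 0, 0]

lemma forall_fin_four {P : Fin 4 → Prop} : (∀ i, P i) ↔ P 0 ∧ P 1 ∧ P 2 ∧ P 3 := by
  rw [Fin.forall_fin_succ, Fin.forall_fin_succ, Fin.forall_fin_succ, Fin.forall_fin_one]
  rfl

lemma partials_apply {E : Type*} [NormedAddCommGroup E] [NormedSpace ℝ E] (x y : E) (q : ℝ × ℝ) :
    partials x y q = q.1 • x + q.2 • y := rfl

lemma hasDerivAt_cos_two (θ : ℝ) :
    HasDerivAt (fun θ => Real.cos (2 * θ)) (-2 * Real.sin (2 * θ)) θ := by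
  have h : HasDerivAt (fun θ : ℝ => 2 * θ) 2 θ := by simpa using (hasDerivAt_id θ).const_mul 2
  exact h.cos.congr_deriv (by ring)

lemma hasDerivAt_sin_two (θ : ℝ) :
    HasDerivAt (fun θ => -2 * Real.sin (2 * θ)) (-4 * Real.cos (2 * θ)) θ := by
  have h : HasDerivAt (fun θ : ℝ => 2 * θ) 2 θ := by simpa using (hasDerivAt_id θ).const_mul 2
  exact (h.sin.const_mul (-2)).congr_deriv (by ring)

lemma hasFDerivWithinAt_paramW (hs : ∀ i, SmoothTF (w i)) {q : ℝ × ℝ} (hq : q ∈ strip) :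
    HasFDerivWithinAt (fun q : ℝ × ℝ => paramW w q.1 q.2)
      (partials (paramWang w q.1 q.2) (paramWder w q.1 q.2)) strip q := by
  have hre := fun i => (Complex.reCLM.hasFDerivAt (x := evalTF (w i) q.1 q.2)).comp_hasFDerivWithinAt q
    ((hs i).hasFDerivWithinAt hq)
  have hc := ((hasDerivAt_cos_two q.1).hasFDerivAt.comp q
    (hasFDerivAt_fst (𝕜 := ℝ) (p := q))).hasFDerivWithinAt (s := strip)
  have hd := ((hasDerivAt_sin_two q.1).hasFDerivAt.comp q
    (hasFDerivAt_fst (𝕜 := ℝ) (p := q))).hasFDerivWithinAt (s := strip)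
  rw [hasFDerivWithinAt_pi']
  rw [forall_fin_four]
  refine ⟨(hre 0).congr_fderiv ?_, (hre 1).congr_fderiv ?_, hc.congr_fderiv ?_,
    hd.congr_fderiv ?_⟩ <;>
  · ext <;> simp [partials, paramWang, paramWder]

lemma contDiffOn_paramW (hs : ∀ i, SmoothTF (w i)) :
    ContDiffOn ℝ 1 (fun q : ℝ × ℝ => paramW w q.1 q.2) strip := by
  rw [contDiffOn_pi, forall_fin_four]
  refine ⟨Complex.reCLM.contDiff.comp_contDiffOn (hs 0).contDiffOn,
    Complex.reCLM.contDiff.comp_contDiffOn (hs 1).contDiffOn, ?_, ?_⟩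
  · exact ContDiff.contDiffOn (by
      change ContDiff ℝ 1 fun q : ℝ × ℝ => Real.cos (2 * q.1)
      fun_prop)
  · exact ContDiff.contDiffOn (by
      change ContDiff ℝ 1 fun q : ℝ × ℝ => -2 * Real.sin (2 * q.1)
      fun_prop)

lemma paramW_invariance (hν : 1 ≤ ν) (hlam : lam < 0) (hb : bundleMap a b l M (lam : ℂ) v = 0)
    (hw : MemX ν w) (hz : tfMap a b c lam v w = 0) (hr : reflectX w = w) (θ : ℝ) {σ : ℝ}
    (hσ : σ ∈ Icc (-1 : ℝ) 1) :
    paramWang w θ σ + (lam * σ) • paramWder w θ σ = field a b c (paramW w θ σ) := by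
  have h0 := congrArg Complex.re (evalTF_invariance hν hlam hb hw hz 0 θ hσ)
  have h1 := congrArg Complex.re (evalTF_invariance hν hlam hb hw hz 1 θ hσ)
  rw [evalTF_rhs_one hν hw θ hσ, ← evalTF_im_eq_zero hr 0] at h1
  rw [rhs_zero] at h0
  simp only [← Complex.ofReal_mul, Complex.add_re, Complex.re_ofReal_mul] at h0
  have h1' : (evalTF (angTF (w 1)) θ σ).re + lam * σ * (evalTF (derivTF (w 1)) θ σ).re =
      -a * (evalTF (w 0) θ σ).re + b * Real.cos (2 * θ) * (evalTF (w 0) θ σ).re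
        + c * (evalTF (w 0) θ σ).re ^ 3 := by
    rw [← Complex.ofReal_re (-a * (evalTF (w 0) θ σ).re + b * Real.cos (2 * θ) *
      (evalTF (w 0) θ σ).re + c * (evalTF (w 0) θ σ).re ^ 3)]
    push_cast at h1 ⊢
    rw [← h1, Complex.add_re, ← Complex.ofReal_mul, Complex.re_ofReal_mul]
  funext i
  revert i
  rw [forall_fin_four]
  refine ⟨?_, ?_, ?_, ?_⟩
  · simpa [paramWang, paramWder, field, paramW] using h0
  · simpa [paramWang, paramWder, field, paramW] using h1'
  · simp [paramWang, paramWder, field, paramW]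
  · simp [paramWang, paramWder, field, paramW]

end

section

variable {ν : ℝ} {M : ℕ} {a b c lam l : ℝ} {v : Fin 2 → ℤ → ℂ} {w : Fin 2 → ℕ → ℤ → ℂ}

/-! ### The conjugacy and its consequences -/

lemma mem_strip {θ σ : ℝ} (hσ : σ ∈ Icc (-1 : ℝ) 1) : (θ, σ) ∈ strip := ⟨mem_univ _, hσ⟩

lemma hasDerivAt_paramW_ang (hs : ∀ i, SmoothTF (w i)) (θ : ℝ) {σ : ℝ} (hσ : σ ∈ Icc (-1 : ℝ) 1) :
    HasDerivAt (fun s => paramW w s σ) (paramWang w θ σ) θ := by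
  have h1 : HasDerivWithinAt (fun s : ℝ => (s, σ)) ((1 : ℝ), (0 : ℝ)) univ θ :=
    ((hasDerivAt_id θ).prodMk (hasDerivAt_const θ σ)).hasDerivWithinAt
  have h := (hasFDerivWithinAt_paramW hs (mem_strip (θ := θ) hσ)).comp_hasDerivWithinAt θ h1
    fun s _ => mem_strip hσ
  rw [hasDerivWithinAt_univ] at h
  exact h.congr_deriv (by simp [partials_apply])

lemma hasDerivWithinAt_paramW (hs : ∀ i, SmoothTF (w i)) (θ : ℝ) {σ : ℝ}
    (hσ : σ ∈ Icc (-1 : ℝ) 1) :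
    HasDerivWithinAt (paramW w θ) (paramWder w θ σ) (Icc (-1 : ℝ) 1) σ := by
  have h1 : HasDerivWithinAt (fun s : ℝ => (θ, s)) ((0 : ℝ), (1 : ℝ)) (Icc (-1 : ℝ) 1) σ :=
    ((hasDerivAt_const σ θ).prodMk (hasDerivAt_id σ)).hasDerivWithinAt
  have h := (hasFDerivWithinAt_paramW hs (mem_strip (θ := θ) hσ)).comp_hasDerivWithinAt σ h1
    fun s hs => mem_strip hs
  exact h.congr_deriv (by simp [partials_apply])

lemma exp_mul_mem (hlam : lam < 0) {t σ : ℝ} (ht : 0 ≤ t) (hσ : σ ∈ Icc (-1 : ℝ) 1) :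
    Real.exp (lam * t) * σ ∈ Icc (-1 : ℝ) 1 := by
  rw [mem_Icc, ← abs_le, abs_mul, Real.abs_exp]
  have h1 : Real.exp (lam * t) ≤ 1 := Real.exp_le_one_iff.2 (by nlinarith)
  exact mul_le_one₀ h1 (abs_nonneg _) (abs_le_one_of_mem hσ)

/-- The curve `(θ + t, e^{λt} σ)` has velocity `(1, λ e^{λt} σ)` and stays in the strip for `t ≥ 0`,
so the chain rule turns the invariance equation into the differential equation. -/
lemma isForwardOrbit_paramW (hlam : lam < 0) (hs : ∀ i, SmoothTF (w i))
    (hinv : ∀ θ, ∀ σ ∈ Icc (-1 : ℝ) 1,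
      paramWang w θ σ + (lam * σ) • paramWder w θ σ = field a b c (paramW w θ σ))
    (θ : ℝ) {σ : ℝ} (hσ : σ ∈ Icc (-1 : ℝ) 1) :
    IsForwardOrbit (field a b c) (fun t => paramW w (θ + t) (Real.exp (lam * t) * σ))
      (paramW w θ σ) := by
  refine ⟨by simp, fun t ht => ?_⟩
  have hmem := exp_mul_mem hlam ht hσ
  have h1 : HasDerivAt (fun t : ℝ => θ + t) 1 t := by simpa using (hasDerivAt_id t).const_add θ
  have h2 : HasDerivAt (fun t : ℝ => Real.exp (lam * t) * σ)
      (lam * (Real.exp (lam * t) * σ)) t := by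
    have : HasDerivAt (fun t : ℝ => lam * t) lam t := by
      simpa using (hasDerivAt_id t).const_mul lam
    exact (this.exp.mul_const σ).congr_deriv (by ring)
  have h := (hasFDerivWithinAt_paramW hs (mem_strip (θ := θ + t) hmem)).comp_hasDerivWithinAt t
    ((h1.prodMk h2).hasDerivWithinAt (s := Ici 0)) fun s hs => mem_strip (exp_mul_mem hlam hs hσ)
  refine h.congr_deriv ?_
  rw [partials_apply, one_smul, hinv _ _ hmem]

lemma contDiff_field : ContDiff ℝ 1 (field a b c) := by
  unfold field
  rw [contDiff_pi, forall_fin_four]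
  refine ⟨?_, ?_, ?_, ?_⟩
  · change ContDiff ℝ 1 fun u : Fin 4 → ℝ => u 1
    fun_prop
  · change ContDiff ℝ 1 fun u : Fin 4 → ℝ => -a * u 0 + b * u 2 * u 0 + c * u 0 ^ 3
    fun_prop
  · change ContDiff ℝ 1 fun u : Fin 4 → ℝ => u 3
    fun_prop
  · change ContDiff ℝ 1 fun u : Fin 4 → ℝ => -4 * u 2
    fun_prop

/-- Uniqueness of forward orbits. -/
lemma IsForwardOrbit.unique {U U' : ℝ → Fin 4 → ℝ} {p : Fin 4 → ℝ}
    (h : IsForwardOrbit (field a b c) U p) (h' : IsForwardOrbit (field a b c) U' p) {t : ℝ}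
    (ht : 0 ≤ t) : U t = U' t := by
  have hc : ∀ {U : ℝ → Fin 4 → ℝ}, IsForwardOrbit (field a b c) U p → ContinuousOn U (Icc 0 t) :=
    fun h s hs => (h.2 s hs.1).continuousWithinAt.mono Icc_subset_Ici_self
  -- The field is only locally Lipschitz, but both arcs lie in this compact set, on which one
  -- constant suffices.
  set S := U '' Icc 0 t ∪ U' '' Icc 0 t
  have hS : IsCompact S := (isCompact_Icc.image_of_continuousOn (hc h)).union
    (isCompact_Icc.image_of_continuousOn (hc h'))
  obtain ⟨K, hK⟩ := (contDiff_field (a := a) (b := b)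
    (c := c)).locallyLipschitz.locallyLipschitzOn.exists_lipschitzOnWith_of_compact hS
  exact ODE_solution_unique_of_mem_Icc_right (v := fun _ => field a b c) (s := fun _ => S)
    (fun _ _ => hK) (hc h) (fun s hs => (h.2 s hs.1).mono (Ici_subset_Ici.2 hs.1))
    (fun s hs => Or.inl ⟨s, ⟨hs.1, hs.2.le⟩, rfl⟩) (hc h')
    (fun s hs => (h'.2 s hs.1).mono (Ici_subset_Ici.2 hs.1))
    (fun s hs => Or.inr ⟨s, ⟨hs.1, hs.2.le⟩, rfl⟩) (by rw [h.1, h'.1]) ⟨ht, le_rfl⟩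

lemma evalTF_zero (p : ℕ → ℤ → ℂ) (θ : ℝ) : evalTF p θ 0 = evalF (p 0) θ := by
  unfold evalTF
  rw [tsum_eq_single 0 fun n hn => by simp [hn]]
  simp

lemma evalF_zero (θ : ℝ) : evalF 0 θ = 0 := by simp [evalF]

lemma paramW_zero (h0 : ∀ i, w i 0 = 0) (θ : ℝ) : paramW w θ 0 = gammaCurve θ := by
  simp [paramW, gammaCurve, evalTF_zero, h0, evalF_zero]

lemma paramWder_zero (h1 : ∀ i, w i 1 = v i) (θ : ℝ) : paramWder w θ 0 = bundleV v θ := by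
  have : ∀ i, derivTF (w i) 0 = v i := fun i => by ext m; simp [derivTF, h1]
  simp [paramWder, bundleV, evalTF_zero, this]

lemma deriv_paramW_zero (hs : ∀ i, SmoothTF (w i)) (h1 : ∀ i, w i 1 = v i) (θ : ℝ) :
    HasDerivAt (paramW w θ) (bundleV v θ) 0 := by
  rw [← paramWder_zero h1]
  exact (hasDerivWithinAt_paramW hs θ (by norm_num)).hasDerivAt (Icc_mem_nhds (by norm_num)
    (by norm_num))

lemma paramW_periodic (θ σ : ℝ) : paramW w (θ + 2 * π) σ = paramW w θ σ := by
  have h : ∀ p : ℕ → ℤ → ℂ, evalTF p (θ + 2 * π) σ = evalTF p θ σ := fun p => by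
    simp only [evalTF, evalF_periodic]
  have h2 : 2 * (θ + 2 * π) = 2 * θ + (2 : ℤ) * (2 * π) := by push_cast; ring
  simp only [paramW, h]
  rw [h2, Real.cos_add_int_mul_two_pi, Real.sin_add_int_mul_two_pi]

lemma bundleV_ne_zero (hv : ∀ θ, bundleFun v θ ≠ 0) (hr : ∀ i, reflect (v i) = v i) (θ : ℝ) :
    bundleV v θ ≠ 0 := fun h => by
  have hre : ∀ i, ((evalF (v i) θ).re : ℂ) = evalF (v i) θ := fun i =>
    Complex.conj_eq_iff_re.1 (by rw [← evalF_reflect, hr])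
  refine hv θ (Prod.ext ?_ ?_)
  · change evalF (v 0) θ = 0
    rw [← hre, show (evalF (v 0) θ).re = 0 from congrFun h 0, Complex.ofReal_zero]
  · change evalF (v 1) θ = 0
    rw [← hre, show (evalF (v 1) θ).re = 0 from congrFun h 1, Complex.ofReal_zero]

/-- Equal points have equal forward orbits. At times `2πk` the angle is again `θ` while both
parameters have shrunk by `q k → 0`, into a neighbourhood of `0` where strict differentiability with
derivative `V(θ) ≠ 0` excludes coincidence. -/
lemma injOn_paramW (hlam : lam < 0) (hs : ∀ i, SmoothTF (w i))
    (hinv : ∀ θ, ∀ σ ∈ Icc (-1 : ℝ) 1,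
      paramWang w θ σ + (lam * σ) • paramWder w θ σ = field a b c (paramW w θ σ))
    (h1 : ∀ i, w i 1 = v i) {θ : ℝ} (hV : bundleV v θ ≠ 0) :
    InjOn (paramW w θ) (Icc (-1 : ℝ) 1) := by
  intro σ hσ σ' hσ' heq
  have horb := isForwardOrbit_paramW (a := a) (b := b) (c := c) hlam hs hinv θ hσ
  have horb' := isForwardOrbit_paramW (a := a) (b := b) (c := c) hlam hs hinv θ hσ'
  rw [← heq] at horb'
  let q : ℕ → ℝ := fun k => Real.exp (lam * (k * (2 * π)))
  have hper : ∀ (k : ℕ) (s : ℝ), paramW w (θ + k * (2 * π)) s = paramW w θ s := fun k s => by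
    induction k with
    | zero => simp
    | succ k ih => rw [← ih, ← paramW_periodic (θ + k * (2 * π))]; push_cast; ring_nf
  have hk : ∀ k : ℕ, paramW w θ (q k * σ) = paramW w θ (q k * σ') := fun k => by
    have := horb.unique horb' (t := k * (2 * π)) (by positivity)
    simpa only [hper] using this
  have hq : Tendsto q atTop (𝓝 0) := by
    refine Real.tendsto_exp_atBot.comp ?_
    refine Tendsto.const_mul_atTop_of_neg hlam ?_
    exact tendsto_natCast_atTop_atTop.atTop_mul_const (by positivity)
  have hstrict : HasStrictDerivAt (paramW w θ) (bundleV v θ) 0 := by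
    have hcd : ContDiffAt ℝ 1 (paramW w θ) 0 := by
      have : ContDiffOn ℝ 1 (paramW w θ) (Icc (-1 : ℝ) 1) :=
        (contDiffOn_paramW hs).comp (f := fun s : ℝ => (θ, s)) (by fun_prop)
          fun s hs => mem_strip hs
      exact this.contDiffAt (Icc_mem_nhds (by norm_num) (by norm_num))
    have := hcd.hasStrictDerivAt one_ne_zero
    rwa [(deriv_paramW_zero hs h1 θ).deriv] at this
  have hlim : Tendsto (fun k => (q k * σ, q k * σ')) atTop (𝓝 ((0 : ℝ), (0 : ℝ))) := by
    have e1 := hq.mul_const σ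
    have e2 := hq.mul_const σ'
    rw [zero_mul] at e1 e2
    exact e1.prodMk_nhds e2
  have hlittle := (hasStrictFDerivAt_iff_isLittleO.1 hstrict.hasStrictFDerivAt).comp_tendsto hlim
  have hpos : 0 < ‖bundleV v θ‖ / 2 := by positivity
  -- With equal values the strict derivative estimate reads `‖V‖ |Δ| ≤ ‖V‖ |Δ| / 2` for the
  -- difference `Δ` of the two parameters.
  obtain ⟨k, hk'⟩ := (hlittle.def hpos).exists
  simp only [Function.comp, hk k, sub_self, zero_sub, norm_neg,
    ContinuousLinearMap.toSpanSingleton_apply, norm_smul] at hk'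
  have hzero : ‖q k * σ - q k * σ'‖ = 0 := by
    have h0 := norm_nonneg (q k * σ - q k * σ')
    have : 0 < ‖bundleV v θ‖ := norm_pos_iff.2 hV
    by_contra hne
    have : 0 < ‖q k * σ - q k * σ'‖ := lt_of_le_of_ne h0 (Ne.symm hne)
    nlinarith
  rw [norm_eq_zero, ← mul_sub] at hzero
  exact sub_eq_zero.1 ((mul_eq_zero.1 hzero).resolve_left (Real.exp_pos _).ne')

/-! ### Estimates near the orbit -/

lemma MemTF.norm_eval_le_mul (hν : 1 ≤ ν) {p : ℕ → ℤ → ℂ} (hp : MemTF ν p) (h0 : p 0 = 0)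
    (θ : ℝ) {σ : ℝ} (hσ : σ ∈ Icc (-1 : ℝ) 1) : ‖evalTF p θ σ‖ ≤ normTF ν p * |σ| := by
  have hle : ∀ n, ‖evalF (p n) θ * (σ : ℂ) ^ n‖ ≤ normF ν (p n) * |σ| := fun n => by
    have hn := normF_nonneg hν (p n)
    rcases n with _ | n
    · rw [h0, evalF_zero, zero_mul, norm_zero]
      exact mul_nonneg (normF_nonneg hν _) (abs_nonneg _)
    · rw [norm_mul, norm_pow, Complex.norm_real, Real.norm_eq_abs, pow_succ]
      refine mul_le_mul ((hp.1 _).norm_eval_le hν θ) ?_ (by positivity) hn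
      exact mul_le_of_le_one_left (abs_nonneg _)
        (pow_le_one₀ (abs_nonneg _) (abs_le_one_of_mem hσ))
  refine (norm_tsum_le_tsum_norm (hp.eval_summable hν θ hσ)).trans ?_
  rw [normTF, ← tsum_mul_right]
  exact (hp.eval_summable hν θ hσ).tsum_le_tsum hle (hp.2.mul_right _)

/-- Orders zero and one are removed, so `σ²` factors out; this controls the deviation of `W` from
its tangent line in `exists_orthogonal`. -/
lemma MemTF.norm_eval_sub_le (hν : 1 ≤ ν) {p : ℕ → ℤ → ℂ} (hp : MemTF ν p) (h0 : p 0 = 0)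
    (θ : ℝ) {σ : ℝ} (hσ : σ ∈ Icc (-1 : ℝ) 1) :
    ‖evalTF p θ σ - evalF (p 1) θ * σ‖ ≤ normTF ν p * σ ^ 2 := by
  have hs := (hp.eval_summable hν θ hσ).of_norm
  have e : evalTF p θ σ - evalF (p 1) θ * σ = ∑' n, evalF (p (n + 2)) θ * (σ : ℂ) ^ (n + 2) := by
    rw [evalTF, ← hs.sum_add_tsum_nat_add 2]
    simp [Finset.sum_range_succ, h0, evalF_zero]
  have hs2 : Summable fun n => ‖evalF (p (n + 2)) θ * (σ : ℂ) ^ (n + 2)‖ :=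
    (summable_nat_add_iff 2).2 (hp.eval_summable hν θ hσ)
  have hle : ∀ n, ‖evalF (p (n + 2)) θ * (σ : ℂ) ^ (n + 2)‖ ≤ normF ν (p (n + 2)) * σ ^ 2 :=
    fun n => by
      have hn := normF_nonneg hν (p (n + 2))
      rw [norm_mul, norm_pow, Complex.norm_real, Real.norm_eq_abs, pow_add, sq_abs]
      refine mul_le_mul ((hp.1 _).norm_eval_le hν θ) ?_ (by positivity) hn
      exact mul_le_of_le_one_left (sq_nonneg _)
        (pow_le_one₀ (abs_nonneg _) (abs_le_one_of_mem hσ))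
  have hS : Summable fun n => normF ν (p (n + 2)) := (summable_nat_add_iff 2).2 hp.2
  rw [e]
  refine (norm_tsum_le_tsum_norm hs2).trans ?_
  refine (hs2.tsum_le_tsum hle (hS.mul_right _)).trans ?_
  rw [tsum_mul_right]
  gcongr
  rw [normTF, ← hp.2.sum_add_tsum_nat_add 2]
  exact le_add_of_nonneg_left (Finset.sum_nonneg fun n _ => normF_nonneg hν _)

lemma gammaCurve_mem (θ : ℝ) : gammaCurve θ ∈ gammaOrbit := by
  have hper : Function.Periodic gammaCurve π := fun θ => by
    simp [gammaCurve, mul_add, Real.cos_add_two_pi, Real.sin_add_two_pi]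
  obtain ⟨y, hy, he⟩ := hper.exists_mem_Ico₀ Real.pi_pos θ
  exact ⟨y, hy, he.symm⟩

lemma image_subset_stableSet (hν : 1 ≤ ν) (hlam : lam < 0) (hw : MemX ν w)
    (hs : ∀ i, SmoothTF (w i)) (h0 : ∀ i, w i 0 = 0)
    (hinv : ∀ θ, ∀ σ ∈ Icc (-1 : ℝ) 1,
      paramWang w θ σ + (lam * σ) • paramWder w θ σ = field a b c (paramW w θ σ))
    (θ : ℝ) {σ : ℝ} (hσ : σ ∈ Icc (-1 : ℝ) 1) :
    paramW w θ σ ∈ stableSet (field a b c) gammaOrbit := by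
  refine ⟨_, isForwardOrbit_paramW hlam hs hinv θ hσ, ?_⟩
  have hlim : Tendsto (fun t => normX ν w * (Real.exp (lam * t) * |σ|)) atTop (𝓝 0) := by
    have : Tendsto (fun t : ℝ => Real.exp (lam * t)) atTop (𝓝 0) :=
      Real.tendsto_exp_atBot.comp (tendsto_id.const_mul_atTop_of_neg hlam)
    simpa using (this.mul_const |σ|).const_mul (normX ν w)
  refine squeeze_zero' (Eventually.of_forall fun t => Metric.infDist_nonneg) ?_ hlim
  filter_upwards [eventually_ge_atTop 0] with t ht
  have hmem := exp_mul_mem hlam ht hσ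
  refine (Metric.infDist_le_dist_of_mem (gammaCurve_mem (θ + t))).trans ?_
  have hX := normX_nonneg hν w
  rw [dist_pi_le_iff (by positivity), forall_fin_four]
  have hi : ∀ i, |(evalTF (w i) (θ + t) (Real.exp (lam * t) * σ)).re| ≤
      normX ν w * (Real.exp (lam * t) * |σ|) := fun i => by
    refine (Complex.abs_re_le_norm _).trans (((hw i).norm_eval_le_mul hν (h0 i) _ hmem).trans ?_)
    rw [abs_mul, Real.abs_exp]
    gcongr
    exact (bddX_iff.1 hw.bdd i).2
  refine ⟨?_, ?_, ?_, ?_⟩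
  · simpa [paramW, gammaCurve, Real.dist_eq] using hi 0
  · simpa [paramW, gammaCurve, Real.dist_eq] using hi 1
  · simp [paramW, gammaCurve]; positivity
  · simp [paramW, gammaCurve]; positivity

end

section

/-! ### Cone estimate along the stable bundle -/

/-- The conclusion is half the derivative of `D² - η S²`. Here `D` is the component across the
bundle, growing at rate `μ`, and `S` the component along it, decaying at rate `μ`; the coupling of
`D` into `S` and the perturbation `n` have to be absorbed by `μ D² + ημ S²`. -/
lemma cone_inequality {μ δ B H : ℝ} (hμ : 0 < μ) (hδ : 0 < δ) (hB : 0 < B) (hH : 0 ≤ H) :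
    ∃ η > 0, ∃ κ > 0, ∀ p q h D S n R : ℝ, R = p ^ 2 + q ^ 2 → δ ≤ R → |p| ≤ B → |q| ≤ B →
      |h| ≤ H → |n| ≤ κ * |p * S - q * D / R| →
      0 ≤ D * (μ * D + p * n) -
        η * (S * (-μ * S + (1 + h) * (p ^ 2 - q ^ 2) * D / R ^ 2 + q * n / R)) := by
  obtain ⟨k, hk⟩ : ∃ k, k = (1 + H) / δ := ⟨_, rfl⟩
  have hk0 : 0 < k := by rw [hk]; positivity
  -- `k` bounds the coupling coefficient. This `η` makes `ημ/2 S² + μ/4 D² - ηk|S||D|` a perfect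
  -- square.
  obtain ⟨η, hη⟩ : ∃ η, η = μ ^ 2 / (2 * k ^ 2) := ⟨_, rfl⟩
  have hη0 : 0 < η := by rw [hη]; positivity
  -- `C` adds up the coefficients of the four products of `|S|` and `|D|` produced by the
  -- perturbation, and `e` is what the square leaves of `μ` and `ημ`; hence the smallness `e / C`.
  obtain ⟨C, hC⟩ : ∃ C, C = B ^ 2 + B ^ 2 / δ + η * (B ^ 2 / δ) + η * (B ^ 2 / δ ^ 2) := ⟨_, rfl⟩
  have hC0 : 0 < C := by rw [hC]; positivity
  obtain ⟨e, he⟩ : ∃ e, e = min (3 / 4 * μ) (η * μ / 2) := ⟨_, rfl⟩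
  have he0 : 0 < e := by rw [he]; positivity
  refine ⟨η, hη0, e / C, by positivity, fun p q h D S n R hR hδR hp hq hh hn => ?_⟩
  have hR0 : 0 < R := hδ.trans_le hδR
  have hx : |p * S - q * D / R| ≤ B * |S| + B / δ * |D| := by
    refine (abs_sub _ _).trans ?_
    rw [abs_mul, abs_div, abs_mul, abs_of_pos hR0]
    have : |q| * |D| / R ≤ B * |D| / δ := by gcongr
    calc _ ≤ B * |S| + B * |D| / δ := by gcongr
      _ = _ := by ring
  obtain ⟨X, hX⟩ : ∃ X, X = B * |S| + B / δ * |D| := ⟨_, rfl⟩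
  have hX0 : 0 ≤ X := by rw [hX]; positivity
  rw [← hX] at hx
  have hn' : |n| ≤ e / C * X := hn.trans (by gcongr)
  have t1 : |D * (p * n)| ≤ |D| * (B * (e / C * X)) := by
    rw [abs_mul, abs_mul]; gcongr
  have t2 : |S * (q * n / R)| ≤ |S| * (B * (e / C * X) / δ) := by
    rw [abs_mul, abs_div, abs_mul, abs_of_pos hR0]; gcongr
  have t3 : |S * ((1 + h) * (p ^ 2 - q ^ 2) * D / R ^ 2)| ≤ |S| * (k * |D|) := by
    rw [abs_mul]
    gcongr
    rw [abs_div, abs_mul, abs_mul, abs_of_pos (by positivity : 0 < R ^ 2)]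
    have a1 : |1 + h| ≤ 1 + H := (abs_add_le _ _).trans (by rw [abs_one]; gcongr)
    have a2 : |p ^ 2 - q ^ 2| ≤ R := abs_le.2 ⟨by rw [hR]; nlinarith [sq_nonneg p],
      by rw [hR]; nlinarith [sq_nonneg q]⟩
    calc _ ≤ (1 + H) * R * |D| / R ^ 2 := by gcongr
      _ = (1 + H) * |D| / R := by field_simp
      _ ≤ (1 + H) * |D| / δ := by gcongr
      _ = _ := by rw [hk]; ring
  have hkS : η * (|S| * (k * |D|)) ≤ η * μ / 2 * S ^ 2 + μ / 4 * D ^ 2 := by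
    have : η * μ / 2 * S ^ 2 + μ / 4 * D ^ 2 - η * (|S| * (k * |D|)) =
        μ / 4 * (μ / k * |S| - |D|) ^ 2 := by
      rw [hη, ← sq_abs S, ← sq_abs D]; field_simp; ring
    have : 0 ≤ μ / 4 * (μ / k * |S| - |D|) ^ 2 := by positivity
    linarith
  have hsum : |D| * (B * (e / C * X)) + η * (|S| * (B * (e / C * X) / δ)) ≤
      e * (D ^ 2 + S ^ 2) := by
    have e1 : |D| * (B * (e / C * X)) + η * (|S| * (B * (e / C * X) / δ)) =
        e / C * (B ^ 2 * (|S| * |D|) + B ^ 2 / δ * |D| ^ 2 + η * (B ^ 2 / δ) * |S| ^ 2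
          + η * (B ^ 2 / δ ^ 2) * (|S| * |D|)) := by
      rw [hX]; field_simp; ring
    have hSD : |S| * |D| ≤ D ^ 2 + S ^ 2 := by
      have h1 := two_mul_le_add_sq |S| |D|
      have h2 : 0 ≤ |S| * |D| := by positivity
      rw [sq_abs, sq_abs] at h1
      linarith
    have hD2 : |D| ^ 2 ≤ D ^ 2 + S ^ 2 := by rw [sq_abs]; linarith [sq_nonneg S]
    have hS2 : |S| ^ 2 ≤ D ^ 2 + S ^ 2 := by rw [sq_abs]; linarith [sq_nonneg D]
    rw [e1]
    calc _ ≤ e / C * (B ^ 2 * (D ^ 2 + S ^ 2) + B ^ 2 / δ * (D ^ 2 + S ^ 2)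
          + η * (B ^ 2 / δ) * (D ^ 2 + S ^ 2) + η * (B ^ 2 / δ ^ 2) * (D ^ 2 + S ^ 2)) := by
          have a1 : (0 : ℝ) ≤ B ^ 2 / δ := by positivity
          have a2 : (0 : ℝ) ≤ η * (B ^ 2 / δ) := by positivity
          have a3 : (0 : ℝ) ≤ η * (B ^ 2 / δ ^ 2) := by positivity
          refine mul_le_mul_of_nonneg_left ?_ (div_pos he0 hC0).le
          exact add_le_add (add_le_add (add_le_add
            (mul_le_mul_of_nonneg_left hSD (sq_nonneg B)) (mul_le_mul_of_nonneg_left hD2 a1))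
            (mul_le_mul_of_nonneg_left hS2 a2)) (mul_le_mul_of_nonneg_left hSD a3)
      _ = e / C * C * (D ^ 2 + S ^ 2) := by rw [hC]; ring
      _ = _ := by rw [div_mul_cancel₀ _ hC0.ne']
  have he1 : e * D ^ 2 ≤ 3 / 4 * μ * D ^ 2 := by gcongr; rw [he]; exact min_le_left _ _
  have he2 : e * S ^ 2 ≤ η * μ / 2 * S ^ 2 := by gcongr; rw [he]; exact min_le_right _ _
  have s1 := neg_abs_le (D * (p * n))
  have s2 : η * (S * (q * n / R)) ≤ η * (|S| * (B * (e / C * X) / δ)) :=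
    mul_le_mul_of_nonneg_left ((le_abs_self _).trans t2) hη0.le
  have s3 : η * (S * ((1 + h) * (p ^ 2 - q ^ 2) * D / R ^ 2)) ≤ η * (|S| * (k * |D|)) :=
    mul_le_mul_of_nonneg_left ((le_abs_self _).trans t3) hη0.le
  have hfin : D * (μ * D + p * n) -
      η * (S * (-μ * S + (1 + h) * (p ^ 2 - q ^ 2) * D / R ^ 2 + q * n / R)) =
      μ * D ^ 2 + D * (p * n) + η * μ * S ^ 2 - η * (S * ((1 + h) * (p ^ 2 - q ^ 2) * D / R ^ 2))
        - η * (S * (q * n / R)) := by ring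
  rw [hfin]
  linarith

/-- A decaying solution of the perturbed variational equation whose initial value is orthogonal
to the stable bundle vanishes initially. -/
lemma eq_zero_of_orthogonal {μ δ B H : ℝ} (hμ : 0 < μ) (hδ : 0 < δ) (hB : 0 < B) (hH : 0 ≤ H) :
    ∃ κ > 0, ∀ p q h x y n : ℝ → ℝ,
      (∀ t, HasDerivAt p (q t + μ * p t) t) → (∀ t, HasDerivAt q (h t * p t + μ * q t) t) →
      (∀ t, δ ≤ p t ^ 2 + q t ^ 2) → (∀ t, |p t| ≤ B) → (∀ t, |q t| ≤ B) → (∀ t, |h t| ≤ H) →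
      (∀ t, 0 ≤ t → HasDerivWithinAt x (y t) (Ici 0) t) →
      (∀ t, 0 ≤ t → HasDerivWithinAt y (h t * x t + n t) (Ici 0) t) →
      (∀ t, 0 ≤ t → |n t| ≤ κ * |x t|) →
      Tendsto x atTop (𝓝 0) → Tendsto y atTop (𝓝 0) → p 0 * x 0 + q 0 * y 0 = 0 →
      x 0 = 0 ∧ y 0 = 0 := by
  obtain ⟨η, hη, κ, hκ, hcone⟩ := cone_inequality hμ hδ hB hH
  refine ⟨κ, hκ, fun p q h x y n hp hq hR hpB hqB hhH hx hy hn hx0 hy0 horth => ?_⟩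
  let R : ℝ → ℝ := fun t => p t ^ 2 + q t ^ 2
  -- The vector splits as `(x, y) = S (p, q) + (D / R) (-q, p)`.
  let D : ℝ → ℝ := fun t => p t * y t - q t * x t
  let S : ℝ → ℝ := fun t => (p t * x t + q t * y t) / R t
  let Q : ℝ → ℝ := fun t => D t ^ 2 - η * S t ^ 2
  have hRpos : ∀ t, 0 < R t := fun t => hδ.trans_le (hR t)
  have hD : ∀ t, 0 ≤ t → HasDerivWithinAt D (μ * D t + p t * n t) (Ici 0) t := fun t ht => by
    refine (((hp t).hasDerivWithinAt.mul (hy t ht)).sub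
      ((hq t).hasDerivWithinAt.mul (hx t ht))).congr_deriv ?_
    simp only [D]; ring
  have hRd : ∀ t, HasDerivAt R (2 * μ * R t + 2 * (1 + h t) * (p t * q t)) t := fun t => by
    refine (((hp t).pow 2).add ((hq t).pow 2)).congr_deriv ?_
    simp only [R]; push_cast; ring
  have hS : ∀ t, 0 ≤ t → HasDerivWithinAt S (-μ * S t +
      (1 + h t) * (p t ^ 2 - q t ^ 2) * D t / R t ^ 2 + q t * n t / R t) (Ici 0) t := fun t ht => by
    refine ((((hp t).hasDerivWithinAt.mul (hx t ht)).add
      ((hq t).hasDerivWithinAt.mul (hy t ht))).div (hRd t).hasDerivWithinAt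
        (hRpos t).ne').congr_deriv ?_
    have h0 := (hRpos t).ne'
    simp only [S, D, Pi.add_apply, Pi.mul_apply]
    field_simp
    simp only [R]
    ring
  have hQ : ∀ t, 0 ≤ t → HasDerivWithinAt Q (2 * (D t * (μ * D t + p t * n t) -
      η * (S t * (-μ * S t + (1 + h t) * (p t ^ 2 - q t ^ 2) * D t / R t ^ 2
        + q t * n t / R t)))) (Ici 0) t := fun t ht => by
    refine (((hD t ht).pow 2).sub (((hS t ht).pow 2).const_mul η)).congr_deriv ?_
    push_cast; ring
  have hxeq : ∀ t, p t * S t - q t * D t / R t = x t := fun t => by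
    have h0 := (hRpos t).ne'
    simp only [S, D]
    field_simp
    simp only [R]
    ring
  have hmono : MonotoneOn Q (Ici 0) := by
    refine monotoneOn_of_deriv_nonneg (convex_Ici 0)
      (fun t ht => (hQ t ht).continuousWithinAt) ?_ ?_
    · intro t ht
      rw [interior_Ici] at ht ⊢
      exact ((hQ t (le_of_lt ht)).hasDerivAt (Ici_mem_nhds ht)).differentiableAt.differentiableWithinAt
    · intro t ht
      rw [interior_Ici] at ht
      rw [((hQ t (le_of_lt ht)).hasDerivAt (Ici_mem_nhds ht)).deriv]
      refine mul_nonneg zero_le_two (hcone _ _ _ _ _ _ _ rfl (hR t) (hpB t) (hqB t) (hhH t) ?_)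
      rw [hxeq]
      exact hn t (le_of_lt ht)
  have hlim : Tendsto (fun t => (B * (|x t| + |y t|)) ^ 2) atTop (𝓝 0) := by
    have := ((hx0.abs.add hy0.abs).const_mul B).pow 2
    simpa using this
  have hQle : ∀ t, Q t ≤ (B * (|x t| + |y t|)) ^ 2 := fun t => by
    have h1 : |D t| ≤ B * (|x t| + |y t|) := by
      refine (abs_sub _ _).trans ?_
      rw [abs_mul, abs_mul]
      have e1 : |p t| * |y t| ≤ B * |y t| := by gcongr; exact hpB t
      have e2 : |q t| * |x t| ≤ B * |x t| := by gcongr; exact hqB t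
      linarith
    have h2 : D t ^ 2 ≤ (B * (|x t| + |y t|)) ^ 2 := by
      rw [← sq_abs]; gcongr
    have h3 : 0 ≤ η * S t ^ 2 := by positivity
    simp only [Q]; linarith
  -- A nondecreasing form bounded above by something tending to zero is nonpositive at the start;
  -- since `S 0 = 0` by orthogonality, `D 0` vanishes too.
  have hQ0 : Q 0 ≤ 0 := by
    refine ge_of_tendsto hlim ?_
    filter_upwards [eventually_ge_atTop 0] with t ht
    exact (hmono self_mem_Ici ht ht).trans (hQle t)
  have hS0 : S 0 = 0 := by simp only [S, horth, zero_div]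
  have hD0 : D 0 = 0 := by
    simp only [Q, hS0] at hQ0
    exact pow_eq_zero_iff two_ne_zero |>.1 (le_antisymm (by linarith) (sq_nonneg _))
  have hx' : x 0 = 0 := by rw [← hxeq 0, hS0, hD0]; simp
  refine ⟨hx', ?_⟩
  have h0 : R 0 * y 0 = 0 := by
    have : R 0 * y 0 = p 0 * D 0 + q 0 * (p 0 * x 0 + q 0 * y 0) := by
      simp only [R, D]; ring
    rw [this, hD0, horth]; ring
  exact (mul_eq_zero.1 h0).resolve_left (hRpos 0).ne'

/-! ### Orbits converging to the periodic orbit -/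

lemma abs_le_infDist_gammaOrbit (u : Fin 4 → ℝ) :
    |u 0| ≤ Metric.infDist u gammaOrbit ∧ |u 1| ≤ Metric.infDist u gammaOrbit := by
  have hne : gammaOrbit.Nonempty := ⟨_, mem_image_of_mem _ (left_mem_Ico.2 Real.pi_pos)⟩
  constructor <;> rw [Metric.le_infDist hne] <;> rintro _ ⟨θ, -, rfl⟩
  · simpa [gammaCurve, Real.dist_eq] using dist_le_pi_dist u (gammaCurve θ) 0
  · simpa [gammaCurve, Real.dist_eq] using dist_le_pi_dist u (gammaCurve θ) 1

/-- `4u₂² + u₃²` equals `4` on the orbit. The factors `3` and `5` below are `e + 2` and `e + 4` with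
`e ≤ 1`, and `17 = 4·3 + 5`. -/
lemma energy_of_infDist_lt {u : Fin 4 → ℝ} {e : ℝ} (he1 : e ≤ 1)
    (hu : Metric.infDist u gammaOrbit < e) : |4 * u 2 ^ 2 + u 3 ^ 2 - 4| ≤ 17 * e := by
  have hne : gammaOrbit.Nonempty := ⟨_, mem_image_of_mem _ (left_mem_Ico.2 Real.pi_pos)⟩
  obtain ⟨_, ⟨θ, -, rfl⟩, hd⟩ := (Metric.infDist_lt_iff hne).1 hu
  have h2 := (dist_le_pi_dist u (gammaCurve θ) 2).trans hd.le
  have h3 := (dist_le_pi_dist u (gammaCurve θ) 3).trans hd.le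
  simp only [gammaCurve, Real.dist_eq, Matrix.cons_val] at h2 h3
  have hcs := Real.sin_sq_add_cos_sq (2 * θ)
  have hc := abs_le.1 (Real.abs_cos_le_one (2 * θ))
  have hs := abs_le.1 (Real.abs_sin_le_one (2 * θ))
  set C := Real.cos (2 * θ)
  set S := Real.sin (2 * θ)
  have he0 : 0 ≤ e := (abs_nonneg _).trans h2
  have e2 : |4 * u 2 ^ 2 + u 3 ^ 2 - 4| =
      |4 * (u 2 - C) * (u 2 - C + 2 * C) + (u 3 - -2 * S) * (u 3 - -2 * S - 4 * S)| := by
    congr 1; linear_combination 4 * hcs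
  rw [e2]
  have b1 : |u 2 - C + 2 * C| ≤ 3 :=
    (abs_add_le _ _).trans (by rw [abs_mul, abs_two]; linarith [Real.abs_cos_le_one (2 * θ)])
  have b2 : |u 3 - -2 * S - 4 * S| ≤ 5 :=
    (abs_sub _ _).trans (by
      rw [abs_mul 4, abs_of_pos (by norm_num : (0 : ℝ) < 4)]
      linarith [Real.abs_sin_le_one (2 * θ)])
  calc _ ≤ 4 * |u 2 - C| * |u 2 - C + 2 * C| + |u 3 - -2 * S| * |u 3 - -2 * S - 4 * S| := by
        refine (abs_add_le _ _).trans_eq ?_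
        rw [abs_mul, abs_mul, abs_mul, abs_of_pos (by norm_num : (0 : ℝ) < 4)]
    _ ≤ 4 * e * 3 + e * 5 := by gcongr
    _ = _ := by ring

lemma const_of_hasDerivWithinAt_zero {f : ℝ → ℝ} (h : ∀ t, 0 ≤ t → HasDerivWithinAt f 0 (Ici 0) t)
    {t : ℝ} (ht : 0 ≤ t) : f t = f 0 := by
  have := (convex_Ici (0 : ℝ)).norm_image_sub_le_of_norm_hasDerivWithin_le (f := f)
    (f' := fun _ => 0) (C := 0) (x := 0) (y := t) (fun x hx => h x hx) (fun x _ => by simp)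
    self_mem_Ici ht
  simpa [sub_eq_zero] using this

lemma exists_angle {α β : ℝ} (h : α ^ 2 + β ^ 2 = 1) :
    ∃ θ, α = Real.cos (2 * θ) ∧ β = -Real.sin (2 * θ) := by
  set z : ℂ := ⟨α, -β⟩ with hz
  have hn : ‖z‖ = 1 := by
    rw [Complex.norm_def, Complex.normSq_mk, Real.sqrt_eq_one]; linarith
  have hz0 : z ≠ 0 := norm_ne_zero_iff.1 (by rw [hn]; exact one_ne_zero)
  refine ⟨z.arg / 2, ?_, ?_⟩
  · rw [mul_div_cancel₀ _ two_ne_zero, Complex.cos_arg hz0, hn, div_one]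
  · rw [mul_div_cancel₀ _ two_ne_zero, Complex.sin_arg, hn, div_one]; simp [hz]

/-- The last two components solve `u'' = -4u` independently of the others. Rotating the solution
back gives constants, and convergence to `γ` forces the conserved energy to be that of `γ`, so the
phase agrees exactly and not only asymptotically. -/
lemma orbit_phase {a b c : ℝ} {U : ℝ → Fin 4 → ℝ} {P : Fin 4 → ℝ}
    (hU : IsForwardOrbit (field a b c) U P)
    (hlim : Tendsto (fun t => Metric.infDist (U t) gammaOrbit) atTop (𝓝 0)) :
    ∃ θ, ∀ t, 0 ≤ t → U t 2 = Real.cos (2 * (θ + t)) ∧ U t 3 = -2 * Real.sin (2 * (θ + t)) := by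
  have hcomp : ∀ i t, 0 ≤ t → HasDerivWithinAt (fun t => U t i) (field a b c (U t) i) (Ici 0) t :=
    fun i t ht => hasDerivWithinAt_pi.1 (hU.2 t ht) i
  have h2 : ∀ t, 0 ≤ t → HasDerivWithinAt (fun t => U t 2) (U t 3) (Ici 0) t :=
    fun t ht => hcomp 2 t ht
  have h3 : ∀ t, 0 ≤ t → HasDerivWithinAt (fun t => U t 3) (-4 * U t 2) (Ici 0) t :=
    fun t ht => hcomp 3 t ht
  have hlin : ∀ t : ℝ, HasDerivAt (fun t : ℝ => 2 * t) 2 t := fun t => by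
    simpa using (hasDerivAt_id t).const_mul 2
  have hc : ∀ t : ℝ, HasDerivWithinAt (fun t => Real.cos (2 * t)) (-Real.sin (2 * t) * 2) (Ici 0) t :=
    fun t => (hlin t).cos.hasDerivWithinAt
  have hs : ∀ t : ℝ, HasDerivWithinAt (fun t => Real.sin (2 * t)) (Real.cos (2 * t) * 2) (Ici 0) t :=
    fun t => (hlin t).sin.hasDerivWithinAt
  have hα : ∀ t, 0 ≤ t → U t 2 * Real.cos (2 * t) - U t 3 / 2 * Real.sin (2 * t) = U 0 2 :=
    fun t ht => by
      have := const_of_hasDerivWithinAt_zero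
        (f := fun t => U t 2 * Real.cos (2 * t) - U t 3 / 2 * Real.sin (2 * t))
        (fun t ht => (((h2 t ht).mul (hc t)).sub (((h3 t ht).div_const 2).mul (hs t))).congr_deriv
          (by ring)) ht
      simpa using this
  have hβ : ∀ t, 0 ≤ t → U t 2 * Real.sin (2 * t) + U t 3 / 2 * Real.cos (2 * t) = U 0 3 / 2 :=
    fun t ht => by
      have := const_of_hasDerivWithinAt_zero
        (f := fun t => U t 2 * Real.sin (2 * t) + U t 3 / 2 * Real.cos (2 * t))
        (fun t ht => (((h2 t ht).mul (hs t)).add (((h3 t ht).div_const 2).mul (hc t))).congr_deriv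
          (by ring)) ht
      simpa using this
  have hen : U 0 2 ^ 2 + (U 0 3 / 2) ^ 2 = 1 := by
    by_contra hne
    have hpos : 0 < |4 * (U 0 2 ^ 2 + (U 0 3 / 2) ^ 2 - 1)| :=
      abs_pos.2 (mul_ne_zero (by norm_num) (sub_ne_zero.2 hne))
    set d := |4 * (U 0 2 ^ 2 + (U 0 3 / 2) ^ 2 - 1)|
    -- Any fraction of `d` below `1/17` works: the energy defect `d` would be at most `17d/18`.
    have he : 0 < min 1 (d / 18) := by positivity
    obtain ⟨t, hlt, ht⟩ := ((hlim.eventually (gt_mem_nhds he)).and (eventually_ge_atTop 0)).exists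
    have hE := energy_of_infDist_lt (min_le_left _ _) hlt
    have heq : 4 * U t 2 ^ 2 + U t 3 ^ 2 - 4 = 4 * (U 0 2 ^ 2 + (U 0 3 / 2) ^ 2 - 1) := by
      rw [← hβ t ht, ← hα t ht]
      linear_combination (-4 * (U t 2 ^ 2 + (U t 3 / 2) ^ 2)) * Real.sin_sq_add_cos_sq (2 * t)
    rw [heq] at hE
    have := min_le_right 1 (d / 18)
    have hE' : d ≤ 17 * min 1 (d / 18) := hE
    linarith
  obtain ⟨θ, h1, h4⟩ := exists_angle hen
  refine ⟨θ, fun t ht => ?_⟩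
  have e1 := hα t ht
  have e2 := hβ t ht
  rw [h1] at e1
  rw [h4] at e2
  have hcs := Real.sin_sq_add_cos_sq (2 * t)
  rw [mul_add, Real.cos_add, Real.sin_add]
  constructor
  · linear_combination (-U t 2) * hcs + Real.cos (2 * t) * e1 + Real.sin (2 * t) * e2
  · linear_combination (-U t 3) * hcs - 2 * Real.sin (2 * t) * e1 + 2 * Real.cos (2 * t) * e2

end

section

variable {ν : ℝ} {M : ℕ} {a b c lam l : ℝ} {v : Fin 2 → ℤ → ℂ} {w : Fin 2 → ℕ → ℤ → ℂ}

/-! ### The image contains the local stable set -/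

lemma continuousOn_paramW_apply (hs : ∀ i, SmoothTF (w i)) (θ : ℝ) (i : Fin 4) :
    ContinuousOn (fun σ => paramW w θ σ i) (Icc (-1 : ℝ) 1) := fun _ hσ =>
  (hasDerivWithinAt_pi.1 (hasDerivWithinAt_paramW hs θ hσ) i).continuousWithinAt

lemma hasDerivAt_bundleV (h : BundleODE a b lam (bundleFun v)) (θ : ℝ) :
    HasDerivAt (fun θ => bundleV v θ 0) (bundleV v θ 1 + -lam * bundleV v θ 0) θ ∧
    HasDerivAt (fun θ => bundleV v θ 1)
      ((-a + b * Real.cos (2 * θ)) * bundleV v θ 0 + -lam * bundleV v θ 1) θ := by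
  have h0 := Complex.reCLM.hasFDerivAt.comp_hasDerivAt θ (h.fst θ)
  have h1 := Complex.reCLM.hasFDerivAt.comp_hasDerivAt θ (h.snd θ)
  refine ⟨h0.congr_deriv ?_, h1.congr_deriv ?_⟩
  · simp only [bundleFun, bundleV, Complex.reCLM_apply, Complex.sub_re, Complex.re_ofReal_mul,
      Matrix.cons_val]
    ring
  · simp only [bundleFun, bundleV, Complex.reCLM_apply, Complex.sub_re, Complex.re_ofReal_mul,
      Matrix.cons_val]
    ring

lemma bundleV_lower_bound (h : BundleODE a b lam (bundleFun v)) (hV : ∀ θ, bundleV v θ ≠ 0) :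
    ∃ δ > 0, ∀ θ, δ ≤ bundleV v θ 0 ^ 2 + bundleV v θ 1 ^ 2 := by
  have hcont : Continuous fun θ => bundleV v θ 0 ^ 2 + bundleV v θ 1 ^ 2 := by
    have h0 : Continuous fun θ => bundleV v θ 0 :=
      continuous_iff_continuousAt.2 fun θ => (hasDerivAt_bundleV h θ).1.continuousAt
    have h1 : Continuous fun θ => bundleV v θ 1 :=
      continuous_iff_continuousAt.2 fun θ => (hasDerivAt_bundleV h θ).2.continuousAt
    exact (h0.pow 2).add (h1.pow 2)
  have hpos : ∀ θ, 0 < bundleV v θ 0 ^ 2 + bundleV v θ 1 ^ 2 := fun θ => by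
    refine lt_of_le_of_ne (by positivity) fun hz => hV θ ?_
    have h0 : bundleV v θ 0 = 0 := by nlinarith [sq_nonneg (bundleV v θ 0), sq_nonneg (bundleV v θ 1)]
    have h1 : bundleV v θ 1 = 0 := by nlinarith [sq_nonneg (bundleV v θ 0), sq_nonneg (bundleV v θ 1)]
    funext i
    revert i
    rw [forall_fin_four]
    exact ⟨h0, h1, rfl, rfl⟩
  obtain ⟨θ₀, -, hmin⟩ := isCompact_Icc.exists_isMinOn (nonempty_Icc.2 Real.two_pi_pos.le)
    hcont.continuousOn
  refine ⟨_, hpos θ₀, fun θ => ?_⟩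
  have hper : Function.Periodic (fun θ => bundleV v θ 0 ^ 2 + bundleV v θ 1 ^ 2) (2 * π) :=
    fun θ => by simp [bundleV, evalF_periodic]
  obtain ⟨y, hy, he⟩ := hper.exists_mem_Ico₀ Real.two_pi_pos θ
  have := hmin (Ico_subset_Icc_self hy)
  exact (show bundleV v θ₀ 0 ^ 2 + bundleV v θ₀ 1 ^ 2 ≤ _ from this).trans_eq he.symm

/-- With `(f, g)` tangent to `(p, q)` and `(x, y)` small, the scalar product is close to `-(p² + q²)
σ`, so it changes sign on `[-s₀, s₀]`. The constants precede `p, q, f, g`, so that one neighbourhood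
serves all angles. -/
lemma exists_orthogonal {C B δ ρ : ℝ} (hδ : 0 < δ) (hB : 0 < B) (hC : 0 < C) (hρ : 0 < ρ) :
    ∃ s₀ > 0, s₀ ≤ 1 ∧ C * s₀ ≤ ρ ∧ ∃ ε > 0, ε ≤ ρ ∧ ∀ (p q x y : ℝ) (f g : ℝ → ℝ),
      δ ≤ p ^ 2 + q ^ 2 → |p| ≤ B → |q| ≤ B → |x| < ε → |y| < ε →
      ContinuousOn f (Icc (-s₀) s₀) → ContinuousOn g (Icc (-s₀) s₀) →
      (∀ σ ∈ Icc (-s₀) s₀, |f σ - p * σ| ≤ C * σ ^ 2) →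
      (∀ σ ∈ Icc (-s₀) s₀, |g σ - q * σ| ≤ C * σ ^ 2) →
      ∃ σ ∈ Icc (-s₀) s₀, p * (x - f σ) + q * (y - g σ) = 0 := by
  -- `C s ≤ ρ` keeps the comparison orbit within `ρ`, and `4BCs ≤ δ` lets half of `sδ` absorb the
  -- quadratic error; `ε` below is chosen so that the other half absorbs the contribution of `x` and
  -- `y`.
  obtain ⟨s, hs⟩ : ∃ s, s = min 1 (min (ρ / C) (δ / (4 * B * C))) := ⟨_, rfl⟩
  have hs0 : 0 < s := by rw [hs]; positivity
  have hs1 : s ≤ 1 := by rw [hs]; exact min_le_left _ _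
  have hs2 : C * s ≤ ρ := by
    have : s ≤ ρ / C := by rw [hs]; exact (min_le_right _ _).trans (min_le_left _ _)
    rw [mul_comm]; exact (le_div_iff₀ hC).1 this
  have hs3 : s * (4 * B * C) ≤ δ := by
    have : s ≤ δ / (4 * B * C) := by rw [hs]; exact (min_le_right _ _).trans (min_le_right _ _)
    exact (le_div_iff₀ (by positivity)).1 this
  obtain ⟨ε, hε⟩ : ∃ ε, ε = min ρ (s * δ / (4 * B)) := ⟨_, rfl⟩
  have hε0 : 0 < ε := by rw [hε]; positivity
  have hε2 : ε * (4 * B) ≤ s * δ := by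
    have : ε ≤ s * δ / (4 * B) := by rw [hε]; exact min_le_right _ _
    exact (le_div_iff₀ (by positivity)).1 this
  refine ⟨s, hs0, hs1, hs2, ε, hε0, by rw [hε]; exact min_le_left _ _, ?_⟩
  intro p q x y f g hR hp hq hx hy hf hg hfe hge
  let G : ℝ → ℝ := fun σ => p * (x - f σ) + q * (y - g σ)
  have hG : ContinuousOn G (Icc (-s) s) :=
    (continuousOn_const.mul (continuousOn_const.sub hf)).add
      (continuousOn_const.mul (continuousOn_const.sub hg))
  have hbase : ∀ x' e : ℝ, ∀ p', |p'| ≤ B → |x'| ≤ e → |p' * x'| ≤ B * e := fun x' e p' hp' hx' => by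
    rw [abs_mul]; exact mul_le_mul hp' hx' (abs_nonneg _) hB.le
  have hdecomp : ∀ σ ∈ Icc (-s) s, |G σ + (p ^ 2 + q ^ 2) * σ| ≤ 2 * B * (ε + C * σ ^ 2) :=
    fun σ hσ => by
      have e : G σ + (p ^ 2 + q ^ 2) * σ =
          p * x + q * y + (-(p * (f σ - p * σ)) + -(q * (g σ - q * σ))) := by
        simp only [G]; ring
      rw [e]
      have b1 := hbase x ε p hp hx.le
      have b2 := hbase y ε q hq hy.le
      have b3 := hbase _ _ p hp (hfe σ hσ)
      have b4 := hbase _ _ q hq (hge σ hσ)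
      refine (abs_add_le _ _).trans ?_
      have c1 := abs_add_le (p * x) (q * y)
      have c2 := abs_add_le (-(p * (f σ - p * σ))) (-(q * (g σ - q * σ)))
      rw [abs_neg, abs_neg] at c2
      linarith
  have hsmall : 2 * B * (ε + C * s ^ 2) ≤ s * (p ^ 2 + q ^ 2) := by
    have h1 : 2 * B * (C * s ^ 2) ≤ s * δ / 2 := by
      have : s * (s * (4 * B * C)) ≤ s * δ := by gcongr
      linarith
    have h2 : s * δ ≤ s * (p ^ 2 + q ^ 2) := by gcongr
    linarith
  have hl := abs_le.1 (hdecomp (-s) ⟨le_rfl, by linarith⟩)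
  have hr := abs_le.1 (hdecomp s ⟨by linarith, le_rfl⟩)
  rw [neg_sq] at hl
  have hmem : (0 : ℝ) ∈ Icc (G s) (G (-s)) := ⟨by linarith [hr.2], by linarith [hl.1]⟩
  obtain ⟨σ, hσ, h⟩ := intermediate_value_Icc' (by linarith : -s ≤ s) hG hmem
  exact ⟨σ, hσ, h⟩

lemma localStableSet_subset_image (hν : 1 ≤ ν) (hlam : lam < 0) (hv : ∀ i, MemF ν (v i))
    (hode : BundleODE a b lam (bundleFun v)) (hV : ∀ θ, bundleV v θ ≠ 0) (hw : MemX ν w)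
    (hs : ∀ i, SmoothTF (w i)) (h0 : ∀ i, w i 0 = 0) (h1 : ∀ i, w i 1 = v i)
    (hinv : ∀ θ, ∀ σ ∈ Icc (-1 : ℝ) 1,
      paramWang w θ σ + (lam * σ) • paramWder w θ σ = field a b c (paramW w θ σ)) :
    ∃ O : Set (Fin 4 → ℝ), IsOpen O ∧ gammaOrbit ⊆ O ∧
      localStableSet (field a b c) gammaOrbit O ⊆
        {p | ∃ θ : ℝ, ∃ σ ∈ Icc (-1 : ℝ) 1, p = paramW w θ σ} := by
  obtain ⟨δ, hδ, hR⟩ := bundleV_lower_bound hode hV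
  obtain ⟨B, hBdef⟩ : ∃ B, B = normF ν (v 0) + normF ν (v 1) + 1 := ⟨_, rfl⟩
  have n0 := normF_nonneg hν (v 0)
  have n1 := normF_nonneg hν (v 1)
  have hB : 0 < B := by rw [hBdef]; positivity
  have hVB : ∀ θ, |bundleV v θ 0| ≤ B ∧ |bundleV v θ 1| ≤ B := fun θ => by
    have e0 := (Complex.abs_re_le_norm _).trans ((hv 0).norm_eval_le hν θ)
    have e1 := (Complex.abs_re_le_norm _).trans ((hv 1).norm_eval_le hν θ)
    constructor
    · change |(evalF (v 0) θ).re| ≤ B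
      linarith
    · change |(evalF (v 1) θ).re| ≤ B
      linarith
  obtain ⟨κ, hκ, hcone⟩ := eq_zero_of_orthogonal (neg_pos.2 hlam) hδ hB
    (by positivity : 0 ≤ |a| + |b|)
  -- When both orbits are within `ρ`, the factor `c(U₀² + U₀Z₀ + Z₀²)` of the difference of cubes is
  -- at most `3|c|ρ² ≤ κ`, as the cone estimate requires.
  obtain ⟨ρ, hρdef⟩ : ∃ ρ, ρ = min 1 (κ / (3 * |c| + 1)) := ⟨_, rfl⟩
  have hρ0 : 0 < ρ := by rw [hρdef]; positivity
  have hρκ : 3 * |c| * ρ ^ 2 ≤ κ := by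
    have r1 : ρ ≤ 1 := by rw [hρdef]; exact min_le_left _ _
    have r2 : ρ * (3 * |c| + 1) ≤ κ :=
      (le_div_iff₀ (by positivity)).1 (by rw [hρdef]; exact min_le_right _ _)
    have r3 : ρ ^ 2 ≤ ρ := by nlinarith
    have r4 : 3 * |c| * ρ ^ 2 ≤ 3 * |c| * ρ := by gcongr
    linarith
  obtain ⟨C, hCdef⟩ : ∃ C, C = normX ν w + 1 := ⟨_, rfl⟩
  have hX := normX_nonneg hν w
  have hC : 0 < C := by rw [hCdef]; positivity
  have hWi : ∀ i : Fin 2, normTF ν (w i) ≤ C := fun i => by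
    have := (bddX_iff.1 hw.bdd i).2
    linarith
  have hWle : ∀ i θ, ∀ σ ∈ Icc (-1 : ℝ) 1, |(evalTF (w i) θ σ).re| ≤ C * |σ| := fun i θ σ hσ =>
    (Complex.abs_re_le_norm _).trans (((hw i).norm_eval_le_mul hν (h0 i) θ hσ).trans
      (mul_le_mul_of_nonneg_right (hWi i) (abs_nonneg _)))
  have hWsub : ∀ i θ, ∀ σ ∈ Icc (-1 : ℝ) 1,
      |(evalTF (w i) θ σ).re - (evalF (v i) θ).re * σ| ≤ C * σ ^ 2 := fun i θ σ hσ => by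
    have e := (Complex.abs_re_le_norm _).trans (((hw i).norm_eval_sub_le hν (h0 i) θ hσ).trans
      (mul_le_mul_of_nonneg_right (hWi i) (sq_nonneg _)))
    rwa [Complex.sub_re, Complex.re_mul_ofReal, h1] at e
  obtain ⟨s₀, hs0, hs1, hCs, ε, hε, hερ, horth⟩ := exists_orthogonal hδ hB hC hρ0
  have hsub : Icc (-s₀) s₀ ⊆ Icc (-1 : ℝ) 1 := Icc_subset_Icc (by linarith) hs1
  -- Only the first two components need restricting: convergence to `γ` already determines the other
  -- two.
  refine ⟨{u | |u 0| < ε ∧ |u 1| < ε}, ?_, ?_, ?_⟩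
  · exact (isOpen_lt (continuous_apply 0).abs continuous_const).inter
      (isOpen_lt (continuous_apply 1).abs continuous_const)
  · rintro _ ⟨θ, -, rfl⟩
    simpa [gammaCurve] using hε
  rintro P ⟨U, hU, hUO, hlim⟩
  obtain ⟨θ, hphase⟩ := orbit_phase hU hlim
  have hU0 : Tendsto (fun t => U t 0) atTop (𝓝 0) :=
    squeeze_zero_norm (fun t => (abs_le_infDist_gammaOrbit (U t)).1) hlim
  have hU1 : Tendsto (fun t => U t 1) atTop (𝓝 0) :=
    squeeze_zero_norm (fun t => (abs_le_infDist_gammaOrbit (U t)).2) hlim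
  obtain ⟨σ, hσ, hσo⟩ := horth (bundleV v θ 0) (bundleV v θ 1) (U 0 0) (U 0 1)
    (fun σ => paramW w θ σ 0) (fun σ => paramW w θ σ 1) (hR θ) (hVB θ).1 (hVB θ).2
    (hUO 0 le_rfl).1 (hUO 0 le_rfl).2
    ((continuousOn_paramW_apply hs θ 0).mono hsub) ((continuousOn_paramW_apply hs θ 1).mono hsub)
    (fun σ hσ => hWsub 0 θ σ (hsub hσ)) (fun σ hσ => hWsub 1 θ σ (hsub hσ))
  have hσ1 := hsub hσ
  have hσs : |σ| ≤ s₀ := abs_le.2 hσ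
  have hZ := isForwardOrbit_paramW (a := a) (b := b) (c := c) hlam hs hinv θ hσ1
  set Z : ℝ → Fin 4 → ℝ := fun t => paramW w (θ + t) (Real.exp (lam * t) * σ) with hZdef
  have hZ2 : ∀ t, Z t 2 = Real.cos (2 * (θ + t)) := fun t => rfl
  have hZle : ∀ t, 0 ≤ t → |Z t 0| ≤ C * (Real.exp (lam * t) * |σ|) ∧
      |Z t 1| ≤ C * (Real.exp (lam * t) * |σ|) := fun t ht => by
    have e0 := hWle 0 (θ + t) _ (exp_mul_mem hlam ht hσ1)
    have e1 := hWle 1 (θ + t) _ (exp_mul_mem hlam ht hσ1)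
    rw [abs_mul, Real.abs_exp] at e0 e1
    exact ⟨e0, e1⟩
  have hZlim : Tendsto (fun t => C * (Real.exp (lam * t) * |σ|)) atTop (𝓝 0) := by
    have : Tendsto (fun t : ℝ => Real.exp (lam * t)) atTop (𝓝 0) :=
      Real.tendsto_exp_atBot.comp (tendsto_id.const_mul_atTop_of_neg hlam)
    simpa using (this.mul_const |σ|).const_mul C
  have hZ0 : Tendsto (fun t => Z t 0) atTop (𝓝 0) :=
    squeeze_zero_norm' ((eventually_ge_atTop 0).mono fun t ht => (hZle t ht).1) hZlim
  have hZ1 : Tendsto (fun t => Z t 1) atTop (𝓝 0) :=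
    squeeze_zero_norm' ((eventually_ge_atTop 0).mono fun t ht => (hZle t ht).2) hZlim
  have hZρ : ∀ t, 0 ≤ t → |Z t 0| ≤ ρ := fun t ht => by
    refine (hZle t ht).1.trans (le_trans ?_ hCs)
    have hexp : Real.exp (lam * t) ≤ 1 := Real.exp_le_one_iff.2 (by nlinarith)
    gcongr
    exact (mul_le_of_le_one_left (abs_nonneg _) hexp).trans hσs
  have hcomp : ∀ {U : ℝ → Fin 4 → ℝ} {P}, IsForwardOrbit (field a b c) U P → ∀ i t, 0 ≤ t →
      HasDerivWithinAt (fun t => U t i) (field a b c (U t) i) (Ici 0) t :=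
    fun h i t ht => hasDerivWithinAt_pi.1 (h.2 t ht) i
  have hshift : ∀ t : ℝ, HasDerivAt (fun t => θ + t) 1 t := fun t => by
    simpa using (hasDerivAt_id t).const_add θ
  -- Because the phases agree exactly, `cos 2(θ + t)` is the same for both orbits, and their
  -- difference obeys the variational equation along `γ` up to the difference of cubes.
  obtain ⟨hx, hy⟩ := hcone (fun t => bundleV v (θ + t) 0) (fun t => bundleV v (θ + t) 1)
    (fun t => -a + b * Real.cos (2 * (θ + t))) (fun t => U t 0 - Z t 0) (fun t => U t 1 - Z t 1)
    (fun t => c * (U t 0 ^ 2 + U t 0 * Z t 0 + Z t 0 ^ 2) * (U t 0 - Z t 0))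
    (fun t => ((hasDerivAt_bundleV hode (θ + t)).1.comp t (hshift t)).congr_deriv (mul_one _))
    (fun t => ((hasDerivAt_bundleV hode (θ + t)).2.comp t (hshift t)).congr_deriv (mul_one _))
    (fun t => hR _) (fun t => (hVB _).1) (fun t => (hVB _).2)
    (fun t => by
      refine (abs_add_le _ _).trans ?_
      rw [abs_neg, abs_mul]
      gcongr
      exact mul_le_of_le_one_right (abs_nonneg _) (Real.abs_cos_le_one _))
    (fun t ht => (hcomp hU 0 t ht).sub (hcomp hZ 0 t ht))
    (fun t ht => by
      refine ((hcomp hU 1 t ht).sub (hcomp hZ 1 t ht)).congr_deriv ?_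
      simp only [field, Matrix.cons_val]
      rw [(hphase t ht).1, hZ2]
      ring)
    (fun t ht => by
      have u1 : |U t 0| ≤ ρ := (hUO t ht).1.le.trans hερ
      have u2 := hZρ t ht
      rw [abs_mul, abs_mul]
      gcongr
      refine le_trans ?_ hρκ
      have : |U t 0 ^ 2 + U t 0 * Z t 0 + Z t 0 ^ 2| ≤ ρ ^ 2 + ρ * ρ + ρ ^ 2 := by
        refine (abs_add_le _ _).trans (add_le_add ((abs_add_le _ _).trans (add_le_add ?_ ?_)) ?_)
        · rw [abs_pow]; gcongr
        · rw [abs_mul]; gcongr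
        · rw [abs_pow]; gcongr
      calc _ ≤ |c| * (ρ ^ 2 + ρ * ρ + ρ ^ 2) := by gcongr
        _ = _ := by ring)
    (by simpa using hU0.sub hZ0) (by simpa using hU1.sub hZ1)
    (by simpa [hZdef] using hσo)
  refine ⟨θ, σ, hσ1, ?_⟩
  rw [← hU.1, ← hZ.1]
  funext i
  revert i
  rw [forall_fin_four]
  refine ⟨sub_eq_zero.1 hx, sub_eq_zero.1 hy, ?_, ?_⟩
  · rw [(hphase 0 le_rfl).1]; rfl
  · rw [(hphase 0 le_rfl).2]; rfl

/-! ### The error bound -/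

lemma SuppIn.evalTF_eq {N : ℕ} {p : ℕ → ℤ → ℂ} (hp : SuppIn N M p) (θ σ : ℝ) :
    evalTF p θ σ = ∑ n ∈ Finset.Icc 0 N, ∑ m ∈ Finset.Icc (-(M : ℤ)) M,
      p n m * Complex.exp (Complex.I * m * θ) * (σ : ℂ) ^ n := by
  have h1 : ∀ n, evalF (p n) θ = ∑ m ∈ Finset.Icc (-(M : ℤ)) M,
      p n m * Complex.exp (Complex.I * m * θ) := fun n =>
    tsum_eq_sum fun m hm => by
      rw [Finset.mem_Icc] at hm
      rw [hp n m (by omega), zero_mul]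
  have h2 : ∀ n ∉ Finset.Icc 0 N, evalF (p n) θ * (σ : ℂ) ^ n = 0 := fun n hn => by
    rw [Finset.mem_Icc] at hn
    rw [h1, Finset.sum_eq_zero fun m _ => by rw [hp n m (by omega), zero_mul], zero_mul]
  rw [evalTF, tsum_eq_sum h2]
  exact Finset.sum_congr rfl fun n _ => by rw [h1, Finset.sum_mul]

end

end GrossPitaevskii

/-! ### Assembly of the validation theorem -/

open GrossPitaevskii
theorem mainTheorem5
    (a b c : ℝ) (hc : c ≠ 0) (ν : ℝ) (hν : 1 ≤ ν) (l : ℝ) (hl : l ≠ 0)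
    (N M : ℕ) (hN : 1 ≤ N) (hM : 1 ≤ M)
    -- the bundle solution `(lam, v)`, within `rF` of the approximation `(lamBar, vbar)`
    (lam : ℝ) (hlam : lam < 0) (v : Fin 2 → ℤ → ℂ) (hv : ∀ i, MemF ν (v i))
    (hbundle : bundleMap a b l M (lam : ℂ) v = 0)
    (lamBar : ℂ) (vbar : Fin 2 → ℤ → ℂ) (rF : ℝ)
    (hlamBar : ‖(lam : ℂ) - lamBar‖ ≤ rF)
    (hvbar : ∀ i, normF ν (v i - vbar i) ≤ rF)
    -- the approximate Taylor–Fourier zero and the finite matrix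
    (wbar : Fin 2 → ℕ → ℤ → ℂ)
    (hsupp : wbar = trunc (Finset.Icc 0 N) (Finset.Icc 0 M) wbar)
    (hwbar0 : ∀ i m, wbar i 0 m = 0) (hwbar1 : ∀ i m, wbar i 1 m = vbar i m)
    (Abar : Matrix (Fin 2 × ℕ × ℤ) (Fin 2 × ℕ × ℤ) ℂ)
    -- the Newton–Kantorovich inequalities
    (rStar : ℝ) (hrStar : 0 < rStar) (Y Z1 Z2 rTF : ℝ)
    (hY : Y = boundY a b c ν lam rF N M Abar v wbar)
    (hZ1 : Z1 = boundZ1 a b c ν lam N M Abar wbar)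
    (hZ2 : Z2 = boundZ2 c ν lam N M Abar wbar rStar)
    (hrTF : rTF = nkRadius Y Z1 Z2)
    (hZ1_lt : Z1 < 1) (hZ2_lt : 2 * Y * Z2 < (1 - Z1) ^ 2) (hrTF_le : rTF ≤ rStar) :
    ∃ w : Fin 2 → ℕ → ℤ → ℂ,
      (MemX ν w ∧ normX ν (w - wbar) ≤ rTF ∧ tfMap a b c lam v w = 0) ∧
      (∀ w' : Fin 2 → ℕ → ℤ → ℂ,
        MemX ν w' → normX ν (w' - wbar) ≤ rTF → tfMap a b c lam v w' = 0 → w' = w) ∧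
      ((∀ i n k, wbar i n k = (starRingEnd ℂ) (wbar i n (-k))) →
        ∃ (V : ℝ → Fin 4 → ℝ) (W : ℝ → ℝ → Fin 4 → ℝ),
          -- `V` is the real stable bundle with Fourier coefficients `(v, 0, 0)`
          (∀ θ : ℝ, (V θ 0 : ℂ) = evalF (v 0) θ ∧ (V θ 1 : ℂ) = evalF (v 1) θ ∧
            V θ 2 = 0 ∧ V θ 3 = 0) ∧
          -- `W` is the real function with Taylor–Fourier coefficients `w`
          (∀ θ : ℝ, ∀ σ ∈ Set.Icc (-1 : ℝ) 1, ∀ i : Fin 4,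
            (W θ σ i : ℂ) = evalTF (fullCoeff w i) θ σ) ∧
          IsLocalStableParam (field a b c) gammaCurve gammaOrbit lam V W ∧
          (∀ θ : ℝ, ∀ σ ∈ Set.Icc (-1 : ℝ) 1, ∀ i : Fin 2,
            ‖(W θ σ (Fin.castLE (by norm_num) i) : ℂ) -
              (∑ n ∈ Finset.Icc 0 N, ∑ m ∈ Finset.Icc (-(M : ℤ)) M,
                wbar i n m * Complex.exp (Complex.I * m * θ) * (σ : ℂ) ^ n)‖ ≤ rTF)) := by
  have hsuppIn : ∀ i, SuppIn N M (wbar i) := fun i n m h => by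
    rw [hsupp, trunc_block_apply, if_neg h]
  have hvbarF : ∀ i, MemF ν (vbar i) := fun i =>
    memF_of_finite (Finset.Icc (-(M : ℤ)) M) fun m hm => by
      rw [Finset.mem_Icc] at hm
      rw [← hwbar1]
      exact hsuppIn i 1 m (by omega)
  have hr : ∀ i, BddF ν (vbar i - v i) rF := fun i => by
    have e : vbar i - v i = vbar i + (-1 : ℂ) • v i := by ext; simp; ring
    refine ⟨by rw [e]; exact (hvbarF i).add hν ((hv i).smul _), ?_⟩
    have : normF ν (vbar i - v i) = normF ν (v i - vbar i) :=
      tsum_congr fun m => by simp [norm_sub_rev]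
    rw [this]; exact hvbar i
  have hwbarX : MemX ν wbar := memX_of_mem_blockSub hν (show wbar ∈ blockSub N M from hsuppIn)
  obtain ⟨w, hwr, hz, huniq⟩ := exists_unique_zero hc hν hN hM hlam hsuppIn hwbar0 hwbar1 hr
    hrStar hY hZ1 hZ2 hrTF hZ1_lt hZ2_lt hrTF_le
  have hball : ∀ {w' : Fin 2 → ℕ → ℤ → ℂ}, MemX ν w' → normX ν (w' - wbar) ≤ rTF →
      BddX ν (w' - wbar) rTF := fun hw' h => ⟨(hw'.bdd.sub hν hwbarX.bdd).1, h⟩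
  have hw : MemX ν w := by simpa using (hwr.add hν hwbarX.bdd).1
  refine ⟨w, ⟨hw, hwr.2, hz⟩, fun w' hw' h h' => huniq w' (hball hw' h) h', fun hsymm => ?_⟩
  have hvr := reflect_bundle hν hl hlam hv hbundle
  -- Conjugation fixes `wbar` and `v`, preserves norms and commutes with `F`, so the conjugate of
  -- `w` is another zero in the ball.
  have hwr' : reflectX w = w := by
    have e : reflectX w - wbar = reflectX (w - wbar) := by
      ext i n m
      simp only [reflectX, reflect, Pi.sub_apply, map_sub]
      rw [hsymm i n m]
    refine huniq _ (by rw [e]; exact hwr.reflectX) ?_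
    rw [tfMap_reflectX hvr, hz]
    ext i n m
    simp [reflectX, reflect]
  obtain ⟨h0, h1⟩ := tfMap_zero_spec hz
  have hs := smoothTF_of_zero hν hlam hbundle hw hz
  have hinv : ∀ θ, ∀ σ ∈ Icc (-1 : ℝ) 1,
      paramWang w θ σ + (lam * σ) • paramWder w θ σ = field a b c (paramW w θ σ) :=
    fun θ σ hσ => paramW_invariance hν hlam hbundle hw hz hwr' θ hσ
  have hode := bundleODE_bundleFun hν hv hbundle
  have hV := bundleV_ne_zero (bundleFun_ne_zero hν hl hv hbundle) hvr
  have hvre : ∀ i θ, ((evalF (v i) θ).re : ℂ) = evalF (v i) θ := fun i θ =>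
    Complex.conj_eq_iff_re.1 (by rw [← evalF_reflect, hvr])
  have hwre := evalTF_im_eq_zero hwr'
  refine ⟨bundleV v, paramW w, fun θ => ⟨hvre 0 θ, hvre 1 θ, rfl, rfl⟩, fun θ σ _ => ?_, ?_, ?_⟩
  · rw [forall_fin_four]
    refine ⟨hwre 0 θ σ, hwre 1 θ σ, ?_, ?_⟩
    · change ((Real.cos (2 * θ) : ℝ) : ℂ) = evalTF (constTF gamma3) θ σ
      rw [evalTF_constTF, evalF_gamma3]
    · change ((-2 * Real.sin (2 * θ) : ℝ) : ℂ) = evalTF (constTF gamma4) θ σ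
      rw [evalTF_constTF, evalF_gamma4]
  · exact {
      periodic := fun θ σ _ => paramW_periodic θ σ
      contDiffOn := contDiffOn_paramW hs
      injOn := fun θ => injOn_paramW hlam hs hinv h1 (hV θ)
      invariance := fun θ σ hσ => by
        rw [(hasDerivAt_paramW_ang hs θ hσ).deriv, (hasDerivWithinAt_paramW hs θ hσ).derivWithin
          (uniqueDiffOn_Icc (by norm_num) σ hσ)]
        exact hinv θ σ hσ
      zeroth_order := paramW_zero h0
      first_order := fun θ => (deriv_paramW_zero hs h1 θ).deriv
      conjugacy := fun θ σ hσ => isForwardOrbit_paramW hlam hs hinv θ hσ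
      image_subset := by
        rintro _ ⟨θ, σ, hσ, rfl⟩
        exact image_subset_stableSet hν hlam hw hs h0 hinv θ hσ
      subset_image := localStableSet_subset_image hν hlam hv hode hV hw hs h0 h1 hinv }
  · intro θ σ hσ i
    have hcast : (paramW w θ σ (Fin.castLE (by norm_num) i) : ℂ) = evalTF (w i) θ σ := by
      revert i
      rw [Fin.forall_fin_two]
      exact ⟨hwre 0 θ σ, hwre 1 θ σ⟩
    -- The error function has coefficients `w - wbar`, and evaluation on the strip is bounded by the
    -- norm.
    have hd := bddX_iff.1 hwr i
    have hsplit := evalTF_add hν hd.1 (hwbarX i) θ hσ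
    rw [Pi.sub_apply, sub_add_cancel] at hsplit
    rw [hcast, ← (hsuppIn i).evalTF_eq, hsplit, add_sub_cancel_right]
    exact (MemTF.norm_eval_le hν hd.1 θ hσ).trans hd.2
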